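/- **Setting.** Let $\mathfrak g$ be a finite-dimensional simple Lie algebra over $\mathbb C$ with Killing form $\langle\cdot|\cdot\rangle$, and let $f\in\mathfrak g$ be nilpotent. Let $\mathfrak g=\bigoplus_{i\in\mathbb Z}\mathfrak g_i$ be a good grading for $f$: a Lie algebra grading with $f\in\mathfrak g_{-2}$ such that $\operatorname{ad}f:\mathfrak g_j\to\mathfrak g_{j-2}$ is injective for $j\ge1$ and surjective for $j\le1$. Let $h\in\mathfrak g_0$, $e\in\mathfrak g_2$ satisfy $[e,f]=h$, $[h,e]=2e$, $[h,f]=-2f$. Let $\mathfrak l\subset\mathfrak g_{-1}$ be isotropic for $(x,y)=\langle e|[x,y]\rangle$, let $\mathfrak l'=\{x\in\mathfrak g_{-1}:(x,\mathfrak l)=0\}$, and put $$\mathfrak g_{\rm neg}=\mathfrak l\oplus\bigoplus_{i\le-2}\mathfrak g_i,\qquad \mathfrak n=\mathfrak l'\oplus\bigoplus_{i\le-2}\mathfrak g_i,\qquad \mathfrak b=\mathfrak n^{\perp},\qquad \mathfrak g_f=\ker\operatorname{ad}f .$$ Fix $a\in\mathfrak g$ with $[a,\mathfrak n]=0$ and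 $\varepsilon\in\mathbb C\setminus\{0\}$. For a subspace $W\subset\mathfrak g$, $\mathcal L(W)$ denotes the smooth maps $S^1=\mathbb R/\mathbb Z\to W$. On $\mathcal L(\mathfrak g)$ put $(u|v)=\int_{S^1}\langle u|v\rangle\,dx$ and $$P_1(q)(v)=\tfrac1\varepsilon[a,v],\qquad P_2(q)(v)=\tfrac1\varepsilon[\varepsilon\partial_x+q,v],\qquad P_\lambda=P_2+\lambda P_1 .$$ On an affine subspace $X$ of $\mathcal L(\mathfrak g)$, a differential polynomial is a polynomial (with constant coefficients) in the coordinates of $q$ and their $x$-derivatives. A local functional is $q\mapsto\int_{S^1}p\,dx$, where $p$ is a polynomial in the same variables with coefficients in $C^\infty(S^1,\mathbb C)$. The gradient $\delta F$ is taken with respect to $(\cdot|\cdot)$, and $\{F,G\}_i=(\delta F|P_i\,\delta G)$, $\{F,G\}_\lambda=(\delta F|P_\lambda\,\delta G)$. For $m\in\mathcal L(\mathfrak n)$ the gauge transformation is $m\cdot q=\exp(-\operatorname{ad}m)(\varepsilon\partial_x+q)-\varepsilon\partial_x$. The adjoint group of $\mathcal L(W)$, $W\in\{\mathfrak n,\mathfrak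 g_{\rm neg}\}$, is the group generated by the $\exp(\operatorname{ad}m)$, $m\in\mathcal L(W)$, acting on the operators $c\,\partial_x+q$; it acts on $\mathcal L(\mathfrak g)$ by $u\cdot q=u(\varepsilon\partial_x+q)-\varepsilon\partial_x$. Given $S\subset\mathcal L(\mathfrak g)$, a distribution $D$ and a quotient $\pi:S\to N$, a local functional on $N$ is a function $k:N\to\mathbb C$ such that $k\circ\pi$ is a local functional on $S$. A lift of $k$ is a local functional on $\mathcal L(\mathfrak g)$ that equals $k\circ\pi$ on $S$ and whose differential vanishes on $D$ at the points of $S$. The reduced bracket is $\{k_1,k_2\}^N_\lambda\circ\pi=\{K_1,K_2\}_\lambda|_S$ for lifts $K_i$ of $k_i$. * *Generalized Drinfeld–Sokolov reduction.* $J:\mathcal L(\mathfrak g)\to\mathcal L(\mathfrak n)^*$ is $J(q)=(q|\cdot)$, $S=J^{-1}(J(e))$, $D$ is the tangent distribution of the orbits of the adjoint group of $\mathcal L(\mathfrak n)$, and $N=S/G_e$, with $G_e$ the isotropy group of $J(e)$ in that group for the coadjoint action. * *Generalized bihamiltonian reduction.* $\Xi$ is the set of local functionals that are Casimirs of $P_1$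 with gradient in $\mathcal L(\mathfrak n)$, $S$ is the level surface of $\Xi$ through $e$, $D$ is spanned by the vector fields $P_2(\delta K)$, $K\in\Xi$, and $N$ is the space of leaves of $D\cap TS$ on $S$, two points being on the same leaf if they are joined by a finite chain of smooth paths in $S$ tangent to $D$. **Theorem.** Local functionals on $\mathcal L(\mathfrak g)$ have unique gradients, and local functionals on $Q=e+\mathcal L(\mathfrak g_f)$ have gradients. The gauge action of the adjoint group of $\mathcal L(\mathfrak n)$ is Hamiltonian for every $P_\lambda$ (the fundamental vector field of $m$ is $P_\lambda$ applied to the gradient of $\varepsilon J(\cdot)(m)$), with equivariant momentum map $J$; $G_e$ is the adjoint group of $\mathcal L(\mathfrak g_{\rm neg})$; and $\Xi$ is closed under $\{\cdot,\cdot\}_2$. The generalized Drinfeld–Sokolov reduction and the generalized bihamiltonian reduction coincide: they have the same $S$, the same $D$ and the same quotient $N$, hence the same reduced brackets. Moreover: 1. $S=e+\mathcal L(\mathfrak b)$, $D_q=P_2(q)(\mathcal L(\mathfrak n))$ for all $q$, $D_s\cap\mathcal L(\mathfrak b)=P_2(s)(\mathcal L(\mathfrak g_{\rm neg}))$ for $s\in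 S$, and the fibres of $S\to N$ are the orbits of the adjoint group of $\mathcal L(\mathfrak g_{\rm neg})$ on $S$. 2. $Q$ is contained in $S$; $\mathcal L(\mathfrak b)=P_2(q)(\mathcal L(\mathfrak g_{\rm neg}))\oplus\mathcal L(\mathfrak g_f)$ for $q\in Q$; and for every $s\in S$ there is a unique $m\in\mathcal L(\mathfrak g_{\rm neg})$ with $m\cdot s\in Q$. Sending the class of $s$ to $m\cdot s$ is a bijection $\Psi:N\to Q$ that identifies the local functionals on $N$ with those on $Q$. 3. Let $R$ be the ring of differential polynomials on $S$ that are invariant under the adjoint group of $\mathcal L(\mathfrak g_{\rm neg})$. It is generated, as a differential ring over $\mathbb C$, by the coordinates of the map $\Psi\circ\pi:S\to Q$. 4. Every local functional on $N$ has a lift. For every basis $\xi_1,\dots,\xi_m$ of $\mathfrak g_f$, with coordinates $q^1,\dots,q^m$ on $Q$, there are matrix differential operators $A_1,A_2$ whose coefficients are differential polynomials on $Q$, such that for every $\lambda\in\mathbb C$ the bracket $$\{F,G\}^Q_\lambda=\int_{S^1}\sum_{j,k}\frac{\delta F}{\delta q^j}\,(A_2+\lambda A_1)^{jk}\,\frac{\delta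 G}{\delta q^k}\,dx$$ is a Poisson bracket (bilinear, antisymmetric, Jacobi) on the local functionals on $Q$ and corresponds under $\Psi$ to the reduced bracket of $\{\cdot,\cdot\}_\lambda$ on $N$. So $A_1,A_2$ define a local bihamiltonian structure $P_1^Q,P_2^Q$ on $Q$. The reduced bracket of $k_1,k_2$ at $\pi(s)$ equals $(v_1|P_\lambda(s)v_2)$ for any $v_i\in\mathcal L(\mathfrak g)$ that represent the differentials of $k_i\circ\pi$ along $S$ at $s$ and annihilate $D_s$. 5. The functionals on $N$ with densities in $R$ are closed under both reduced brackets. -/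

import Mathlib

open scoped ContDiff

namespace LoopReduction

noncomputable section

/-! ### The loop algebra -/

section LoopSpace

variable (V : Type*) [AddCommGroup V] [Module ℂ V]

/-- The loop space of a complex vector space `V`: smooth maps from the circle `ℝ/ℤ` to `V`, written
as `1`-periodic maps `ℝ → V`. Smoothness is tested on linear forms, which for finite-dimensional
`V` is smoothness with respect to any norm. -/
def Loop : Submodule ℂ (ℝ → V) where
  carrier := {q | (∀ φ : V →ₗ[ℂ] ℂ, ContDiff ℝ ∞ fun x => φ (q x)) ∧ Function.Periodic q 1}
  add_mem' := by
    rintro q r ⟨hq, hq'⟩ ⟨hr, hr'⟩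
    refine ⟨fun φ => ?_, hq'.add hr'⟩
    simpa using (hq φ).add (hr φ)
  zero_mem' := ⟨fun φ => by simpa using contDiff_const, fun x => rfl⟩
  smul_mem' := by
    rintro c q ⟨hq, hq'⟩
    refine ⟨fun φ => ?_, fun x => by simp [hq' x]⟩
    simpa using contDiff_const.mul (hq φ)

variable {V}

/-- The loops with values in the subspace `W`. -/
def loopsIn (W : Submodule ℂ V) : Submodule ℂ (Loop V) where
  carrier := {q | ∀ x, q.1 x ∈ W}
  add_mem' := fun hq hr x => W.add_mem (hq x) (hr x)
  zero_mem' := fun _ => W.zero_mem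
  smul_mem' := fun c _ hq x => W.smul_mem c (hq x)

/-- The constant loop. -/
def constLoop (v : V) : Loop V :=
  ⟨fun _ => v, fun _ => contDiff_const, fun _ => rfl⟩

/-- The derivative of a map `ℝ → V`, computed in coordinates. -/
def curveDeriv [Module.Finite ℂ V] (q : ℝ → V) (x : ℝ) : V :=
  ∑ i, deriv (fun y => (Module.finBasis ℂ V).repr (q y) i) x • Module.finBasis ℂ V i

theorem contDiff_repr [Module.Finite ℂ V] (q : Loop V)
    (i : Fin (Module.finrank ℂ V)) :
    ContDiff ℝ ∞ fun y => (Module.finBasis ℂ V).repr (q.1 y) i :=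
  q.2.1 ((Module.finBasis ℂ V).coord i)

/-- The derivative does not depend on the coordinates. -/
theorem apply_curveDeriv [Module.Finite ℂ V] (q : Loop V) (φ : V →ₗ[ℂ] ℂ) (x : ℝ) :
    φ (curveDeriv q.1 x) = deriv (fun y => φ (q.1 y)) x := by
  have h : (fun y => φ (q.1 y)) = fun y => ∑ i,
      (Module.finBasis ℂ V).repr (q.1 y) i * φ (Module.finBasis ℂ V i) := by
    funext y
    conv_lhs => rw [← (Module.finBasis ℂ V).sum_repr (q.1 y)]
    simp only [map_sum, map_smul, smul_eq_mul]
  have hd : ∀ i, DifferentiableAt ℝ (fun y => (Module.finBasis ℂ V).repr (q.1 y) i) x :=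
    fun i => ((contDiff_repr q i).differentiable (by simp)).differentiableAt
  rw [h, deriv_fun_sum (fun i _ => (hd i).mul_const _)]
  simp [curveDeriv, deriv_mul_const (hd _)]

/-- The derivative `∂_x` on the loop space. -/
def dx [Module.Finite ℂ V] : Loop V →ₗ[ℂ] Loop V where
  toFun q := ⟨curveDeriv q.1, by
    refine ⟨fun φ => ?_, fun x => ?_⟩
    · simp only [apply_curveDeriv q φ]
      exact ((contDiff_infty_iff_deriv (𝕜 := ℝ)).1 (q.2.1 φ)).2
    · unfold curveDeriv
      refine Finset.sum_congr rfl fun i _ => ?_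
      congr 1
      rw [← deriv_comp_add_const]
      simp only [q.2.2 _]⟩
  map_add' q r := by
    ext x
    refine (Module.finBasis ℂ V).ext_elem fun i => ?_
    have hq := ((contDiff_repr q i).differentiable (by simp)).differentiableAt (x := x)
    have hr := ((contDiff_repr r i).differentiable (by simp)).differentiableAt (x := x)
    have h1 := apply_curveDeriv (q + r) ((Module.finBasis ℂ V).coord i) x
    have h2 := apply_curveDeriv q ((Module.finBasis ℂ V).coord i) x
    have h3 := apply_curveDeriv r ((Module.finBasis ℂ V).coord i) x
    simp only [Module.Basis.coord_apply] at h1 h2 h3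
    simp only [Submodule.coe_add, Pi.add_apply, map_add, Finsupp.add_apply] at *
    rw [h1, h2, h3]
    exact deriv_fun_add hq hr
  map_smul' c q := by
    ext x
    refine (Module.finBasis ℂ V).ext_elem fun i => ?_
    have hq := ((contDiff_repr q i).differentiable (by simp)).differentiableAt (x := x)
    have h1 := apply_curveDeriv (c • q) ((Module.finBasis ℂ V).coord i) x
    have h2 := apply_curveDeriv q ((Module.finBasis ℂ V).coord i) x
    simp only [Module.Basis.coord_apply] at h1 h2
    simp only [Submodule.coe_smul, Pi.smul_apply, map_smul, Finsupp.smul_apply, smul_eq_mul,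
      RingHom.id_apply] at *
    rw [h1, h2]
    exact deriv_const_mul c hq

end LoopSpace

variable {g : Type*} [LieRing g] [LieAlgebra ℂ g] [Module.Finite ℂ g]

/-- The pointwise Lie bracket of the loop algebra. -/
def br : Loop g →ₗ[ℂ] Loop g →ₗ[ℂ] Loop g :=
  LinearMap.mk₂ ℂ
    (fun q r => ⟨fun x => ⁅q.1 x, r.1 x⁆, by
      refine ⟨fun φ => ?_, fun x => by simp only [q.2.2 x, r.2.2 x]⟩
      have h : (fun x => φ ⁅q.1 x, r.1 x⁆) = fun x => ∑ i, ∑ j,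
          (Module.finBasis ℂ g).repr (q.1 x) i * ((Module.finBasis ℂ g).repr (r.1 x) j *
            φ ⁅Module.finBasis ℂ g i, Module.finBasis ℂ g j⁆) := by
        funext x
        conv_lhs => rw [← (Module.finBasis ℂ g).sum_repr (q.1 x),
          ← (Module.finBasis ℂ g).sum_repr (r.1 x)]
        rw [sum_lie, map_sum]
        refine Finset.sum_congr rfl fun i _ => ?_
        rw [lie_sum, map_sum]
        refine Finset.sum_congr rfl fun j _ => ?_
        rw [smul_lie, lie_smul, map_smul, map_smul, smul_eq_mul, smul_eq_mul]
      rw [h]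
      exact ContDiff.sum fun i _ => ContDiff.sum fun j _ =>
        (contDiff_repr q i).mul ((contDiff_repr r j).mul contDiff_const)⟩)
    (fun _ _ _ => by ext x; simp) (fun _ _ _ => by ext x; simp)
    (fun _ _ _ => by ext x; simp) (fun _ _ _ => by ext x; simp)

/-- The bilinear form `(u|v) = ∫_{S¹} ⟨u(x)|v(x)⟩ dx` induced by the Killing form. -/
def pair (u v : Loop g) : ℂ :=
  ∫ x in (0 : ℝ)..1, killingForm ℂ g (u.1 x) (v.1 x)

/-- `v` is the velocity at time `t` of the curve `γ` in the loop algebra. -/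
def IsVelocity (γ : ℝ → Loop g) (t : ℝ) (v : Loop g) : Prop :=
  ∀ (φ : g →ₗ[ℂ] ℂ) (x : ℝ), HasDerivAt (fun τ => φ ((γ τ).1 x)) (φ (v.1 x)) t

/-! ### The bihamiltonian structure -/

/-- The Poisson tensor `P₁(q)(v) = (1/ε) [a, v]`. -/
def P₁ (ε : ℂ) (a : g) (_q : Loop g) : Loop g →ₗ[ℂ] Loop g :=
  ε⁻¹ • br (constLoop a)

/-- The Poisson tensor `P₂(q)(v) = (1/ε) [ε ∂_x + q, v]`. -/
def P₂ (ε : ℂ) (q : Loop g) : Loop g →ₗ[ℂ] Loop g :=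
  ε⁻¹ • (ε • dx + br q)

/-- The Poisson pencil `P_λ = P₂ + λ P₁`. -/
def pencil (ε : ℂ) (a : g) (lam : ℂ) (q : Loop g) : Loop g →ₗ[ℂ] Loop g :=
  P₂ ε q + lam • P₁ ε a q

/-! ### Differential polynomials and local functionals

`X` is a space with a map `i` to the loop algebra: the loop algebra itself, or a subset of it. -/

section Functionals

variable {X : Type*} (i : X → Loop g)

/-- The coordinates of the loop `i s` and their `x`-derivatives. -/
def jets : Set (X → ℝ → ℂ) :=
  {p | ∃ (φ : g →ₗ[ℂ] ℂ) (k : ℕ), p = fun s x => iteratedDeriv k (fun y => φ ((i s).1 y)) x}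

/-- The ring of differential polynomials on `X`. -/
def diffPoly : Subalgebra ℂ (X → ℝ → ℂ) := Algebra.adjoin ℂ (jets i)

/-- Differential polynomials whose coefficients are smooth functions on the circle. -/
def densities : Subalgebra ℂ (X → ℝ → ℂ) :=
  Algebra.adjoin ℂ (jets i ∪
    {p | ∃ c : ℝ → ℂ, ContDiff ℝ ∞ c ∧ Function.Periodic c 1 ∧ p = fun _ => c})

/-- The functional `s ↦ ∫_{S¹} p(s)(x) dx` with density `p`. -/
def functionalOf (p : X → ℝ → ℂ) (s : X) : ℂ := ∫ x in (0 : ℝ)..1, p s x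

/-- Local functionals on `X`. -/
def IsLocal (F : X → ℂ) : Prop := ∃ p ∈ densities i, F = functionalOf p

/-- `v` is a gradient of `F` at `q`: the derivative of `F` at `q` in each direction `s` such that
the line through `q` in the direction `s` stays in `X` is `(v|s)`. -/
def HasGrad (F : X → ℂ) (q : X) (v : Loop g) : Prop :=
  ∀ (s : Loop g) (c : ℂ → X), (∀ θ : ℂ, i (c θ) = i q + θ • s) →
    HasDerivAt (fun θ => F (c θ)) (pair v s) 0

open Classical in
/-- A gradient of `F` at `q` (zero if there is none). -/
def grad (F : X → ℂ) (q : X) : Loop g :=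
  if h : ∃ v, HasGrad i F q v then h.choose else 0

/-- The bracket given by the matrix differential operator `∑_r A_{jk}^r(q) ∂_x^r`:
`{F, G}(q) = ∫ ∑_{j,k,r} (δF/δq^j) A_{jk}^r(q) ∂_x^r (δG/δq^k) dx`, where the `q^j` are the
coordinates with respect to the vectors `ξ j`. -/
def opBracket {ι : Type*} [Fintype ι] (ξ : ι → g) (A : ι → ι → ℕ →₀ diffPoly i)
    (F G : X → ℂ) (q : X) : ℂ :=
  ∫ x in (0 : ℝ)..1, ∑ j, ∑ k, (A j k).sum fun r c =>
    killingForm ℂ g ((grad i F q).1 x) (ξ j) * (c : X → ℝ → ℂ) q x *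
      iteratedDeriv r (fun y => killingForm ℂ g ((grad i G q).1 y) (ξ k)) x

/-- `b` is a Poisson bracket on the space of local functionals on `X`. -/
structure IsPoisson (b : (X → ℂ) → (X → ℂ) → (X → ℂ)) : Prop where
  isLocal : ∀ F G, IsLocal i F → IsLocal i G → IsLocal i (b F G)
  linear : ∀ (c : ℂ) (F F' G : X → ℂ), IsLocal i F → IsLocal i F' → IsLocal i G →
    b (c • F + F') G = c • b F G + b F' G
  antisymm : ∀ F G, IsLocal i F → IsLocal i G → b F G = -b G F
  jacobi : ∀ F G H, IsLocal i F → IsLocal i G → IsLocal i H →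
    b F (b G H) + b G (b H F) + b H (b F G) = 0

end Functionals

/-- The bracket `{F, G} = ⟨dF, P dG⟩` of functionals on the loop algebra. -/
def bracket (P : Loop g → Loop g →ₗ[ℂ] Loop g) (F G : Loop g → ℂ) (q : Loop g) : ℂ :=
  pair (grad id F q) (P q (grad id G q))

/-! ### Gauge transformations

The pair `(c, q)` stands for the first order operator `c ∂_x + q`. -/

/-- `ad m` acting on operators: `[m, c ∂_x + q] = [m, q] - c m'`. -/
def adOp (m : Loop g) : Module.End ℂ (ℂ × Loop g) :=
  LinearMap.inr ℂ ℂ (Loop g) ∘ₗ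
    (br m ∘ₗ LinearMap.snd ℂ ℂ (Loop g) -
      LinearMap.toSpanSingleton ℂ (Loop g) (dx m) ∘ₗ LinearMap.fst ℂ ℂ (Loop g))

/-- The exponential series of a nilpotent endomorphism. -/
def expNil {M : Type*} [AddCommGroup M] [Module ℂ M] (T : Module.End ℂ M) : Module.End ℂ M :=
  ∑ᶠ k : ℕ, ((k.factorial : ℂ)⁻¹) • T ^ k

/-- The gauge transformation `q ↦ exp(-ad m)(ε ∂_x + q) - ε ∂_x`. -/
def gaugeBy (ε : ℂ) (m q : Loop g) : Loop g := (expNil (-adOp m) (ε, q)).2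

/-- The adjoint group of the loop algebra of `W`, for a subalgebra `W` of `g` acting nilpotently:
the group generated by the `exp(ad m)` with `m` a loop in `W`. -/
def adjointGroup (W : Submodule ℂ g) : Subgroup (Module.End ℂ (ℂ × Loop g))ˣ :=
  Subgroup.closure {u | ∃ m ∈ loopsIn W, (u : Module.End ℂ (ℂ × Loop g)) = expNil (adOp m)}

/-- The gauge action `q ↦ u(ε ∂_x + q) - ε ∂_x`. -/
def act (ε : ℂ) (u : (Module.End ℂ (ℂ × Loop g))ˣ) (q : Loop g) : Loop g :=
  ((u : Module.End ℂ (ℂ × Loop g)) (ε, q)).2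

/-- The adjoint action on the loop algebra. -/
def adAct (u : (Module.End ℂ (ℂ × Loop g))ˣ) (w : Loop g) : Loop g :=
  ((u : Module.End ℂ (ℂ × Loop g)) (0, w)).2

/-- The momentum map `J`: the loop `q` seen as a linear form on the loops in `n`. -/
def momentum (n : Submodule ℂ g) (q : Loop g) : loopsIn n → ℂ := fun w => pair q w

/-- The isotropy group of `e` (as a linear form on the loops in `n`) under the coadjoint action
of the adjoint group of the loop algebra of `n`. -/
def isotropy (n : Submodule ℂ g) (e : g) : Set (Module.End ℂ (ℂ × Loop g))ˣ :=
  {u | u ∈ adjointGroup n ∧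
    ∀ w ∈ loopsIn n, pair (constLoop e) (adAct u⁻¹ w) = pair (constLoop e) w}

/-! ### Reductions -/

/-- The data of a Marsden-Ratiu reduction of the loop algebra: a submanifold `S`, a distribution
`D`, and the equivalence relation on `S` whose quotient is the reduced space. -/
structure Reduction (g : Type*) [LieRing g] [LieAlgebra ℂ g] [Module.Finite ℂ g] where
  S : Set (Loop g)
  D : Loop g → Submodule ℂ (Loop g)
  rel : Loop g → Loop g → Prop

namespace Reduction

variable (red : Reduction g)

/-- The reduced space `N`. -/
abbrev Space : Type _ := Quot fun s t : red.S => red.rel s t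

/-- The projection `S → N`. -/
def proj (s : red.S) : red.Space := Quot.mk _ s

/-- Local functionals on `N`. -/
def IsLocalQuot (f : red.Space → ℂ) : Prop :=
  IsLocal (fun s : red.S => (s : Loop g)) (f ∘ red.proj)

/-- `F` is an extension of `f ∘ π` to the loop algebra whose differential vanishes on `D` at the
points of `S`. -/
def IsLift (f : red.Space → ℂ) (F : Loop g → ℂ) : Prop :=
  IsLocal id F ∧ (∀ s : red.S, F s = f (red.proj s)) ∧
    ∀ s : red.S, ∀ v ∈ red.D s, pair (grad id F s) v = 0

/-- `k` is the reduced bracket of `f` and `h`: `{f, h}^N ∘ π = {F, H} ∘ i_S` for all lifts. -/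
def IsReducedBracket (P : Loop g → Loop g →ₗ[ℂ] Loop g) (f h k : red.Space → ℂ) : Prop :=
  ∀ F H, red.IsLift f F → red.IsLift h H → ∀ s : red.S, bracket P F H s = k (red.proj s)

/-- The ring of differential polynomials on `S` that are invariant under the relation. -/
def invDiffPoly : Subalgebra ℂ (red.S → ℝ → ℂ) where
  carrier := {p | p ∈ diffPoly (fun s : red.S => (s : Loop g)) ∧
    ∀ s t : red.S, red.rel s t → p s = p t}
  mul_mem' := by
    rintro p r ⟨hp, hp'⟩ ⟨hr, hr'⟩
    exact ⟨mul_mem hp hr, fun s t h => by simp [hp' s t h, hr' s t h]⟩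
  add_mem' := by
    rintro p r ⟨hp, hp'⟩ ⟨hr, hr'⟩
    exact ⟨add_mem hp hr, fun s t h => by simp [hp' s t h, hr' s t h]⟩
  algebraMap_mem' c := ⟨Subalgebra.algebraMap_mem _ c, fun _ _ _ => rfl⟩

/-- Functionals on `N` with densities in the ring of invariant differential polynomials. -/
def HasInvDensity (f : red.Space → ℂ) : Prop :=
  ∃ p ∈ red.invDiffPoly, f ∘ red.proj = functionalOf p

end Reduction

/-- The generalized Drinfeld-Sokolov reduction, as the Marsden-Weinstein reduction for the gauge
action of the adjoint group of the loops in `n`: `S` is the level set of the momentum map at `e`,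
`D` is tangent to the orbits of that group, and the quotient is by the isotropy group of `e`. -/
def dsReduction (ε : ℂ) (n : Submodule ℂ g) (e : g) : Reduction g where
  S := {q | momentum n q = momentum n (constLoop e)}
  D q := Submodule.span ℂ
    {v | ∃ m ∈ loopsIn n, IsVelocity (fun t : ℝ => gaugeBy ε ((t : ℂ) • m) q) 0 v}
  rel s t := momentum n s = momentum n (constLoop e) ∧ momentum n t = momentum n (constLoop e) ∧
    ∃ u ∈ isotropy n e, t = act ε u s

/-- The set `Ξ` of Casimirs of `P₁` whose gradient is a loop in `n`. -/
def casimirs (ε : ℂ) (a : g) (n : Submodule ℂ g) : Set (Loop g → ℂ) :=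
  {K | IsLocal id K ∧ ∀ q, P₁ ε a q (grad id K q) = 0 ∧ grad id K q ∈ loopsIn n}

/-- The level surface of a set of functionals through `q₀`. -/
def levelSurface (Ξ : Set (Loop g → ℂ)) (q₀ : Loop g) : Set (Loop g) :=
  {q | ∀ K ∈ Ξ, K q = K q₀}

/-- The distribution generated by the Hamiltonian vector fields `P(dK)`, `K ∈ Ξ`. -/
def hamDistribution (P : Loop g → Loop g →ₗ[ℂ] Loop g) (Ξ : Set (Loop g → ℂ)) (q : Loop g) :
    Submodule ℂ (Loop g) :=
  Submodule.span ℂ ((fun K => P q (grad id K q)) '' Ξ)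

/-- `s` and `t` are joined by a smooth path in `S` that is tangent to `D` (hence to `D ∩ TS`). -/
def TangentPath (S : Set (Loop g)) (D : Loop g → Submodule ℂ (Loop g)) (s t : Loop g) : Prop :=
  ∃ γ : ℝ → Loop g,
    (∀ φ : g →ₗ[ℂ] ℂ, ContDiff ℝ ∞ fun p : ℝ × ℝ => φ ((γ p.1).1 p.2)) ∧
    (∀ τ, γ τ ∈ S) ∧ (∀ τ, ∃ v ∈ D (γ τ), IsVelocity γ τ v) ∧ γ 0 = s ∧ γ 1 = t

/-- Two points of `S` lie on the same leaf of the foliation of `S` by `D ∩ TS`. -/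
def SameLeaf (S : Set (Loop g)) (D : Loop g → Submodule ℂ (Loop g)) (s t : Loop g) : Prop :=
  s ∈ S ∧ t ∈ S ∧ Relation.EqvGen (TangentPath S D) s t

/-- The generalized bihamiltonian reduction: `S` is the level surface through `e` of the set `Ξ`
of Casimirs of `P₁`, `D = P₂(dΞ)`, and the quotient is the space of leaves of `D ∩ TS`. -/
def bihReduction (ε : ℂ) (a : g) (n : Submodule ℂ g) (e : g) : Reduction g where
  S := levelSurface (casimirs ε a n) (constLoop e)
  D := hamDistribution (P₂ ε) (casimirs ε a n)
  rel := SameLeaf (levelSurface (casimirs ε a n) (constLoop e))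
    (hamDistribution (P₂ ε) (casimirs ε a n))

/-! ### Nilpotent elements and good gradings -/

/-- `gr` is a good grading of the Lie algebra `g` for `f`. -/
structure IsGoodGrading (gr : ℤ → Submodule ℂ g) (f : g) : Prop where
  isInternal : DirectSum.IsInternal gr
  lie_mem : ∀ i j, ∀ x ∈ gr i, ∀ y ∈ gr j, ⁅x, y⁆ ∈ gr (i + j)
  mem : f ∈ gr (-2)
  injective : ∀ j, 1 ≤ j → ∀ x ∈ gr j, ⁅f, x⁆ = 0 → x = 0
  surjective : ∀ j, j ≤ 1 → ∀ y ∈ gr (j - 2), ∃ x ∈ gr j, ⁅f, x⁆ = y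

/-- The coisotropic subspace `l' = {x ∈ g₋₁ | ⟨e|[x, y]⟩ = 0 for all y ∈ l}`. -/
def coisotropic (gr : ℤ → Submodule ℂ g) (e : g) (l : Submodule ℂ g) : Submodule ℂ g where
  carrier := {x | x ∈ gr (-1) ∧ ∀ y ∈ l, killingForm ℂ g e ⁅x, y⁆ = 0}
  add_mem' := by
    rintro x y ⟨hx, hx'⟩ ⟨hy, hy'⟩
    exact ⟨add_mem hx hy, fun z hz => by simp [hx' z hz, hy' z hz]⟩
  zero_mem' := ⟨zero_mem _, fun _ _ => by simp⟩
  smul_mem' := by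
    rintro c x ⟨hx, hx'⟩
    exact ⟨Submodule.smul_mem _ c hx, fun z hz => by simp [hx' z hz]⟩

/-- The sum of `l ⊂ g₋₁` and all `g_i` with `i ≤ -2`. -/
def lowerPart (gr : ℤ → Submodule ℂ g) (l : Submodule ℂ g) : Submodule ℂ g :=
  l ⊔ ⨆ i : ℤ, ⨆ _ : i ≤ -2, gr i

/-- The affine loop space `e + L(W)`. -/
def affineLoops (e : g) (W : Submodule ℂ g) : Set (Loop g) :=
  {q | q - constLoop e ∈ loopsIn W}

end

end LoopReduction

open LoopReduction

/-! Since `a` centralizes n, the tensor P₁ vanishes on L(n), and on L(n) every P_λ agrees with P₂.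
This makes the two reductions coincide. The linear functionals (·|m) with m in L(n) belong to Ξ.
They already cut out the level set of J and already span P₂(L(n)). Conversely a Casimir in Ξ has
gradient in L(n), which is orthogonal to L(b), so it is constant on e + L(b). Hence S = e + L(b) and
D = P₂(L(n)) on both sides (`levelSurface_casimirs`, `hamDistribution_casimirs`, `momentum_level`,
`dsReduction_D`).

The quotients are compared through a gauge-fixing map Φ. By sl₂-theory ad e is injective in negative
degrees, and g_{≤1} = [e, g_{≤-1}] ⊕ ker ad f (`exists_decomp`). Let ρ be the projection of g_{≤1}
that inverts ad e on the first summand. For q in e + L(g_{≤1}) the leading term of the gauge action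
m·q in m is [e, m]. Therefore m ↦ m - ρ(m·q - e) contracts the finite filtration by degree. Its
fixed point is unique, is reached after finitely many steps, and is a differential polynomial in q
(`exists_section`). This defines Φ(q) in Q, invariant under gauge transformations by all loops of
negative degree. On S the gauge parameter lies in L(g_neg), because b is [e, l] in degree 1 and
everything below.

By the Baker-Campbell-Hausdorff theorem (`exists_bch`) the exponentials of L(g_neg) form a group, so
the fibres of Φ on S are its orbits. The leaves of D ∩ TS are the same sets. A gauge flow τ ↦ (τm)·s
is a tangent path, and the derivative of Φ kills P₂(L(g_neg)) = D ∩ TS, so Φ is constant along every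
tangent path (`eq_of_tangentPath`). No Frobenius theorem is needed. An invariant differential
polynomial satisfies p(s) = p(Φ(s)), so the coordinates of Φ generate the invariants.

For the brackets, F ∘ Φ is a lift of a local functional F on Q, and its gradient annihilates D along
S. The pairing (v|P_λ w) does not change when v and w are altered by L(n), provided they annihilate
D (`pair_pencil_congr`). Hence all lifts give one bracket. Differentiating the annihilation
condition along S and using the cocycle identity shows that the bracket of two lifts again
annihilates D (`grad_bracket_annihilates`). It is therefore constant on orbits, and Jacobi on Q
follows from Jacobi on L(g). On Q the gradient of F ∘ Φ is the formal adjoint of dΦ applied to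
δF/δq, so the reduced operators are dΦ ∘ P_i ∘ (dΦ)* (`exists_operators`). -/

namespace LoopReduction

set_option linter.unusedSectionVars false

noncomputable section

/-! ### Smooth functions on the circle -/

/-- The algebra of smooth functions on the circle `ℝ/ℤ`. -/
def circleFun : Subalgebra ℂ (ℝ → ℂ) where
  carrier := {u | ContDiff ℝ ∞ u ∧ Function.Periodic u 1}
  mul_mem' := fun hu hv => ⟨hu.1.mul hv.1, hu.2.mul hv.2⟩
  add_mem' := fun hu hv => ⟨hu.1.add hv.1, hu.2.add hv.2⟩
  algebraMap_mem' _ := ⟨contDiff_const, fun _ => rfl⟩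

theorem const_mem_circleFun (c : ℂ) : (fun _ => c) ∈ circleFun := ⟨contDiff_const, fun _ => rfl⟩

theorem continuous_of_mem_circleFun {u : ℝ → ℂ} (hu : u ∈ circleFun) : Continuous u :=
  hu.1.continuous

theorem differentiable_of_mem_circleFun {u : ℝ → ℂ} (hu : u ∈ circleFun) : Differentiable ℝ u :=
  hu.1.differentiable (by simp)

theorem intervalIntegrable_of_mem_circleFun {u : ℝ → ℂ} (hu : u ∈ circleFun) :
    IntervalIntegrable u MeasureTheory.volume 0 1 :=
  (continuous_of_mem_circleFun hu).intervalIntegrable _ _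

theorem deriv_mem_circleFun {u : ℝ → ℂ} (hu : u ∈ circleFun) : deriv u ∈ circleFun := by
  refine ⟨((contDiff_infty_iff_deriv (𝕜 := ℝ)).1 hu.1).2, fun x => ?_⟩
  rw [← deriv_comp_add_const]
  simp only [hu.2 _]

theorem iteratedDeriv_mem_circleFun {u : ℝ → ℂ} (hu : u ∈ circleFun) (r : ℕ) :
    iteratedDeriv r u ∈ circleFun := by
  induction r generalizing u with
  | zero => simpa using hu
  | succ r ih => rw [iteratedDeriv_succ']; exact ih (deriv_mem_circleFun hu)

theorem conj_mem_circleFun {u : ℝ → ℂ} (hu : u ∈ circleFun) :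
    (fun x => (starRingEnd ℂ) (u x)) ∈ circleFun :=
  ⟨Complex.conjCLE.contDiff.comp hu.1, fun x => by simp only [hu.2 x]⟩

theorem deriv_mul_circleFun {u v : ℝ → ℂ} (hu : u ∈ circleFun) (hv : v ∈ circleFun) :
    deriv (fun x => u x * v x) = fun x => deriv u x * v x + u x * deriv v x := by
  funext x
  exact deriv_fun_mul (differentiable_of_mem_circleFun hu x) (differentiable_of_mem_circleFun hv x)

theorem deriv_add_circleFun {u v : ℝ → ℂ} (hu : u ∈ circleFun) (hv : v ∈ circleFun) :
    deriv (fun x => u x + v x) = fun x => deriv u x + deriv v x := by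
  funext x
  exact deriv_fun_add (differentiable_of_mem_circleFun hu x) (differentiable_of_mem_circleFun hv x)

theorem deriv_const_mul_circleFun (c : ℂ) {u : ℝ → ℂ} (hu : u ∈ circleFun) :
    deriv (fun x => c * u x) = fun x => c * deriv u x := by
  funext x
  exact deriv_const_mul c (differentiable_of_mem_circleFun hu x)

theorem integral_deriv_circleFun {u : ℝ → ℂ} (hu : u ∈ circleFun) :
    ∫ x in (0 : ℝ)..1, deriv u x = 0 := by
  rw [intervalIntegral.integral_deriv_eq_sub
    (fun x _ => (differentiable_of_mem_circleFun hu x))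
    (intervalIntegrable_of_mem_circleFun (deriv_mem_circleFun hu))]
  have := hu.2 0
  simp only [zero_add] at this
  rw [this, sub_self]

theorem integral_mul_deriv_circleFun {u v : ℝ → ℂ} (hu : u ∈ circleFun) (hv : v ∈ circleFun) :
    ∫ x in (0 : ℝ)..1, u x * deriv v x = -∫ x in (0 : ℝ)..1, deriv u x * v x := by
  have h := integral_deriv_circleFun (mul_mem hu hv)
  have h' : deriv (u * v) = fun x => deriv u x * v x + u x * deriv v x :=
    deriv_mul_circleFun hu hv
  rw [h', intervalIntegral.integral_add] at h
  · linear_combination h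
  · exact intervalIntegrable_of_mem_circleFun (mul_mem (deriv_mem_circleFun hu) hv)
  · exact intervalIntegrable_of_mem_circleFun (mul_mem hu (deriv_mem_circleFun hv))

theorem integral_mul_iteratedDeriv_circleFun {u v : ℝ → ℂ} (hu : u ∈ circleFun)
    (hv : v ∈ circleFun) (r : ℕ) :
    ∫ x in (0 : ℝ)..1, u x * iteratedDeriv r v x =
      ∫ x in (0 : ℝ)..1, ((-1) ^ r * iteratedDeriv r u x) * v x := by
  induction r generalizing u v with
  | zero => simp
  | succ r ih =>
    have h2 := ih hu (deriv_mem_circleFun hv)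
    have h4 := integral_mul_deriv_circleFun
      (mul_mem (const_mem_circleFun ((-1) ^ r)) (iteratedDeriv_mem_circleFun hu r)) hv
    simp only [Pi.mul_apply] at h4
    rw [iteratedDeriv_succ', h2, h4]
    have h3 : deriv ((fun _ => (-1 : ℂ) ^ r) * iteratedDeriv r u) =
        fun x => (-1) ^ r * iteratedDeriv (r + 1) u x := by
      rw [iteratedDeriv_succ]
      exact deriv_const_mul_circleFun _ (iteratedDeriv_mem_circleFun hu r)
    rw [h3, ← intervalIntegral.integral_neg]
    congr 1
    funext x
    ring

/-- The integrand is |u|², continuous and nonnegative, so its integral is positive as soon as u is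
nonzero somewhere in a period. -/
theorem eq_zero_of_integral_mul_conj {u : ℝ → ℂ} (hu : u ∈ circleFun)
    (h : ∫ x in (0 : ℝ)..1, u x * (starRingEnd ℂ) (u x) = 0) (x : ℝ) : u x = 0 := by
  have hc : Continuous fun x => Complex.normSq (u x) :=
    Complex.continuous_normSq.comp (continuous_of_mem_circleFun hu)
  have h1 : ∫ x in (0 : ℝ)..1, Complex.normSq (u x) = 0 := by
    have : ∫ x in (0 : ℝ)..1, ((Complex.normSq (u x) : ℝ) : ℂ) = 0 := by
      rw [← h]
      congr 1
      funext x
      rw [Complex.mul_conj]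
    rw [intervalIntegral.integral_ofReal] at this
    exact_mod_cast this
  obtain ⟨y, hy, hxy⟩ := hu.2.exists_mem_Ico₀ one_pos x
  by_contra hne
  rw [hxy] at hne
  have := intervalIntegral.integral_pos (f := fun x => Complex.normSq (u x)) one_pos
    hc.continuousOn (fun x _ => Complex.normSq_nonneg _)
    ⟨y, ⟨hy.1, hy.2.le⟩, Complex.normSq_pos.2 hne⟩
  exact this.ne' h1

/-! ### Loops -/

section Loops

variable {V : Type*} [AddCommGroup V] [Module ℂ V]

theorem eq_of_forall_form {v w : V} (h : ∀ φ : V →ₗ[ℂ] ℂ, φ v = φ w) : v = w := by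
  by_contra hne
  obtain ⟨φ, hφ, -⟩ := Submodule.exists_le_ker_of_notMem (p := (⊥ : Submodule ℂ V)) (v := v - w)
    (by simpa [sub_eq_zero] using hne)
  exact hφ (by rw [map_sub, h, sub_self])

/-- Smoothness and velocity of loops are defined through linear forms, so membership in a subspace
is passed to derivatives by testing on the forms that vanish on it. -/
theorem mem_of_forall_form {W : Submodule ℂ V} {v : V}
    (h : ∀ φ : V →ₗ[ℂ] ℂ, (∀ w ∈ W, φ w = 0) → φ v = 0) : v ∈ W := by
  by_contra hne
  obtain ⟨φ, hφ, hW⟩ := Submodule.exists_le_ker_of_notMem hne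
  exact hφ (h φ fun w hw => hW hw)

theorem form_mem (q : Loop V) (φ : V →ₗ[ℂ] ℂ) : (fun x => φ (q.1 x)) ∈ circleFun :=
  ⟨q.2.1 φ, fun x => by simp only [q.2.2 x]⟩

/-- A map with smooth periodic coordinates is a loop. -/
def Loop.mk (q : ℝ → V) (h : ∀ φ : V →ₗ[ℂ] ℂ, (fun x => φ (q x)) ∈ circleFun) : Loop V :=
  ⟨q, fun φ => (h φ).1, fun x => eq_of_forall_form fun φ => (h φ).2 x⟩

@[simp] theorem Loop.mk_apply (q : ℝ → V) (h : ∀ φ : V →ₗ[ℂ] ℂ, (fun x => φ (q x)) ∈ circleFun)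
    (x : ℝ) : (Loop.mk q h).1 x = q x := rfl

theorem Loop.ext_apply {q r : Loop V} (h : ∀ x, q.1 x = r.1 x) : q = r :=
  Subtype.ext (funext h)

@[simp] theorem Loop.add_apply (q r : Loop V) (x : ℝ) : (q + r).1 x = q.1 x + r.1 x := rfl
@[simp] theorem Loop.sub_apply (q r : Loop V) (x : ℝ) : (q - r).1 x = q.1 x - r.1 x := rfl
@[simp] theorem Loop.neg_apply (q : Loop V) (x : ℝ) : (-q).1 x = -q.1 x := rfl
@[simp] theorem Loop.zero_apply (x : ℝ) : (0 : Loop V).1 x = 0 := rfl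
@[simp] theorem Loop.smul_apply (c : ℂ) (q : Loop V) (x : ℝ) : (c • q).1 x = c • q.1 x := rfl
@[simp] theorem constLoop_apply (v : V) (x : ℝ) : (constLoop v).1 x = v := rfl

@[simp] theorem Loop.sum_apply {κ : Type*} (s : Finset κ) (q : κ → Loop V) (x : ℝ) :
    (∑ j ∈ s, q j).1 x = ∑ j ∈ s, (q j).1 x := by
  rw [AddSubmonoidClass.coe_finsetSum, Finset.sum_apply]

/-- The loop `x ↦ u(x) v`. -/
def tensorLoop (u : circleFun) (v : V) : Loop V :=
  Loop.mk (fun x => u.1 x • v) fun φ => by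
    simp only [map_smul, smul_eq_mul]
    exact mul_mem u.2 (const_mem_circleFun (φ v))

@[simp] theorem tensorLoop_apply (u : circleFun) (v : V) (x : ℝ) :
    (tensorLoop u v).1 x = u.1 x • v := rfl

/-- The loop obtained by applying a linear map pointwise. -/
def Loop.map {V' : Type*} [AddCommGroup V'] [Module ℂ V'] (A : V →ₗ[ℂ] V') :
    Loop V →ₗ[ℂ] Loop V' where
  toFun q := Loop.mk (fun x => A (q.1 x)) fun φ => form_mem q (φ ∘ₗ A)
  map_add' q r := Loop.ext_apply fun x => by simp
  map_smul' c q := Loop.ext_apply fun x => by simp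

@[simp] theorem Loop.map_apply {V' : Type*} [AddCommGroup V'] [Module ℂ V'] (A : V →ₗ[ℂ] V')
    (q : Loop V) (x : ℝ) : (Loop.map A q).1 x = A (q.1 x) := rfl

theorem tensorLoop_mem {W : Submodule ℂ V} (u : circleFun) {v : V} (hv : v ∈ W) :
    tensorLoop u v ∈ loopsIn W := fun _ => W.smul_mem _ hv

theorem loopsIn_mono {W W' : Submodule ℂ V} (h : W ≤ W') : loopsIn W ≤ loopsIn W' :=
  fun _ hq x => h (hq x)

variable [Module.Finite ℂ V]

theorem form_dx (q : Loop V) (φ : V →ₗ[ℂ] ℂ) (x : ℝ) :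
    φ ((dx q).1 x) = deriv (fun y => φ (q.1 y)) x := apply_curveDeriv q φ x

theorem dx_mem {W : Submodule ℂ V} {q : Loop V} (hq : q ∈ loopsIn W) : dx q ∈ loopsIn W := by
  intro x
  refine mem_of_forall_form fun φ hφ => ?_
  rw [form_dx]
  have : (fun y => φ (q.1 y)) = fun _ => 0 := funext fun y => hφ _ (hq y)
  rw [this, deriv_const]

theorem dx_constLoop (v : V) : dx (constLoop v) = 0 :=
  Loop.ext_apply fun x => eq_of_forall_form fun φ => by rw [form_dx]; simp

end Loops

variable {g : Type*} [LieRing g] [LieAlgebra ℂ g] [Module.Finite ℂ g]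

@[simp] theorem br_apply (q r : Loop g) (x : ℝ) : (br q r).1 x = ⁅q.1 x, r.1 x⁆ := rfl

theorem bilin_expand (B : g →ₗ[ℂ] g →ₗ[ℂ] ℂ) (y z : g) :
    B y z = ∑ i, (Module.finBasis ℂ g).coord i y * B (Module.finBasis ℂ g i) z := by
  conv_lhs => rw [← (Module.finBasis ℂ g).sum_repr y]
  simp only [map_sum, map_smul, LinearMap.sum_apply, LinearMap.smul_apply, smul_eq_mul,
    Module.Basis.coord_apply]

theorem bilin_mem_circleFun (B : g →ₗ[ℂ] g →ₗ[ℂ] ℂ) (u v : Loop g) :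
    (fun x => B (u.1 x) (v.1 x)) ∈ circleFun := by
  have h : (fun x => B (u.1 x) (v.1 x)) = ∑ i, (fun x => (Module.finBasis ℂ g).coord i (u.1 x)) *
      fun x => (B (Module.finBasis ℂ g i)) (v.1 x) := by
    funext x
    simp only [Finset.sum_apply, Pi.mul_apply, bilin_expand B (u.1 x)]
  rw [h]
  exact sum_mem fun i _ => mul_mem (form_mem u _) (form_mem v _)

theorem deriv_bilin (B : g →ₗ[ℂ] g →ₗ[ℂ] ℂ) (u v : Loop g) (x : ℝ) :
    deriv (fun y => B (u.1 y) (v.1 y)) x =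
      B ((dx u).1 x) (v.1 x) + B (u.1 x) ((dx v).1 x) := by
  have h : (fun x => B (u.1 x) (v.1 x)) = fun y =>
      ∑ i, (Module.finBasis ℂ g).coord i (u.1 y) * (B (Module.finBasis ℂ g i)) (v.1 y) := by
    funext x
    exact bilin_expand B (u.1 x) (v.1 x)
  have hd : ∀ i, deriv (fun y => (Module.finBasis ℂ g).coord i (u.1 y) *
      (B (Module.finBasis ℂ g i)) (v.1 y)) x =
      (Module.finBasis ℂ g).coord i ((dx u).1 x) * (B (Module.finBasis ℂ g i)) (v.1 x) +
      (Module.finBasis ℂ g).coord i (u.1 x) * (B (Module.finBasis ℂ g i)) ((dx v).1 x) := by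
    intro i
    rw [deriv_mul_circleFun (form_mem u _) (form_mem v _), form_dx, form_dx]
  have hdiff : ∀ i, DifferentiableAt ℝ (fun y => (Module.finBasis ℂ g).coord i (u.1 y) *
      (B (Module.finBasis ℂ g i)) (v.1 y)) x := fun i =>
    differentiable_of_mem_circleFun
      (mul_mem (form_mem u ((Module.finBasis ℂ g).coord i)) (form_mem v (B _))) x
  rw [h, deriv_fun_sum fun i _ => hdiff i]
  simp only [hd, Finset.sum_add_distrib]
  congr 1
  · exact (bilin_expand B _ _).symm
  · exact (bilin_expand B _ _).symm

theorem dx_br (u v : Loop g) : dx (br u v) = br (dx u) v + br u (dx v) :=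
  Loop.ext_apply fun x => eq_of_forall_form fun φ => by
    rw [form_dx]
    have h := deriv_bilin ((LieModule.toEnd ℂ g g : g →ₗ[ℂ] Module.End ℂ g).compr₂ φ) u v x
    simp only [LinearMap.compr₂_apply, LieHom.coe_toLinearMap, LieModule.toEnd_apply_apply] at h
    rw [Loop.add_apply, map_add, br_apply, br_apply, ← h]
    rfl

theorem br_skew (u v : Loop g) : br u v = -br v u :=
  Loop.ext_apply fun x => (lie_skew (u.1 x) (v.1 x)).symm

theorem br_leibniz (u v w : Loop g) : br u (br v w) = br (br u v) w + br v (br u w) :=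
  Loop.ext_apply fun x => leibniz_lie (u.1 x) (v.1 x) (w.1 x)

/-! ### The pairing -/

theorem killing_mem_circleFun (u v : Loop g) :
    (fun x => killingForm ℂ g (u.1 x) (v.1 x)) ∈ circleFun :=
  bilin_mem_circleFun (killingForm ℂ g) u v

theorem pair_add_left (u u' v : Loop g) : pair (u + u') v = pair u v + pair u' v := by
  unfold pair
  rw [← intervalIntegral.integral_add
    (intervalIntegrable_of_mem_circleFun (killing_mem_circleFun _ _))
    (intervalIntegrable_of_mem_circleFun (killing_mem_circleFun _ _))]
  simp

theorem pair_comm (u v : Loop g) : pair u v = pair v u := by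
  unfold pair
  congr 1
  funext x
  exact LieModule.traceForm_comm ℂ g g _ _

theorem pair_smul_left (c : ℂ) (u v : Loop g) : pair (c • u) v = c * pair u v := by
  unfold pair
  rw [← intervalIntegral.integral_const_mul]
  simp

theorem pair_add_right (u v v' : Loop g) : pair u (v + v') = pair u v + pair u v' := by
  rw [pair_comm, pair_add_left, pair_comm v, pair_comm v']

theorem pair_smul_right (c : ℂ) (u v : Loop g) : pair u (c • v) = c * pair u v := by
  rw [pair_comm, pair_smul_left, pair_comm]

/-- The pairing as a bilinear form. -/
def pairing : Loop g →ₗ[ℂ] Loop g →ₗ[ℂ] ℂ :=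
  LinearMap.mk₂ ℂ pair pair_add_left pair_smul_left pair_add_right pair_smul_right

theorem pairing_apply (u v : Loop g) : pairing u v = pair u v := rfl

theorem pair_neg_left (u v : Loop g) : pair (-u) v = -pair u v := by
  simp only [← pairing_apply, map_neg, LinearMap.neg_apply]

theorem pair_neg_right (u v : Loop g) : pair u (-v) = -pair u v := by
  simp only [← pairing_apply, map_neg]

theorem pair_sub_left (u u' v : Loop g) : pair (u - u') v = pair u v - pair u' v := by
  simp only [← pairing_apply, map_sub, LinearMap.sub_apply]

theorem pair_sub_right (u v v' : Loop g) : pair u (v - v') = pair u v - pair u v' := by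
  simp only [← pairing_apply, map_sub]

@[simp] theorem pair_zero_left (v : Loop g) : pair 0 v = 0 := by
  simp only [← pairing_apply, map_zero, LinearMap.zero_apply]

@[simp] theorem pair_zero_right (v : Loop g) : pair v 0 = 0 := by
  simp only [← pairing_apply, map_zero]

theorem pair_br (u v w : Loop g) : pair (br u v) w = pair u (br v w) := by
  unfold pair
  congr 1
  funext x
  exact LieModule.traceForm_apply_lie_apply ℂ g g _ _ _

theorem pair_br_left (u v w : Loop g) : pair (br u v) w = -pair v (br u w) := by
  rw [br_skew u v, pair_neg_left, pair_br]

theorem pair_dx (u v : Loop g) : pair (dx u) v = -pair u (dx v) := by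
  have h := integral_deriv_circleFun (killing_mem_circleFun u v)
  have h2 : deriv (fun x => killingForm ℂ g (u.1 x) (v.1 x)) = fun x =>
      killingForm ℂ g ((dx u).1 x) (v.1 x) + killingForm ℂ g (u.1 x) ((dx v).1 x) :=
    funext fun x => deriv_bilin (killingForm ℂ g) u v x
  rw [h2, intervalIntegral.integral_add
    (intervalIntegrable_of_mem_circleFun (killing_mem_circleFun _ _))
    (intervalIntegrable_of_mem_circleFun (killing_mem_circleFun _ _))] at h
  exact eq_neg_of_add_eq_zero_left h

/-- The fundamental lemma of the calculus of variations. The test loop is conj(u) ⊗ y with u =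
⟨v|y⟩, so no bump functions are needed and the pairing becomes ∫|u|². -/
theorem killing_eq_zero_of_pair {W : Submodule ℂ g} {v : Loop g}
    (h : ∀ s ∈ loopsIn W, pair v s = 0) (x : ℝ) {y : g} (hy : y ∈ W) :
    killingForm ℂ g (v.1 x) y = 0 := by
  have hu := form_mem v ((killingForm ℂ g).flip y)
  refine eq_zero_of_integral_mul_conj hu ?_ x
  have h2 := h _ (tensorLoop_mem ⟨_, conj_mem_circleFun hu⟩ hy)
  rw [← h2]
  unfold pair
  congr 1
  funext x
  simp [mul_comm]

theorem pair_eq_zero_of_killing {u v : Loop g} (h : ∀ x, killingForm ℂ g (u.1 x) (v.1 x) = 0) :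
    pair u v = 0 := by
  unfold pair
  simp [h]

theorem eq_zero_of_pair [LieAlgebra.IsKilling ℂ g] {v : Loop g} (h : ∀ s, pair v s = 0) :
    v = 0 := by
  refine Loop.ext_apply fun x => ?_
  have := (LieAlgebra.IsKilling.killingForm_nondegenerate ℂ g).1
  exact this _ fun y => killing_eq_zero_of_pair (W := ⊤) (fun s _ => h s) x trivial

theorem eq_of_pair [LieAlgebra.IsKilling ℂ g] {v w : Loop g} (h : ∀ s, pair v s = pair w s) :
    v = w :=
  sub_eq_zero.1 (eq_zero_of_pair fun s => by rw [pair_sub_left, h, sub_self])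

/-! ### The Poisson tensors -/

theorem P₂_apply {ε : ℂ} (hε : ε ≠ 0) (q v : Loop g) : P₂ ε q v = dx v + ε⁻¹ • br q v := by
  simp [P₂, smul_smul, inv_mul_cancel₀ hε]

theorem pencil_apply {ε : ℂ} (hε : ε ≠ 0) (a : g) (lam : ℂ) (q v : Loop g) :
    pencil ε a lam q v = dx v + ε⁻¹ • br (q + lam • constLoop a) v := by
  simp only [pencil, P₁, LinearMap.add_apply, P₂_apply hε, LinearMap.smul_apply, map_add, map_smul,
    smul_add, add_assoc]
  rw [smul_comm]

theorem pencil_zero (ε : ℂ) (a : g) (q : Loop g) : pencil ε a 0 q = P₂ ε q := by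
  simp [pencil]

theorem pair_pencil {ε : ℂ} (hε : ε ≠ 0) (a : g) (lam : ℂ) (q u v : Loop g) :
    pair (pencil ε a lam q u) v = -pair u (pencil ε a lam q v) := by
  rw [pencil_apply hε, pencil_apply hε, pair_add_left, pair_add_right, pair_dx, pair_smul_left,
    pair_smul_right, pair_br_left]
  ring

/-- Applied to loops in n, this makes the distribution and the gauge flows independent of λ. -/
theorem pencil_eq_P₂ {ε : ℂ} (a : g) (lam : ℂ) (q : Loop g) {w : Loop g}
    (h : ∀ x, ⁅a, w.1 x⁆ = 0) : pencil ε a lam q w = P₂ ε q w := by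
  have : br (constLoop a) w = 0 := Loop.ext_apply fun x => h x
  simp [pencil, P₁, this]

/-- The cocycle identity of the pencil. -/
theorem pair_pencil_cyclic {ε : ℂ} (hε : ε ≠ 0) (a : g) (lam : ℂ) (q u v w : Loop g) :
    pair (pencil ε a lam q u) (br v w) + pair (pencil ε a lam q v) (br w u) +
      pair (pencil ε a lam q w) (br u v) = 0 := by
  -- The order-zero part is invariance of the Killing form together with the Jacobi identity.
  have h1 : ∀ z : Loop g, pair (br z u) (br v w) + pair (br z v) (br w u) +
      pair (br z w) (br u v) = 0 := by
    intro z
    rw [pair_br z u, pair_br z v, pair_br z w, ← pair_add_right, ← pair_add_right,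
      br_leibniz u v w, br_skew w u, br_skew w (br u v), map_neg]
    simp
  -- The first-order part says that (u, v) ↦ (u'|v) is a 2-cocycle, because ∂_x is a skew
  -- derivation.
  have h2 : pair (dx u) (br v w) + pair (dx v) (br w u) + pair (dx w) (br u v) = 0 := by
    have e1 : pair (dx v) (br w u) = pair u (br (dx v) w) := by rw [← pair_br, pair_comm]
    have e2 : pair (dx w) (br u v) = pair u (br v (dx w)) := by
      rw [pair_comm, pair_br]
    rw [pair_dx, dx_br, pair_add_right, e1, e2]
    ring
  simp only [pencil_apply hε, pair_add_left, pair_smul_left]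
  linear_combination h2 + ε⁻¹ * h1 (q + lam • constLoop a)

end

end LoopReduction

/-! ### Good gradings, the sl₂-triple, and the subspaces n and b. -/

namespace LoopReduction

set_option linter.unusedSectionVars false

noncomputable section

/-! ### Representations of `sl₂` -/

section Sl2

open Polynomial

variable {M : Type*} [AddCommGroup M] [Module ℂ M] {E F H : Module.End ℂ M}

/-- The usual formula for a lowest-weight vector, with the operator H in place of the weight. No
eigenvector of H is assumed. -/
theorem sl2_F_pow_E (hEF : E * F - F * E = H) (hHE : H * E - E * H = (2 : ℂ) • E) {x : M}
    (hx : F x = 0) (n : ℕ) :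
    F ((E ^ (n + 1)) x) = -((n + 1 : ℂ) • (E ^ n) (H x + (n : ℂ) • x)) := by
  have hFE : ∀ y, F (E y) = E (F y) - H y := fun y => by
    rw [← hEF]; simp
  have hHEn : ∀ (n : ℕ) (y : M), H ((E ^ n) y) = (E ^ n) (H y + (2 * n : ℂ) • y) := by
    intro n
    induction n with
    | zero => intro y; simp
    | succ n ih =>
      intro y
      have h1 : H (E y) = E (H y) + (2 : ℂ) • E y := by
        have := LinearMap.congr_fun hHE y
        simp only [LinearMap.sub_apply, Module.End.mul_apply, LinearMap.smul_apply] at this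
        rw [← this]; abel
      rw [pow_succ, Module.End.mul_apply, Module.End.mul_apply, ih, h1]
      congr 1
      simp only [map_add, map_smul, Nat.cast_add, Nat.cast_one]
      module
  induction n with
  | zero => simp [hFE, hx]
  | succ n ih =>
    rw [pow_succ', Module.End.mul_apply, hFE, ih, hHEn, pow_succ' E n]
    simp only [map_add, map_smul, map_neg, Nat.cast_add, Nat.cast_one,
      ← Module.End.mul_apply E, ← pow_succ']
    module

theorem sl2_E_pow_F (hEF : E * F - F * E = H) (hHF : H * F - F * H = (-2 : ℂ) • F) {y : M}
    (hy : F (E y) = 0) (n : ℕ) :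
    E ((F ^ (n + 1)) y) = (n + 1 : ℂ) • (F ^ n) (H y - (n : ℂ) • y) := by
  have hEF' : ∀ y, E (F y) = F (E y) + H y := fun y => by
    rw [← hEF]; simp
  have hHFn : ∀ (n : ℕ) (y : M), H ((F ^ n) y) = (F ^ n) (H y - (2 * n : ℂ) • y) := by
    intro n
    induction n with
    | zero => intro y; simp
    | succ n ih =>
      intro y
      have h1 : H (F y) = F (H y) - (2 : ℂ) • F y := by
        have := LinearMap.congr_fun hHF y
        simp only [LinearMap.sub_apply, Module.End.mul_apply, LinearMap.smul_apply] at this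
        rw [sub_eq_iff_eq_add] at this
        rw [this]; module
      rw [pow_succ, Module.End.mul_apply, Module.End.mul_apply, ih, h1]
      congr 1
      simp only [map_sub, map_smul, Nat.cast_add, Nat.cast_one]
      module
  induction n with
  | zero => simp [hEF', hy]
  | succ n ih =>
    rw [pow_succ', Module.End.mul_apply, hEF', ih, hHFn, pow_succ' F n]
    simp only [map_sub, map_smul, Nat.cast_add, Nat.cast_one,
      ← Module.End.mul_apply F, ← pow_succ']
    module

/-- In a representation of `sl₂` with nilpotent `E` and `F`, the kernel of `F` and the range of `E`
intersect trivially. -/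
theorem sl2_ker_inf_range (hEF : E * F - F * E = H) (hHE : H * E - E * H = (2 : ℂ) • E)
    (hHF : H * F - F * H = (-2 : ℂ) • F) (hE : IsNilpotent E) (hF : IsNilpotent F) {y : M}
    (hy : F (E y) = 0) : E y = 0 := by
  -- On ker F the operator H is annihilated by a polynomial with roots 0, -1, -2, ...: applying F to
  -- Eⁿ⁺¹x = 0 gives Eⁿ(H + n)x = 0, and (H + n)x is still in ker F.
  have hA : ∀ (n : ℕ) (x : M), F x = 0 → (E ^ n) x = 0 →
      aeval H (∏ i ∈ Finset.range n, (X - C (-(i : ℂ)))) x = 0 := by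
    intro n
    induction n with
    | zero => intro x _ hx; simpa using hx
    | succ n ih =>
      intro x hx hn
      have h1 := sl2_F_pow_E hEF hHE hx n
      rw [hn, map_zero, eq_comm, neg_eq_zero, smul_eq_zero] at h1
      have h2 := h1.resolve_left (by exact_mod_cast Nat.succ_ne_zero n)
      have h3 : F (H x) = 0 := by
        have := LinearMap.congr_fun hHF x
        simp only [LinearMap.sub_apply, Module.End.mul_apply, LinearMap.smul_apply, hx, map_zero,
          smul_zero, zero_sub, neg_eq_zero] at this
        exact this
      rw [Finset.prod_range_succ, map_mul, Module.End.mul_apply]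
      have h4 : aeval H (X - C (-(n : ℂ))) x = H x + (n : ℂ) • x := by
        simp only [map_sub, aeval_X, aeval_C, LinearMap.sub_apply, Module.algebraMap_end_apply]
        module
      rw [h4]
      exact ih _ (by simp [h3, hx]) h2
  -- On vectors Ey killed by F the roots are instead 2, 3, 4, ...: the same argument is run on y
  -- with powers of F.
  have hB : ∀ (n : ℕ) (y : M), F (E y) = 0 → (F ^ n) y = 0 →
      aeval H (∏ i ∈ Finset.range n, (X - C (2 + (i : ℂ)))) (E y) = 0 := by
    intro n
    induction n with
    | zero =>
      intro y _ hy
      simp only [pow_zero, Module.End.one_apply] at hy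
      simp [hy]
    | succ n ih =>
      intro y hy hn
      have h1 := sl2_E_pow_F hEF hHF hy n
      rw [hn, map_zero, eq_comm, smul_eq_zero] at h1
      have h2 := h1.resolve_left (by exact_mod_cast Nat.succ_ne_zero n)
      have h5 : H (E y) = E (H y) + (2 : ℂ) • E y := by
        have := LinearMap.congr_fun hHE y
        simp only [LinearMap.sub_apply, Module.End.mul_apply, LinearMap.smul_apply] at this
        rw [← this]; abel
      have h3 : F (H (E y)) = 0 := by
        have := LinearMap.congr_fun hHF (E y)
        simp only [LinearMap.sub_apply, Module.End.mul_apply, LinearMap.smul_apply, hy, map_zero,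
          smul_zero, zero_sub, neg_eq_zero] at this
        exact this
      rw [Finset.prod_range_succ, map_mul, Module.End.mul_apply]
      have h4 : aeval H (X - C (2 + (n : ℂ))) (E y) = E (H y - (n : ℂ) • y) := by
        simp only [map_sub, aeval_X, aeval_C, LinearMap.sub_apply, Module.algebraMap_end_apply, h5,
          map_smul]
        module
      rw [h4]
      refine ih _ ?_ h2
      have h6 : E (H y - (n : ℂ) • y) = H (E y) - (2 + n : ℂ) • E y := by
        rw [h5, map_sub, map_smul]; module
      rw [h6]
      simp [h3, hy]
  obtain ⟨n, hn⟩ := hE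
  obtain ⟨m, hm⟩ := hF
  have h1 := hA n (E y) hy (by simp [hn])
  have h2 := hB m y hy (by simp [hm])
  -- Nonpositive roots on one side and roots at least 2 on the other: the two polynomials are
  -- coprime, so a vector killed by both is zero.
  have hcop : IsCoprime (∏ i ∈ Finset.range n, (X - C (-(i : ℂ))))
      (∏ i ∈ Finset.range m, (X - C (2 + (i : ℂ)))) := by
    refine IsCoprime.prod_left fun i _ => IsCoprime.prod_right fun j _ =>
      isCoprime_X_sub_C_of_isUnit_sub (IsUnit.mk0 _ ?_)
    have h3 : (-(i : ℂ) - (2 + j)) = -((i + 2 + j : ℕ) : ℂ) := by push_cast; ring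
    rw [h3, neg_ne_zero, Nat.cast_ne_zero]
    omega
  obtain ⟨p, q, hpq⟩ := hcop
  have h3 := congrArg (fun P => aeval H P (E y)) hpq
  rw [map_add, map_mul, map_mul, map_one, LinearMap.add_apply, Module.End.mul_apply,
    Module.End.mul_apply, h1, h2, map_zero, map_zero, add_zero, Module.End.one_apply] at h3
  exact h3.symm

end Sl2

variable {g : Type*} [LieRing g] [LieAlgebra ℂ g] [Module.Finite ℂ g]

/-! ### Gradings -/

/-- The sum of the components of degree at most `k`. -/
def below (gr : ℤ → Submodule ℂ g) (k : ℤ) : Submodule ℂ g := ⨆ i : ℤ, ⨆ _ : i ≤ k, gr i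

/-- A good grading for `f`, with an `sl₂`-triple. -/
structure IsGradedTriple (gr : ℤ → Submodule ℂ g) (e h f : g) : Prop extends
    IsGoodGrading gr f where
  lie_e_f : ⁅e, f⁆ = h
  lie_h_e : ⁅h, e⁆ = (2 : ℂ) • e
  lie_h_f : ⁅h, f⁆ = (-2 : ℂ) • f
  e_mem : e ∈ gr 2

theorem gr_le_below (gr : ℤ → Submodule ℂ g) {i k : ℤ} (h : i ≤ k) : gr i ≤ below gr k :=
  le_iSup₂_of_le i h le_rfl

theorem below_mono (gr : ℤ → Submodule ℂ g) {i k : ℤ} (h : i ≤ k) : below gr i ≤ below gr k :=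
  iSup₂_le fun _ hj => gr_le_below gr (hj.trans h)

theorem below_induction {gr : ℤ → Submodule ℂ g} {k : ℤ} {P : g → Prop}
    (hgr : ∀ i ≤ k, ∀ x ∈ gr i, P x) (hadd : ∀ x y, P x → P y → P (x + y)) {x : g}
    (hx : x ∈ below gr k) : P x := by
  have h0 : P 0 := hgr k le_rfl 0 (zero_mem _)
  unfold below at hx
  induction hx using Submodule.iSup_induction' with
  | mem i x hx =>
    by_cases h : i ≤ k
    · simp only [h, iSup_pos] at hx
      exact hgr i h x hx
    · simp only [h, iSup_neg, not_false_eq_true, Submodule.mem_bot] at hx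
      rwa [hx]
  | zero => exact h0
  | add x y _ _ hx hy => exact hadd _ _ hx hy

namespace IsGradedTriple

variable {gr : ℤ → Submodule ℂ g} {e h f : g}

theorem exists_bound (H : IsGradedTriple gr e h f) :
    ∃ N : ℕ, 2 ≤ N ∧ ∀ i : ℤ, (i < -N ∨ N < i) → gr i = ⊥ := by
  have hfin := WellFoundedGT.finite_ne_bot_of_iSupIndep H.isInternal.submodule_iSupIndep
  obtain ⟨B, hB⟩ := hfin.bddAbove
  obtain ⟨A, hA⟩ := hfin.bddBelow
  -- The summand 2 ensures N ≥ 2, so that ∂_x, which `opFil` puts in degree 2, lies in the top step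
  -- of the filtration.
  refine ⟨2 + A.natAbs + B.natAbs, by omega, fun i hi => ?_⟩
  by_contra hne
  have h1 : i ≤ B := hB hne
  have h2 : A ≤ i := hA hne
  omega

/-- The projection to the component of degree `i`. -/
def pr (H : IsGradedTriple gr e h f) (i : ℤ) : g →ₗ[ℂ] g :=
  (gr i).subtype ∘ₗ DirectSum.component ℂ ℤ (fun i => gr i) i ∘ₗ
    (LinearEquiv.ofBijective (DirectSum.coeLinearMap gr) H.isInternal).symm.toLinearMap

variable (H : IsGradedTriple gr e h f)
include H

theorem pr_mem (i : ℤ) (x : g) : H.pr i x ∈ gr i := by simp [pr]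

theorem symm_of_mem {i : ℤ} {x : g} (hx : x ∈ gr i) :
    (LinearEquiv.ofBijective (DirectSum.coeLinearMap gr) H.isInternal).symm x =
      DirectSum.lof ℂ ℤ (fun i => gr i) i ⟨x, hx⟩ := by
  rw [LinearEquiv.symm_apply_eq]
  exact (DirectSum.coeLinearMap_lof gr i ⟨x, hx⟩).symm

theorem pr_of_mem {i : ℤ} {x : g} (hx : x ∈ gr i) : H.pr i x = x := by
  simp [pr, H.symm_of_mem hx]

theorem pr_of_mem_ne {i j : ℤ} {x : g} (hx : x ∈ gr j) (hij : j ≠ i) : H.pr i x = 0 := by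
  simp only [pr, LinearMap.comp_apply, LinearEquiv.coe_coe, H.symm_of_mem hx]
  rw [DirectSum.component.of, dif_neg hij]
  simp

theorem below_eq_top : ∃ N : ℕ, 2 ≤ N ∧ below gr N = ⊤ ∧ below gr (-N - 1) = ⊥ := by
  obtain ⟨N, hN2, hN⟩ := H.exists_bound
  refine ⟨N, hN2, ?_, ?_⟩
  · rw [eq_top_iff, ← H.isInternal.submodule_iSup_eq_top]
    refine iSup_le fun i => ?_
    by_cases hi : i ≤ N
    · exact gr_le_below gr hi
    · rw [hN i (by omega)]; exact bot_le
  · rw [eq_bot_iff]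
    exact iSup₂_le fun i hi => (hN i (by omega)).le

theorem induction {P : g → Prop} (hgr : ∀ i, ∀ x ∈ gr i, P x)
    (hadd : ∀ x y, P x → P y → P (x + y)) (x : g) : P x := by
  obtain ⟨N, -, hN, -⟩ := H.below_eq_top
  exact below_induction (gr := gr) (k := N) (fun i _ => hgr i) hadd (hN ▸ trivial)

theorem mem_below_iff {k : ℤ} {x : g} : x ∈ below gr k ↔ ∀ i, k < i → H.pr i x = 0 := by
  constructor
  · intro hx
    refine below_induction (P := fun x => ∀ i, k < i → H.pr i x = 0) ?_ ?_ hx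
    · intro i hi x hx j hj
      exact H.pr_of_mem_ne hx (by omega)
    · intro x y hx hy i hi
      rw [map_add, hx i hi, hy i hi, add_zero]
  · obtain ⟨N, -, hN⟩ := H.exists_bound
    have hsum : ∀ x, ∑ i ∈ Finset.Icc (-N : ℤ) N, H.pr i x = x := by
      refine H.induction ?_ ?_
      · intro i x hx
        by_cases hi : i ∈ Finset.Icc (-N : ℤ) N
        · rw [Finset.sum_eq_single i (fun j _ hj => H.pr_of_mem_ne hx hj.symm)
            (fun h => absurd hi h), H.pr_of_mem hx]
        · have : x = 0 := by
            have := hN i (by rw [Finset.mem_Icc] at hi; omega)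
            rw [this] at hx
            exact hx
          simp [this]
      · intro x y hx hy
        simp only [map_add, Finset.sum_add_distrib, hx, hy]
    intro hx
    rw [← hsum x]
    refine sum_mem fun i _ => ?_
    by_cases hi : i ≤ k
    · exact gr_le_below gr hi (H.pr_mem i x)
    · rw [hx i (by omega)]; exact zero_mem _

theorem eq_zero_of_pr {x : g} (hx : ∀ i, H.pr i x = 0) : x = 0 := by
  obtain ⟨N, -, -, hN⟩ := H.below_eq_top
  have : x ∈ below gr (-N - 1) := H.mem_below_iff.2 fun i _ => hx i
  rwa [hN] at this

theorem pr_mem_below {i k : ℤ} (hik : i ≤ k) (x : g) : H.pr i x ∈ below gr k :=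
  gr_le_below gr hik (H.pr_mem i x)

theorem pr_lie {j : ℤ} {y : g} (hy : y ∈ gr j) (i : ℤ) (x : g) :
    H.pr (j + i) ⁅y, x⁆ = ⁅y, H.pr i x⁆ := by
  refine H.induction (P := fun x => H.pr (j + i) ⁅y, x⁆ = ⁅y, H.pr i x⁆) ?_ ?_ x
  · intro k x hx
    by_cases hk : k = i
    · subst hk
      rw [H.pr_of_mem hx, H.pr_of_mem (H.lie_mem j k y hy x hx)]
    · rw [H.pr_of_mem_ne hx hk, H.pr_of_mem_ne (H.lie_mem j k y hy x hx) (by omega), lie_zero]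
  · intro x x' hx hx'
    rw [lie_add, map_add, hx, hx', map_add, lie_add]

theorem lie_mem_below {j k : ℤ} {x y : g} (hx : x ∈ below gr j) (hy : y ∈ below gr k) :
    ⁅x, y⁆ ∈ below gr (j + k) := by
  refine below_induction (P := fun x => ⁅x, y⁆ ∈ below gr (j + k)) ?_ ?_ hx
  · intro i hi x hx
    refine below_induction (P := fun y => ⁅x, y⁆ ∈ below gr (j + k)) ?_ ?_ hy
    · intro i' hi' y hy
      exact gr_le_below gr (add_le_add hi hi') (H.lie_mem i i' x hx y hy)
    · intro y y' hy hy'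
      rw [lie_add]; exact add_mem hy hy'
  · intro x x' hx hx'
    rw [add_lie]; exact add_mem hx hx'

/-- The degrees fill at most the window [-N, N], and 2N + 1 nonzero shifts in one direction leave
it. -/
theorem pow_eq_zero_of_shift : ∃ n : ℕ, ∀ (T : Module.End ℂ g) (d : ℤ), d ≠ 0 →
    (∀ i, ∀ x ∈ gr i, T x ∈ gr (i + d)) → T ^ n = 0 := by
  obtain ⟨N, -, hN⟩ := H.exists_bound
  refine ⟨2 * N + 1, fun T d hd hT => ?_⟩
  have hpow : ∀ (n : ℕ) (i : ℤ) (x : g), x ∈ gr i → (T ^ n) x ∈ gr (i + n * d) := by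
    intro n
    induction n with
    | zero => intro i x hx; simpa using hx
    | succ n ih =>
      intro i x hx
      rw [pow_succ, Module.End.mul_apply]
      have := ih _ _ (hT i x hx)
      convert this using 2
      push_cast; ring
  refine LinearMap.ext fun x => H.induction (P := fun x => (T ^ (2 * N + 1)) x = 0) ?_ ?_ x
  · intro i x hx
    have h1 := hpow (2 * N + 1) i x hx
    by_cases hi : i < -N ∨ N < i
    · rw [hN i hi] at hx
      rw [(Submodule.mem_bot ℂ).1 hx, map_zero]
    · rw [hN] at h1
      · exact h1
      · rcases lt_or_gt_of_ne hd with hd | hd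
        · left
          have := mul_le_mul_of_nonneg_left (show d ≤ -1 by omega) (show (0 : ℤ) ≤ 2 * N + 1 by omega)
          push_cast
          omega
        · right
          have := mul_le_mul_of_nonneg_left (show 1 ≤ d by omega) (show (0 : ℤ) ≤ 2 * N + 1 by omega)
          push_cast
          omega
  · intro x y hx hy
    rw [map_add, hx, hy, add_zero]

/-- The product ad x ad y shifts the degree by i + j ≠ 0, hence has no diagonal block and trace
zero. -/
theorem killing_gr {i j : ℤ} {x y : g} (hx : x ∈ gr i) (hy : y ∈ gr j) (hij : i + j ≠ 0) :
    killingForm ℂ g x y = 0 := by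
  rw [killingForm_apply_apply]
  refine LinearMap.trace_eq_zero_of_mapsTo_ne H.isInternal (fun k => k + (i + j))
    (fun k => by omega) fun k z hz => ?_
  have := H.lie_mem i (j + k) x hx _ (H.lie_mem j k y hy z hz)
  rw [show i + (j + k) = k + (i + j) by ring] at this
  exact this

theorem killing_below {i j : ℤ} {x y : g} (hx : x ∈ below gr i) (hy : y ∈ below gr j)
    (hij : i + j < 0) : killingForm ℂ g x y = 0 := by
  refine below_induction (P := fun x => killingForm ℂ g x y = 0) ?_ ?_ hx
  · intro a ha x hx
    refine below_induction (P := fun y => killingForm ℂ g x y = 0) ?_ ?_ hy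
    · intro b hb y hy
      exact H.killing_gr hx hy (by omega)
    · intro y y' hy hy'
      rw [map_add, hy, hy', add_zero]
  · intro x x' hx hx'
    rw [map_add, LinearMap.add_apply, hx, hx', add_zero]

theorem killing_pr (i : ℤ) (x y : g) :
    killingForm ℂ g (H.pr i x) y = killingForm ℂ g x (H.pr (-i) y) := by
  refine H.induction (P := fun x => killingForm ℂ g (H.pr i x) y =
    killingForm ℂ g x (H.pr (-i) y)) ?_ ?_ x
  · intro a x hx
    refine H.induction (P := fun y => killingForm ℂ g (H.pr i x) y =
      killingForm ℂ g x (H.pr (-i) y)) ?_ ?_ y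
    · intro b y hy
      by_cases ha : a = i <;> by_cases hb : b = -i
      · subst ha; subst hb; rw [H.pr_of_mem hx, H.pr_of_mem hy]
      · subst ha
        rw [H.pr_of_mem hx, H.pr_of_mem_ne hy hb, H.killing_gr hx hy (by omega), map_zero]
      · subst hb
        rw [H.pr_of_mem hy, H.pr_of_mem_ne hx ha, H.killing_gr hx hy (by omega), map_zero,
          LinearMap.zero_apply]
      · rw [H.pr_of_mem_ne hy hb, H.pr_of_mem_ne hx ha, map_zero, map_zero, LinearMap.zero_apply]
    · intro y y' hy hy'
      simp only [map_add, hy, hy']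
  · intro x x' hx hx'
    simp only [map_add, LinearMap.add_apply, hx, hx']

/-! ### The kernel of `ad f` and the range of `ad e` -/

theorem isNilpotent_ad_e : IsNilpotent (LieAlgebra.ad ℂ g e) := by
  obtain ⟨n, hn⟩ := H.pow_eq_zero_of_shift
  refine ⟨n, hn _ 2 (by norm_num) fun i x hx => ?_⟩
  rw [add_comm]
  exact H.lie_mem 2 i e H.e_mem x hx

theorem isNilpotent_ad_f : IsNilpotent (LieAlgebra.ad ℂ g f) := by
  obtain ⟨n, hn⟩ := H.pow_eq_zero_of_shift
  refine ⟨n, hn _ (-2) (by norm_num) fun i x hx => ?_⟩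
  rw [add_comm]
  exact H.lie_mem (-2) i f H.mem x hx

omit H in
theorem ad_mul_sub (x y : g) : LieAlgebra.ad ℂ g x * LieAlgebra.ad ℂ g y -
    LieAlgebra.ad ℂ g y * LieAlgebra.ad ℂ g x = LieAlgebra.ad ℂ g ⁅x, y⁆ :=
  LinearMap.ext fun z => (lie_lie x y z).symm

theorem lie_e_eq_zero {y : g} (hy : ⁅f, ⁅e, y⁆⁆ = 0) : ⁅e, y⁆ = 0 := by
  refine sl2_ker_inf_range (E := LieAlgebra.ad ℂ g e) (F := LieAlgebra.ad ℂ g f)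
    (H := LieAlgebra.ad ℂ g h) ?_ ?_ ?_ H.isNilpotent_ad_e H.isNilpotent_ad_f hy
  · rw [ad_mul_sub, H.lie_e_f]
  · rw [ad_mul_sub, H.lie_h_e, map_smul]
  · rw [ad_mul_sub, H.lie_h_f, map_smul]

/-- The triple (f, -h, e) satisfies the same relations, so this is `lie_e_eq_zero` with e and f
exchanged. -/
theorem lie_f_eq_zero {y : g} (hy : ⁅e, ⁅f, y⁆⁆ = 0) : ⁅f, y⁆ = 0 := by
  refine sl2_ker_inf_range (E := LieAlgebra.ad ℂ g f) (F := LieAlgebra.ad ℂ g e)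
    (H := LieAlgebra.ad ℂ g (-h)) ?_ ?_ ?_ H.isNilpotent_ad_f H.isNilpotent_ad_e hy
  · rw [ad_mul_sub, ← lie_skew, H.lie_e_f]
  · rw [ad_mul_sub, neg_lie, H.lie_h_f, ← map_smul, neg_smul, neg_neg]
  · rw [ad_mul_sub, neg_lie, H.lie_h_e, ← map_smul, neg_smul]

/-- A component of degree i ≤ -1 is [f, y] with y of degree i + 2 ≤ 1, by surjectivity in the good
grading. Then [e, [f, y]] = 0 forces [f, y] = 0. -/
theorem ad_e_injective {x : g} (hx : x ∈ below gr (-1)) (hex : ⁅e, x⁆ = 0) : x = 0 := by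
  refine H.eq_zero_of_pr fun i => ?_
  by_cases hi : -1 < i
  · exact H.mem_below_iff.1 hx i hi
  · obtain ⟨y, -, hy⟩ := H.surjective (i + 2) (by omega) (H.pr i x)
      (by simpa using H.pr_mem i x)
    have h1 : ⁅e, H.pr i x⁆ = 0 := by rw [← H.pr_lie H.e_mem, hex, map_zero]
    rw [← hy] at h1 ⊢
    exact H.lie_f_eq_zero h1

theorem ker_f_mem_below {x : g} (hx : ⁅f, x⁆ = 0) : x ∈ below gr 0 := by
  refine H.mem_below_iff.2 fun i hi => H.injective i (by omega) _ (H.pr_mem i x) ?_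
  rw [← H.pr_lie H.mem, hx, map_zero]

theorem lie_e_mem {k : ℤ} {x : g} (hx : x ∈ below gr k) : ⁅e, x⁆ ∈ below gr (k + 2) := by
  rw [add_comm]
  exact H.lie_mem_below (gr_le_below gr le_rfl H.e_mem) hx

theorem lie_f_mem {k : ℤ} {x : g} (hx : x ∈ below gr k) : ⁅f, x⁆ ∈ below gr (k - 2) := by
  rw [sub_eq_neg_add]
  exact H.lie_mem_below (gr_le_below gr le_rfl H.mem) hx

/-- This is g_{≤1} = [e, g_{≤-1}] + ker ad f. The map ad f ad e preserves g_{≤-1} and is injective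
there, hence surjective by finite dimension, and [f, [e, w]] = [f, x] can be solved for w. -/
theorem exists_decomp {x : g} (hx : x ∈ below gr 1) :
    ∃ w ∈ below gr (-1), ⁅f, x - ⁅e, w⁆⁆ = 0 := by
  let T : below gr (-1) →ₗ[ℂ] below gr (-1) :=
    LinearMap.restrict (LieAlgebra.ad ℂ g f * LieAlgebra.ad ℂ g e) fun w hw => by
      simpa using H.lie_f_mem (H.lie_e_mem hw)
  have hinj : Function.Injective T := by
    rw [injective_iff_map_eq_zero]
    intro w hw
    exact Subtype.ext (H.ad_e_injective w.2 (H.lie_e_eq_zero (congrArg Subtype.val hw)))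
  obtain ⟨w, hw⟩ := LinearMap.injective_iff_surjective.1 hinj ⟨⁅f, x⁆, by simpa using H.lie_f_mem hx⟩
  refine ⟨w, w.2, ?_⟩
  have : ⁅f, ⁅e, (w : g)⁆⁆ = ⁅f, x⁆ := congrArg Subtype.val hw
  rw [lie_sub, this, sub_self]

/-- The projection of `g` to the part of negative degree that inverts `ad e` and vanishes on the
kernel of `ad f`. -/
theorem exists_retraction : ∃ ρ : g →ₗ[ℂ] g, (∀ w ∈ below gr (-1), ρ ⁅e, w⁆ = w) ∧
    (∀ z, ⁅f, z⁆ = 0 → ρ z = 0) ∧ (∀ x, ρ x ∈ below gr (-1)) ∧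
    (∀ k ≤ 1, ∀ x ∈ below gr k, ρ x ∈ below gr (k - 2)) ∧
    ∀ x ∈ below gr 1, ρ x = 0 → ⁅f, x⁆ = 0 := by
  -- The map (w, z) ↦ [e, w] + z is injective, and the first component of a left inverse is the
  -- retraction. Outside the range of this map its values do not matter.
  let A : (below gr (-1) × LinearMap.ker (LieAlgebra.ad ℂ g f)) →ₗ[ℂ] g :=
    LinearMap.coprod (LieAlgebra.ad ℂ g e ∘ₗ Submodule.subtype _) (Submodule.subtype _)
  have hA : LinearMap.ker A = ⊥ := by
    rw [LinearMap.ker_eq_bot']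
    rintro ⟨⟨w, hw⟩, ⟨z, hz⟩⟩ h0
    have h0' : ⁅e, w⁆ + z = 0 := h0
    have hz' : ⁅f, z⁆ = 0 := hz
    have h1 : ⁅f, ⁅e, w⁆⁆ = 0 := by
      rw [eq_neg_of_add_eq_zero_left h0', lie_neg, hz', neg_zero]
    have h2 := H.lie_e_eq_zero h1
    have h3 := H.ad_e_injective hw h2
    rw [h2, zero_add] at h0'
    simp [h3, h0']
  obtain ⟨B, hB⟩ := LinearMap.exists_leftInverse_of_injective A hA
  have hB' : ∀ w (hw : w ∈ below gr (-1)) z (hz : ⁅f, z⁆ = 0),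
      (B (⁅e, w⁆ + z)).1 = ⟨w, hw⟩ := fun w hw z hz =>
    congrArg Prod.fst (LinearMap.congr_fun hB (⟨w, hw⟩, ⟨z, hz⟩))
  have hρ : ∀ w (_ : w ∈ below gr (-1)) z (_ : ⁅f, z⁆ = 0),
      ((Submodule.subtype _ ∘ₗ LinearMap.fst ℂ _ _ ∘ₗ B : g →ₗ[ℂ] g)) (⁅e, w⁆ + z) = w :=
    fun w hw z hz => congrArg Subtype.val (hB' w hw z hz)
  refine ⟨Submodule.subtype _ ∘ₗ LinearMap.fst ℂ _ _ ∘ₗ B, ?_, ?_, ?_, ?_, ?_⟩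
  · intro w hw
    simpa using hρ w hw 0 (lie_zero _)
  · intro z hz
    simpa using hρ 0 (zero_mem _) z hz
  · intro x
    exact (B x).1.2
  · intro k hk x hx
    obtain ⟨w, hw, hwx⟩ := H.exists_decomp (below_mono gr hk hx)
    have h1 := hρ w hw _ hwx
    rw [add_sub_cancel] at h1
    rw [h1]
    refine H.mem_below_iff.2 fun i hi => ?_
    by_cases hi' : -1 < i
    · exact H.mem_below_iff.1 hw i hi'
    -- For k - 2 < i ≤ -1 the component of x in degree i + 2 > k vanishes, so the f-kernel condition
    -- there only concerns [e, w_i], which must be zero.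
    · have h2 : ⁅f, H.pr (2 + i) (x - ⁅e, w⁆)⁆ = 0 := by
        rw [← H.pr_lie H.mem, hwx, map_zero]
      rw [map_sub, H.mem_below_iff.1 hx (2 + i) (by omega), zero_sub, lie_neg, neg_eq_zero,
        H.pr_lie H.e_mem] at h2
      exact H.ad_e_injective (H.pr_mem_below (by omega) w) (H.lie_e_eq_zero h2)
  · intro x hx hρx
    obtain ⟨w, hw, hwx⟩ := H.exists_decomp hx
    have h1 := hρ w hw _ hwx
    rw [add_sub_cancel, hρx] at h1
    rw [← h1, lie_zero, sub_zero] at hwx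
    exact hwx

/-! ### The subspaces defined by an isotropic subspace -/

theorem mem_lowerPart {l : Submodule ℂ g} (hl : l ≤ gr (-1)) {x : g} :
    x ∈ lowerPart gr l ↔ x ∈ below gr (-1) ∧ H.pr (-1) x ∈ l := by
  constructor
  · intro hx
    obtain ⟨y, hy, z, hz, rfl⟩ := Submodule.mem_sup.1 hx
    have hz' : z ∈ below gr (-2) := hz
    refine ⟨add_mem (gr_le_below gr le_rfl (hl hy)) (below_mono gr (by norm_num) hz'), ?_⟩
    rw [map_add, H.pr_of_mem (hl hy), H.mem_below_iff.1 hz' (-1) (by norm_num), add_zero]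
    exact hy
  · rintro ⟨hx, hx'⟩
    refine Submodule.mem_sup.2 ⟨_, hx', x - H.pr (-1) x, ?_, by abel⟩
    change _ ∈ below gr (-2)
    refine H.mem_below_iff.2 fun i hi => ?_
    rw [map_sub]
    by_cases hi' : i = -1
    · subst hi'
      rw [H.pr_of_mem (H.pr_mem _ _), sub_self]
    · rw [H.mem_below_iff.1 hx i (by omega), H.pr_of_mem_ne (H.pr_mem (-1) x) (Ne.symm hi'),
        sub_zero]

theorem coisotropic_le (l : Submodule ℂ g) : coisotropic gr e l ≤ gr (-1) := fun _ hx => hx.1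

theorem lowerPart_le {l : Submodule ℂ g} (hl : l ≤ gr (-1)) : lowerPart gr l ≤ below gr (-1) :=
  fun _ hx => ((H.mem_lowerPart hl).1 hx).1

theorem lowerPart_mono {l l' : Submodule ℂ g} (h : l ≤ l') : lowerPart gr l ≤ lowerPart gr l' :=
  sup_le_sup_right h _

/-- A bracket of negative elements has degree at most -2, hence lies in `lowerPart` for any l. In
particular n is a subalgebra. -/
theorem lie_mem_lowerPart {l : Submodule ℂ g} {x y : g}
    (hx : x ∈ below gr (-1)) (hy : y ∈ below gr (-1)) : ⁅x, y⁆ ∈ lowerPart gr l := by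
  have h1 : ⁅x, y⁆ ∈ below gr (-2) := by simpa using H.lie_mem_below hx hy
  have h2 : below gr (-2) ≤ lowerPart gr l := le_sup_right
  exact h2 h1

/-- Only the component of degree -2 of [x, y] pairs with e, and with y of degree -1 it comes from
the component of x of degree -1. -/
theorem killing_e (x : g) {y : g} (hy : y ∈ gr (-1)) :
    killingForm ℂ g e ⁅H.pr (-1) x, y⁆ = killingForm ℂ g e ⁅x, y⁆ := by
  have h1 : ⁅H.pr (-1) x, y⁆ = H.pr (-2) ⁅x, y⁆ := by
    rw [← lie_skew, ← lie_skew x, map_neg, ← H.pr_lie hy]; rfl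
  have h2 := H.killing_pr 2 e ⁅x, y⁆
  rw [H.pr_of_mem H.e_mem] at h2
  rw [h1, h2]

variable [LieAlgebra.IsKilling ℂ g]

theorem killing_nondegenerate {x : g} (hx : ∀ y, killingForm ℂ g x y = 0) : x = 0 :=
  (LieAlgebra.IsKilling.killingForm_nondegenerate ℂ g).1 x hx

/-- By invariance ⟨[e, y]|x⟩ = -⟨e|[x, y]⟩, so the condition defining l' is orthogonality to [e, l].
Orthogonality to g_{≤0} leaves only negative degrees. -/
theorem mem_coisotropic_part {l : Submodule ℂ g} (hl : l ≤ gr (-1)) {x : g} :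
    x ∈ lowerPart gr (coisotropic gr e l) ↔
      x ∈ (killingForm ℂ g).orthogonal (l.map (LieAlgebra.ad ℂ g e) ⊔ below gr 0) := by
  have hkey : ∀ y ∈ l, killingForm ℂ g ⁅e, y⁆ x = -killingForm ℂ g e ⁅H.pr (-1) x, y⁆ := by
    intro y hy
    rw [H.killing_e x (hl hy), LieModule.traceForm_apply_lie_apply, ← lie_skew y x, map_neg]
  rw [H.mem_lowerPart (H.coisotropic_le l), LinearMap.BilinForm.mem_orthogonal_iff]
  constructor
  · rintro ⟨hx, hx'⟩ z hz
    obtain ⟨u, hu, v, hv, rfl⟩ := Submodule.mem_sup.1 hz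
    obtain ⟨y, hy, rfl⟩ := hu
    change killingForm ℂ g (⁅e, y⁆ + v) x = 0
    rw [map_add, LinearMap.add_apply, H.killing_below hv hx (by norm_num), hkey y hy, hx'.2 y hy]
    simp
  · intro hx
    have h1 : x ∈ below gr (-1) := by
      refine H.mem_below_iff.2 fun i hi => H.killing_nondegenerate fun y => ?_
      rw [H.killing_pr, LieModule.traceForm_comm]
      exact hx _ (Submodule.mem_sup_right (H.pr_mem_below (by omega) y))
    refine ⟨h1, H.pr_mem _ _, fun y hy => ?_⟩
    have := hx ⁅e, y⁆ (Submodule.mem_sup_left ⟨y, hy, rfl⟩)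
    rw [← neg_eq_zero, ← hkey y hy]
    exact this

theorem lowerPart_coisotropic {l : Submodule ℂ g} (hl : l ≤ gr (-1)) :
    lowerPart gr (coisotropic gr e l) =
      (killingForm ℂ g).orthogonal (l.map (LieAlgebra.ad ℂ g e) ⊔ below gr 0) :=
  Submodule.ext fun _ => H.mem_coisotropic_part hl

theorem orthogonal_orthogonal (W : Submodule ℂ g) :
    (killingForm ℂ g).orthogonal ((killingForm ℂ g).orthogonal W) = W :=
  LinearMap.BilinForm.orthogonal_orthogonal
    (LieAlgebra.IsKilling.killingForm_nondegenerate ℂ g)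
    (LieModule.traceForm_isSymm ℂ g g).isRefl W

/-- Taking orthogonals twice gives b = [e, l] ⊕ g_{≤0}: all of g_{≤0}, and [e, l] in degree 1. -/
theorem mem_orthogonal_coisotropic {l : Submodule ℂ g} (hl : l ≤ gr (-1)) {x : g} :
    x ∈ (killingForm ℂ g).orthogonal (lowerPart gr (coisotropic gr e l)) ↔
      x ∈ below gr 1 ∧ ∃ y ∈ l, H.pr 1 x = ⁅e, y⁆ := by
  rw [H.lowerPart_coisotropic hl, H.orthogonal_orthogonal]
  constructor
  · intro hx
    obtain ⟨u, hu, v, hv, rfl⟩ := Submodule.mem_sup.1 hx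
    obtain ⟨y, hy, rfl⟩ := hu
    have h1 : ⁅e, y⁆ ∈ gr 1 := H.lie_mem 2 (-1) e H.e_mem y (hl hy)
    refine ⟨add_mem (gr_le_below gr le_rfl h1) (below_mono gr (by norm_num) hv), y, hy, ?_⟩
    rw [map_add, H.mem_below_iff.1 hv 1 (by norm_num), add_zero]
    exact H.pr_of_mem h1
  · rintro ⟨hx, y, hy, hxy⟩
    refine Submodule.mem_sup.2 ⟨⁅e, y⁆, ⟨y, hy, rfl⟩, x - ⁅e, y⁆, ?_, by abel⟩
    rw [← hxy]
    refine H.mem_below_iff.2 fun i hi => ?_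
    rw [map_sub]
    by_cases hi' : i = 1
    · subst hi'
      rw [H.pr_of_mem (H.pr_mem _ _), sub_self]
    · rw [H.mem_below_iff.1 hx i (by omega), H.pr_of_mem_ne (H.pr_mem 1 x) (Ne.symm hi'),
        sub_zero]

/-- Biduality l'' = l for the form (x, y) = ⟨e|[x, y]⟩. Orthogonality to l' puts [e, x] in n^⊥,
whose part of degree 1 is [e, l], and ad e is injective in degree -1. -/
theorem mem_of_coisotropic {l : Submodule ℂ g} (hl : l ≤ gr (-1)) {x : g} (hx : x ∈ gr (-1))
    (h0 : ∀ y ∈ coisotropic gr e l, killingForm ℂ g e ⁅x, y⁆ = 0) : x ∈ l := by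
  have h1 : ⁅e, x⁆ ∈ gr 1 := H.lie_mem 2 (-1) e H.e_mem x hx
  have h2 : ⁅e, x⁆ ∈ (killingForm ℂ g).orthogonal (lowerPart gr (coisotropic gr e l)) := by
    rw [LinearMap.BilinForm.mem_orthogonal_iff]
    intro y hy
    obtain ⟨hy1, hy2⟩ := (H.mem_lowerPart (H.coisotropic_le l)).1 hy
    change killingForm ℂ g y ⁅e, x⁆ = 0
    rw [LieModule.traceForm_comm]
    have h3 := H.killing_pr 1 ⁅e, x⁆ y
    rw [H.pr_of_mem h1] at h3
    rw [h3, LieModule.traceForm_apply_lie_apply]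
    exact h0 _ hy2
  obtain ⟨-, y, hy, hxy⟩ := (H.mem_orthogonal_coisotropic hl).1 h2
  rw [H.pr_of_mem h1] at hxy
  have h3 : x - y = 0 := by
    refine H.ad_e_injective (gr_le_below gr le_rfl (sub_mem hx (hl hy))) ?_
    rw [lie_sub, hxy, sub_self]
  rwa [sub_eq_zero.1 h3]

end IsGradedTriple

end

end LoopReduction

/-! ### Differentiable families of loops, and rings of differential polynomials. -/

namespace LoopReduction

set_option linter.unusedSectionVars false

noncomputable section

/-! ### Families of functions on the circle -/

theorem form_expand {V : Type*} [AddCommGroup V] [Module ℂ V] [Module.Finite ℂ V]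
    (φ : V →ₗ[ℂ] ℂ) (y : V) :
    φ y = ∑ i, φ (Module.finBasis ℂ V i) * (Module.finBasis ℂ V).coord i y := by
  conv_lhs => rw [← (Module.finBasis ℂ V).sum_repr y]
  simp only [map_sum, map_smul, smul_eq_mul, Module.Basis.coord_apply, mul_comm]

theorem iteratedDeriv_add_circleFun {u v : ℝ → ℂ} (hu : u ∈ circleFun) (hv : v ∈ circleFun)
    (r : ℕ) : iteratedDeriv r (fun x => u x + v x) =
      fun x => iteratedDeriv r u x + iteratedDeriv r v x := by
  induction r generalizing u v with
  | zero => simp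
  | succ r ih =>
    simp only [iteratedDeriv_succ']
    rw [deriv_add_circleFun hu hv]
    exact ih (deriv_mem_circleFun hu) (deriv_mem_circleFun hv)

theorem iteratedDeriv_const_mul_circleFun (c : ℂ) {u : ℝ → ℂ} (hu : u ∈ circleFun)
    (r : ℕ) : iteratedDeriv r (fun x => c * u x) = fun x => c * iteratedDeriv r u x := by
  induction r generalizing u with
  | zero => simp
  | succ r ih =>
    simp only [iteratedDeriv_succ']
    rw [deriv_const_mul_circleFun c hu]
    exact ih (deriv_mem_circleFun hu)

theorem iteratedDeriv_zero_fun' (r : ℕ) : iteratedDeriv r (fun _ : ℝ => (0 : ℂ)) = fun _ => 0 := by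
  have := iteratedDeriv_const_mul_circleFun 0 (const_mem_circleFun 0) r
  simpa using this

section Families

variable {𝕜 : Type} [RCLike 𝕜] [NormedAlgebra 𝕜 ℂ]

/-- A family of functions on the circle depending differentiably on a parameter, together with all
its derivatives with respect to the circle variable; `u'` is the derivative with respect to the
parameter. -/
structure IsJetFamily (u u' : 𝕜 → ℝ → ℂ) : Prop where
  mem : ∀ τ, u τ ∈ circleFun
  mem' : ∀ τ, u' τ ∈ circleFun
  hasDerivAt : ∀ r τ x,
    HasDerivAt (fun τ => iteratedDeriv r (u τ) x) (iteratedDeriv r (u' τ) x) τ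
  cont : ∀ r, Continuous fun p : 𝕜 × ℝ => iteratedDeriv r (u p.1) p.2
  cont' : ∀ r, Continuous fun p : 𝕜 × ℝ => iteratedDeriv r (u' p.1) p.2

theorem IsJetFamily.congr {u u' v v' : 𝕜 → ℝ → ℂ} (h : IsJetFamily u u')
    (huv : ∀ τ x, u τ x = v τ x) (huv' : ∀ τ x, u' τ x = v' τ x) : IsJetFamily v v' := by
  have h1 : u = v := funext fun τ => funext fun x => huv τ x
  have h2 : u' = v' := funext fun τ => funext fun x => huv' τ x
  exact h1 ▸ h2 ▸ h

theorem IsJetFamily.scalar {c c' : 𝕜 → ℂ} (hc : ∀ τ, HasDerivAt c (c' τ) τ) (hc' : Continuous c')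
    {u : ℝ → ℂ} (hu : u ∈ circleFun) :
    IsJetFamily (fun τ x => c τ * u x) (fun τ x => c' τ * u x) where
  mem τ := mul_mem (const_mem_circleFun (c τ)) hu
  mem' τ := mul_mem (const_mem_circleFun (c' τ)) hu
  hasDerivAt r τ x := by
    simp only [iteratedDeriv_const_mul_circleFun _ hu]
    exact (hc τ).mul_const _
  cont r := by
    simp only [iteratedDeriv_const_mul_circleFun _ hu]
    have h1 : Continuous c := continuous_iff_continuousAt.2 fun τ => (hc τ).continuousAt
    exact (h1.comp continuous_fst).mul
      ((continuous_of_mem_circleFun (iteratedDeriv_mem_circleFun hu r)).comp continuous_snd)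
  cont' r := by
    simp only [iteratedDeriv_const_mul_circleFun _ hu]
    exact (hc'.comp continuous_fst).mul
      ((continuous_of_mem_circleFun (iteratedDeriv_mem_circleFun hu r)).comp continuous_snd)

theorem IsJetFamily.const {u : ℝ → ℂ} (hu : u ∈ circleFun) :
    IsJetFamily (fun _ : 𝕜 => u) (fun _ _ => 0) :=
  (IsJetFamily.scalar (c := fun _ => 1) (c' := fun _ => 0) (fun τ => hasDerivAt_const τ _)
    continuous_const hu).congr (by simp) (by simp)

theorem IsJetFamily.deriv {u u' : 𝕜 → ℝ → ℂ} (h : IsJetFamily u u') :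
    IsJetFamily (fun τ => deriv (u τ)) (fun τ => deriv (u' τ)) where
  mem τ := deriv_mem_circleFun (h.mem τ)
  mem' τ := deriv_mem_circleFun (h.mem' τ)
  hasDerivAt r τ x := by simpa only [iteratedDeriv_succ'] using h.hasDerivAt (r + 1) τ x
  cont r := by simpa only [iteratedDeriv_succ'] using h.cont (r + 1)
  cont' r := by simpa only [iteratedDeriv_succ'] using h.cont' (r + 1)

theorem IsJetFamily.iteratedDeriv {u u' : 𝕜 → ℝ → ℂ} (h : IsJetFamily u u') (r : ℕ) :
    IsJetFamily (fun τ => iteratedDeriv r (u τ)) (fun τ => iteratedDeriv r (u' τ)) := by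
  induction r generalizing u u' with
  | zero => simpa using h
  | succ r ih => simpa only [iteratedDeriv_succ'] using ih h.deriv

theorem IsJetFamily.add {u u' v v' : 𝕜 → ℝ → ℂ} (hu : IsJetFamily u u') (hv : IsJetFamily v v') :
    IsJetFamily (fun τ x => u τ x + v τ x) (fun τ x => u' τ x + v' τ x) where
  mem τ := add_mem (hu.mem τ) (hv.mem τ)
  mem' τ := add_mem (hu.mem' τ) (hv.mem' τ)
  hasDerivAt r τ x := by
    simp only [fun τ => iteratedDeriv_add_circleFun (hu.mem τ) (hv.mem τ) r,
      iteratedDeriv_add_circleFun (hu.mem' τ) (hv.mem' τ) r]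
    exact (hu.hasDerivAt r τ x).add (hv.hasDerivAt r τ x)
  cont r := by
    simp only [fun τ => iteratedDeriv_add_circleFun (hu.mem τ) (hv.mem τ) r]
    exact (hu.cont r).add (hv.cont r)
  cont' r := by
    simp only [fun τ => iteratedDeriv_add_circleFun (hu.mem' τ) (hv.mem' τ) r]
    exact (hu.cont' r).add (hv.cont' r)

/-- Induction on the order of the x-derivative with both families free: one use of the product rule
turns order r + 1 for (u, v) into order r for (u', v) and (u, v'), which avoids binomial sums. -/
theorem IsJetFamily.mul {u u' v v' : 𝕜 → ℝ → ℂ} (hu : IsJetFamily u u') (hv : IsJetFamily v v') :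
    IsJetFamily (fun τ x => u τ x * v τ x) (fun τ x => u' τ x * v τ x + u τ x * v' τ x) := by
  have hd : ∀ {u v : 𝕜 → ℝ → ℂ}, (∀ τ, u τ ∈ circleFun) → (∀ τ, v τ ∈ circleFun) → ∀ r τ,
      _root_.iteratedDeriv (r + 1) (fun x => u τ x * v τ x) = fun x =>
        _root_.iteratedDeriv r (fun x => _root_.deriv (u τ) x * v τ x) x +
        _root_.iteratedDeriv r (fun x => u τ x * _root_.deriv (v τ) x) x := by
    intro u v hu hv r τ
    rw [iteratedDeriv_succ', deriv_mul_circleFun (hu τ) (hv τ)]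
    exact iteratedDeriv_add_circleFun (mul_mem (deriv_mem_circleFun (hu τ)) (hv τ))
      (mul_mem (hu τ) (deriv_mem_circleFun (hv τ))) r
  have hcont : ∀ (r : ℕ) (u v : 𝕜 → ℝ → ℂ), (∀ τ, u τ ∈ circleFun) → (∀ τ, v τ ∈ circleFun) →
      (∀ r, Continuous fun p : 𝕜 × ℝ => _root_.iteratedDeriv r (u p.1) p.2) →
      (∀ r, Continuous fun p : 𝕜 × ℝ => _root_.iteratedDeriv r (v p.1) p.2) →
      Continuous fun p : 𝕜 × ℝ => _root_.iteratedDeriv r (fun x => u p.1 x * v p.1 x) p.2 := by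
    intro r
    induction r with
    | zero =>
      intro u v _ _ h1 h2
      simp only [iteratedDeriv_zero] at h1 h2 ⊢
      have := (h1 0).mul (h2 0)
      simp only [iteratedDeriv_zero] at this
      exact this
    | succ r ih =>
      intro u v hu hv h1 h2
      simp only [hd hu hv]
      refine (ih _ _ (fun τ => deriv_mem_circleFun (hu τ)) hv (fun r => ?_) h2).add
        (ih _ _ hu (fun τ => deriv_mem_circleFun (hv τ)) h1 fun r => ?_)
      · simpa only [iteratedDeriv_succ'] using h1 (r + 1)
      · simpa only [iteratedDeriv_succ'] using h2 (r + 1)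
  have hder : ∀ (r : ℕ) (u u' v v' : 𝕜 → ℝ → ℂ), IsJetFamily u u' → IsJetFamily v v' → ∀ τ x,
      HasDerivAt (fun τ => _root_.iteratedDeriv r (fun x => u τ x * v τ x) x)
        (_root_.iteratedDeriv r (fun x => u' τ x * v τ x + u τ x * v' τ x) x) τ := by
    intro r
    induction r with
    | zero =>
      intro u u' v v' hu hv τ x
      simpa using (hu.hasDerivAt 0 τ x).fun_mul (hv.hasDerivAt 0 τ x)
    | succ r ih =>
      intro u u' v v' hu hv τ x
      simp only [hd hu.mem hv.mem]
      have h1 := (ih _ _ _ _ hu.deriv hv τ x).add (ih _ _ _ _ hu hv.deriv τ x)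
      refine h1.congr_deriv ?_
      have m1 := mul_mem (hu.mem' τ) (hv.mem τ)
      have m2 := mul_mem (hu.mem τ) (hv.mem' τ)
      have m3 := mul_mem (hu.deriv.mem' τ) (hv.mem τ)
      have m4 := mul_mem (hu.deriv.mem τ) (hv.mem' τ)
      have m5 := mul_mem (hu.mem' τ) (hv.deriv.mem τ)
      have m6 := mul_mem (hu.mem τ) (hv.deriv.mem' τ)
      have e1 := iteratedDeriv_add_circleFun (add_mem m3 m4) (add_mem m5 m6) r
      rw [iteratedDeriv_succ']
      have e2 : _root_.deriv (fun x => u' τ x * v τ x + u τ x * v' τ x) = fun x =>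
          (_root_.deriv (u' τ) x * v τ x + _root_.deriv (u τ) x * v' τ x) +
          (u' τ x * _root_.deriv (v τ) x + u τ x * _root_.deriv (v' τ) x) := by
        have := deriv_add_circleFun m1 m2
        refine this.trans ?_
        have h3 : _root_.deriv (u' τ * v τ) = _ := deriv_mul_circleFun (hu.mem' τ) (hv.mem τ)
        have h4 : _root_.deriv (u τ * v' τ) = _ := deriv_mul_circleFun (hu.mem τ) (hv.mem' τ)
        rw [h3, h4]
        funext x
        ring
      rw [e2]
      exact (congrFun e1 x).symm
  refine ⟨fun τ => mul_mem (hu.mem τ) (hv.mem τ), fun τ => add_mem (mul_mem (hu.mem' τ) (hv.mem τ))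
    (mul_mem (hu.mem τ) (hv.mem' τ)), fun r τ x => hder r _ _ _ _ hu hv τ x,
    fun r => hcont r u v hu.mem hv.mem hu.cont hv.cont, fun r => ?_⟩
  have h3 := fun τ => iteratedDeriv_add_circleFun (mul_mem (hu.mem' τ) (hv.mem τ))
    (mul_mem (hu.mem τ) (hv.mem' τ)) r
  simp only [Pi.mul_apply] at h3
  simp only [h3]
  exact (hcont r u' v hu.mem' hv.mem hu.cont' hv.cont).add
    (hcont r u v' hu.mem hv.mem' hu.cont hv.cont')

theorem IsJetFamily.const_mul {u u' : 𝕜 → ℝ → ℂ} (c : ℂ) (hu : IsJetFamily u u') :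
    IsJetFamily (fun τ x => c * u τ x) (fun τ x => c * u' τ x) :=
  ((IsJetFamily.const (const_mem_circleFun c)).mul hu).congr (by simp) (by simp)

theorem IsJetFamily.sum {κ : Type*} (t : Finset κ) {u u' : κ → 𝕜 → ℝ → ℂ}
    (h : ∀ j ∈ t, IsJetFamily (u j) (u' j)) :
    IsJetFamily (fun τ x => ∑ j ∈ t, u j τ x) (fun τ x => ∑ j ∈ t, u' j τ x) := by
  classical
  induction t using Finset.induction_on with
  | empty => simpa using IsJetFamily.const (𝕜 := 𝕜) (const_mem_circleFun 0)
  | insert a t ha ih =>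
    simp only [Finset.sum_insert ha]
    exact (h a (Finset.mem_insert_self a t)).add
      (ih fun j hj => h j (Finset.mem_insert_of_mem hj))

/-- Differentiation under the integral sign. The parameter derivative is jointly continuous, hence
bounded on the compact set (unit ball) × [0, 1]. -/
theorem IsJetFamily.hasDerivAt_integral {u u' : 𝕜 → ℝ → ℂ} (h : IsJetFamily u u') (τ : 𝕜) :
    HasDerivAt (fun τ => ∫ x in (0 : ℝ)..1, u τ x) (∫ x in (0 : ℝ)..1, u' τ x) τ := by
  have hK : IsCompact (Metric.closedBall τ 1 ×ˢ Set.Icc (0 : ℝ) 1) :=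
    (isCompact_closedBall τ 1).prod isCompact_Icc
  obtain ⟨C, hC⟩ := hK.exists_bound_of_continuousOn (f := fun p : 𝕜 × ℝ => u' p.1 p.2)
    (by simpa using (h.cont' 0).continuousOn)
  refine (intervalIntegral.hasDerivAt_integral_of_dominated_loc_of_deriv_le
    (F := u) (F' := u') (bound := fun _ => C) (Metric.closedBall_mem_nhds τ one_pos) ?_ ?_ ?_ ?_ ?_
    ?_).2
  · exact Filter.Eventually.of_forall fun t =>
      (continuous_of_mem_circleFun (h.mem t)).aestronglyMeasurable
  · exact intervalIntegrable_of_mem_circleFun (h.mem τ)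
  · exact (continuous_of_mem_circleFun (h.mem' τ)).aestronglyMeasurable
  · refine Filter.Eventually.of_forall fun x hx t ht => hC (t, x) ⟨ht, ?_⟩
    rw [Set.uIoc_of_le zero_le_one] at hx
    exact ⟨hx.1.le, hx.2⟩
  · exact intervalIntegrable_const
  · refine Filter.Eventually.of_forall fun x _ t _ => ?_
    simpa using h.hasDerivAt 0 t x

variable {g : Type*} [LieRing g] [LieAlgebra ℂ g] [Module.Finite ℂ g]

/-- A curve of loops with velocity `γ'`, differentiable together with its jets. -/
def IsJetCurve (γ γ' : 𝕜 → Loop g) : Prop :=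
  ∀ φ : g →ₗ[ℂ] ℂ, IsJetFamily (fun τ x => φ ((γ τ).1 x)) (fun τ x => φ ((γ' τ).1 x))

theorem IsJetCurve.scalar {c c' : 𝕜 → ℂ} (hc : ∀ τ, HasDerivAt c (c' τ) τ) (hc' : Continuous c')
    (q : Loop g) : IsJetCurve (fun τ => c τ • q) (fun τ => c' τ • q) := fun φ =>
  (IsJetFamily.scalar hc hc' (form_mem q φ)).congr (by simp) (by simp)

theorem IsJetCurve.const (q : Loop g) : IsJetCurve (fun _ : 𝕜 => q) (fun _ => 0) := fun φ =>
  (IsJetFamily.const (form_mem q φ)).congr (by simp) (by simp)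

theorem IsJetCurve.add {γ γ' η η' : 𝕜 → Loop g} (hγ : IsJetCurve γ γ') (hη : IsJetCurve η η') :
    IsJetCurve (fun τ => γ τ + η τ) (fun τ => γ' τ + η' τ) := fun φ =>
  ((hγ φ).add (hη φ)).congr (by simp) (by simp)

theorem IsJetCurve.sum {κ : Type*} (t : Finset κ) {γ γ' : κ → 𝕜 → Loop g}
    (h : ∀ j ∈ t, IsJetCurve (γ j) (γ' j)) :
    IsJetCurve (fun τ => ∑ j ∈ t, γ j τ) (fun τ => ∑ j ∈ t, γ' j τ) := fun φ =>
  (IsJetFamily.sum t fun j hj => h j hj φ).congr (by simp) (by simp)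

theorem IsJetCurve.bilin {γ γ' η η' : 𝕜 → Loop g} (B : g →ₗ[ℂ] g →ₗ[ℂ] ℂ)
    (hγ : IsJetCurve γ γ') (hη : IsJetCurve η η') :
    IsJetFamily (fun τ x => B ((γ τ).1 x) ((η τ).1 x))
      (fun τ x => B ((γ' τ).1 x) ((η τ).1 x) + B ((γ τ).1 x) ((η' τ).1 x)) := by
  refine (IsJetFamily.sum Finset.univ fun i _ =>
    (hγ ((Module.finBasis ℂ g).coord i)).mul (hη (B (Module.finBasis ℂ g i)))).congr ?_ ?_
  · intro τ x
    exact (bilin_expand B _ _).symm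
  · intro τ x
    simp only [Finset.sum_add_distrib]
    rw [bilin_expand B ((γ' τ).1 x), bilin_expand B ((γ τ).1 x)]

theorem IsJetCurve.br {γ γ' η η' : 𝕜 → Loop g} (hγ : IsJetCurve γ γ') (hη : IsJetCurve η η') :
    IsJetCurve (fun τ => br (γ τ) (η τ)) (fun τ => br (γ' τ) (η τ) + br (γ τ) (η' τ)) := fun φ =>
  (hγ.bilin ((LieModule.toEnd ℂ g g : g →ₗ[ℂ] Module.End ℂ g).compr₂ φ) hη).congr
    (fun τ x => by simp) (fun τ x => by simp)

theorem IsJetCurve.dx {γ γ' : 𝕜 → Loop g} (hγ : IsJetCurve γ γ') :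
    IsJetCurve (fun τ => dx (γ τ)) (fun τ => dx (γ' τ)) := fun φ =>
  (hγ φ).deriv.congr (fun _ _ => (form_dx _ _ _).symm) (fun _ _ => (form_dx _ _ _).symm)

theorem IsJetCurve.hasDerivAt_pair {γ γ' η η' : 𝕜 → Loop g} (hγ : IsJetCurve γ γ')
    (hη : IsJetCurve η η') (τ : 𝕜) :
    HasDerivAt (fun τ => pair (γ τ) (η τ)) (pair (γ' τ) (η τ) + pair (γ τ) (η' τ)) τ := by
  have h := (hγ.bilin (killingForm ℂ g) hη).hasDerivAt_integral τ
  rw [intervalIntegral.integral_add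
    (intervalIntegrable_of_mem_circleFun (killing_mem_circleFun _ _))
    (intervalIntegrable_of_mem_circleFun (killing_mem_circleFun _ _))] at h
  exact h

theorem IsJetCurve.of_basis {γ γ' : 𝕜 → Loop g}
    (h : ∀ i, IsJetFamily (fun τ x => (Module.finBasis ℂ g).coord i ((γ τ).1 x))
      (fun τ x => (Module.finBasis ℂ g).coord i ((γ' τ).1 x))) : IsJetCurve γ γ' := by
  intro φ
  have hφ := fun y => (form_expand φ y).symm
  exact (IsJetFamily.sum Finset.univ fun i _ => (h i).const_mul (φ (Module.finBasis ℂ g i))).congr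
    (fun _ _ => hφ _) (fun _ _ => hφ _)

/-- Gradients are tested on lines with complex parameter, while gauge flows and tangent paths have a
real one; this is why jet curves are defined over both fields. -/
theorem isJetCurve_line (q s : Loop g) : IsJetCurve (fun θ : ℂ => q + θ • s) (fun _ => s) := by
  have h := (IsJetCurve.const (𝕜 := ℂ) q).add (IsJetCurve.scalar (c := fun θ : ℂ => θ)
    (c' := fun _ => 1) (fun τ => hasDerivAt_id τ) continuous_const s)
  simpa using h

end Families

/-! ### Differential algebras of functions -/

section DiffAlg

variable {g : Type*} [LieRing g] [LieAlgebra ℂ g] [Module.Finite ℂ g]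
variable {X : Type*} {i : X → Loop g} {𝓐 : Subalgebra ℂ (X → ℝ → ℂ)}

/-- An algebra of functions with smooth values that is closed under `∂_x`. -/
structure IsDiffAlg (𝓐 : Subalgebra ℂ (X → ℝ → ℂ)) : Prop where
  mem_circleFun : ∀ p ∈ 𝓐, ∀ s, p s ∈ circleFun
  deriv_mem : ∀ p ∈ 𝓐, (fun s => deriv (p s)) ∈ 𝓐

theorem isDiffAlg_adjoin {G : Set (X → ℝ → ℂ)} (hG : ∀ p ∈ G, ∀ s, p s ∈ circleFun)
    (hG' : ∀ p ∈ G, (fun s => deriv (p s)) ∈ Algebra.adjoin ℂ G) :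
    IsDiffAlg (Algebra.adjoin ℂ G) := by
  have h1 : ∀ p ∈ Algebra.adjoin ℂ G, ∀ s, p s ∈ circleFun := by
    intro p hp s
    induction hp using Algebra.adjoin_induction with
    | mem p hp => exact hG p hp s
    | algebraMap c => exact const_mem_circleFun c
    | add p r _ _ hp hr => exact add_mem hp hr
    | mul p r _ _ hp hr => exact mul_mem hp hr
  refine ⟨h1, fun p hp => ?_⟩
  induction hp using Algebra.adjoin_induction with
  | mem p hp => exact hG' p hp
  | algebraMap c =>
    have : (fun s : X => deriv ((algebraMap ℂ (X → ℝ → ℂ) c) s)) = 0 := by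
      funext s x
      exact deriv_const x c
    rw [this]
    exact zero_mem _
  | add p r hp' hr' hp hr =>
    have : (fun s => deriv ((p + r) s)) = (fun s => deriv (p s)) + fun s => deriv (r s) := by
      funext s
      exact deriv_add_circleFun (h1 p hp' s) (h1 r hr' s)
    rw [this]
    exact add_mem hp hr
  | mul p r hp' hr' hp hr =>
    have : (fun s => deriv ((p * r) s)) =
        (fun s => deriv (p s)) * r + p * fun s => deriv (r s) := by
      funext s
      exact deriv_mul_circleFun (h1 p hp' s) (h1 r hr' s)
    rw [this]
    exact add_mem (mul_mem hp hr') (mul_mem hp' hr)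

theorem jets_mem_circleFun {p : X → ℝ → ℂ} (hp : p ∈ jets i) (s : X) : p s ∈ circleFun := by
  obtain ⟨φ, k, rfl⟩ := hp
  exact iteratedDeriv_mem_circleFun (form_mem (i s) φ) k

theorem deriv_mem_jets {p : X → ℝ → ℂ} (hp : p ∈ jets i) : (fun s => deriv (p s)) ∈ jets i := by
  obtain ⟨φ, k, rfl⟩ := hp
  exact ⟨φ, k + 1, funext fun s => iteratedDeriv_succ.symm⟩

theorem isDiffAlg_diffPoly (i : X → Loop g) : IsDiffAlg (diffPoly i) :=
  isDiffAlg_adjoin (fun _ hp => jets_mem_circleFun hp)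
    fun _ hp => Algebra.subset_adjoin (deriv_mem_jets hp)

theorem coeff_mem_densities (i : X → Loop g) {c : ℝ → ℂ} (hc : c ∈ circleFun) :
    (fun _ => c) ∈ densities i := Algebra.subset_adjoin (Or.inr ⟨c, hc.1, hc.2, rfl⟩)

theorem isDiffAlg_densities (i : X → Loop g) : IsDiffAlg (densities i) := by
  refine isDiffAlg_adjoin ?_ ?_
  · rintro p (hp | ⟨c, hc, hc', rfl⟩) s
    · exact jets_mem_circleFun hp s
    · exact ⟨hc, hc'⟩
  · rintro p (hp | ⟨c, hc, hc', rfl⟩)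
    · exact Algebra.subset_adjoin (Or.inl (deriv_mem_jets hp))
    · exact coeff_mem_densities i (deriv_mem_circleFun ⟨hc, hc'⟩)

theorem diffPoly_le_densities (i : X → Loop g) : diffPoly i ≤ densities i :=
  Algebra.adjoin_mono Set.subset_union_left

theorem IsDiffAlg.iteratedDeriv_mem (h𝓐 : IsDiffAlg 𝓐) {p : X → ℝ → ℂ} (hp : p ∈ 𝓐) (r : ℕ) :
    (fun s => iteratedDeriv r (p s)) ∈ 𝓐 := by
  induction r generalizing p with
  | zero => simpa using hp
  | succ r ih => simpa only [iteratedDeriv_succ'] using ih (h𝓐.deriv_mem p hp)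

theorem const_mem (c : ℂ) : (fun _ _ => c) ∈ 𝓐 := Subalgebra.algebraMap_mem 𝓐 c

/-- A map to the loop algebra whose coordinates belong to the algebra `𝓐`. -/
def IsDiffMap (𝓐 : Subalgebra ℂ (X → ℝ → ℂ)) (T : X → Loop g) : Prop :=
  ∀ φ : g →ₗ[ℂ] ℂ, (fun s x => φ ((T s).1 x)) ∈ 𝓐

namespace IsDiffMap

variable {T T' : X → Loop g}

theorem self (i : X → Loop g) : IsDiffMap (diffPoly i) i := fun φ =>
  Algebra.subset_adjoin ⟨φ, 0, by simp⟩

theorem mono {𝓑 : Subalgebra ℂ (X → ℝ → ℂ)} (h : 𝓐 ≤ 𝓑) (hT : IsDiffMap 𝓐 T) : IsDiffMap 𝓑 T :=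
  fun φ => h (hT φ)

theorem add (hT : IsDiffMap 𝓐 T) (hT' : IsDiffMap 𝓐 T') : IsDiffMap 𝓐 fun s => T s + T' s :=
  fun φ => by
    simp only [Loop.add_apply, map_add]
    exact add_mem (hT φ) (hT' φ)

theorem sub (hT : IsDiffMap 𝓐 T) (hT' : IsDiffMap 𝓐 T') : IsDiffMap 𝓐 fun s => T s - T' s :=
  fun φ => by
    simp only [Loop.sub_apply, map_sub]
    exact sub_mem (hT φ) (hT' φ)

theorem const_smul (c : ℂ) (hT : IsDiffMap 𝓐 T) : IsDiffMap 𝓐 fun s => c • T s :=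
  fun φ => by
    simp only [Loop.smul_apply, map_smul]
    exact Subalgebra.smul_mem 𝓐 (hT φ) c

theorem const (v : g) : IsDiffMap 𝓐 fun _ => constLoop v := fun φ => const_mem (φ v)

theorem zero : IsDiffMap 𝓐 (fun _ => (0 : Loop g)) := fun φ => by
  simpa using const_mem (𝓐 := 𝓐) 0

theorem sum {κ : Type*} (t : Finset κ) {T : κ → X → Loop g} (h : ∀ j ∈ t, IsDiffMap 𝓐 (T j)) :
    IsDiffMap 𝓐 fun s => ∑ j ∈ t, T j s := fun φ => by
  have := sum_mem (S := 𝓐) (t := t) (f := fun j s x => φ ((T j s).1 x)) fun j hj => h j hj φ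
  convert this using 1
  funext s x
  simp

theorem map (A : g →ₗ[ℂ] g) (hT : IsDiffMap 𝓐 T) : IsDiffMap 𝓐 fun s => Loop.map A (T s) :=
  fun φ => hT (φ ∘ₗ A)

theorem bilin (B : g →ₗ[ℂ] g →ₗ[ℂ] ℂ) (hT : IsDiffMap 𝓐 T) (hT' : IsDiffMap 𝓐 T') :
    (fun s x => B ((T s).1 x) ((T' s).1 x)) ∈ 𝓐 := by
  have := sum_mem (S := 𝓐) (t := Finset.univ) fun j _ =>
    mul_mem (hT ((Module.finBasis ℂ g).coord j)) (hT' (B (Module.finBasis ℂ g j)))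
  convert this using 1
  funext s x
  rw [bilin_expand]
  simp

theorem br (hT : IsDiffMap 𝓐 T) (hT' : IsDiffMap 𝓐 T') : IsDiffMap 𝓐 fun s => br (T s) (T' s) :=
  fun φ => by
    simpa using hT.bilin ((LieModule.toEnd ℂ g g : g →ₗ[ℂ] Module.End ℂ g).compr₂ φ) hT'

theorem dx (h𝓐 : IsDiffAlg 𝓐) (hT : IsDiffMap 𝓐 T) : IsDiffMap 𝓐 fun s => dx (T s) := fun φ => by
  have := h𝓐.deriv_mem _ (hT φ)
  convert this using 1
  funext s x
  exact form_dx _ _ _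

/-- Substitution of a map with coordinates in 𝓐 into a differential polynomial stays in 𝓐, because 𝓐
is closed under ∂_x. -/
theorem comp_diffPoly (h𝓐 : IsDiffAlg 𝓐) (hT : IsDiffMap 𝓐 T) {p : Loop g → ℝ → ℂ}
    (hp : p ∈ diffPoly (id : Loop g → Loop g)) : (fun s => p (T s)) ∈ 𝓐 := by
  induction hp using Algebra.adjoin_induction with
  | mem p hp =>
    obtain ⟨φ, k, rfl⟩ := hp
    exact h𝓐.iteratedDeriv_mem (hT φ) k
  | algebraMap c => exact const_mem c
  | add p r _ _ hp hr => exact add_mem hp hr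
  | mul p r _ _ hp hr => exact mul_mem hp hr

theorem comp_densities (h𝓐 : IsDiffAlg 𝓐) (h𝓐' : ∀ c ∈ circleFun, (fun _ => c) ∈ 𝓐)
    (hT : IsDiffMap 𝓐 T) {p : Loop g → ℝ → ℂ}
    (hp : p ∈ densities (id : Loop g → Loop g)) : (fun s => p (T s)) ∈ 𝓐 := by
  induction hp using Algebra.adjoin_induction with
  | mem p hp =>
    obtain ⟨φ, k, rfl⟩ | ⟨c, hc, hc', rfl⟩ := hp
    · exact h𝓐.iteratedDeriv_mem (hT φ) k
    · exact h𝓐' c ⟨hc, hc'⟩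
  | algebraMap c => exact const_mem c
  | add p r _ _ hp hr => exact add_mem hp hr
  | mul p r _ _ hp hr => exact mul_mem hp hr

end IsDiffMap

/-- Coordinates on X are restrictions of coordinates on the loop algebra. This moves every question
about S, N or Q to functions on L(g). -/
theorem exists_extension_diffPoly {p : X → ℝ → ℂ} (hp : p ∈ diffPoly i) :
    ∃ P ∈ diffPoly (id : Loop g → Loop g), p = fun s => P (i s) := by
  induction hp using Algebra.adjoin_induction with
  | mem p hp =>
    obtain ⟨φ, k, rfl⟩ := hp
    exact ⟨_, Algebra.subset_adjoin ⟨φ, k, rfl⟩, rfl⟩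
  | algebraMap c => exact ⟨_, const_mem c, rfl⟩
  | add p r _ _ hp hr =>
    obtain ⟨P, hP, rfl⟩ := hp
    obtain ⟨R, hR, rfl⟩ := hr
    exact ⟨_, add_mem hP hR, rfl⟩
  | mul p r _ _ hp hr =>
    obtain ⟨P, hP, rfl⟩ := hp
    obtain ⟨R, hR, rfl⟩ := hr
    exact ⟨_, mul_mem hP hR, rfl⟩

theorem exists_extension_densities {p : X → ℝ → ℂ} (hp : p ∈ densities i) :
    ∃ P ∈ densities (id : Loop g → Loop g), p = fun s => P (i s) := by
  induction hp using Algebra.adjoin_induction with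
  | mem p hp =>
    obtain ⟨φ, k, rfl⟩ | ⟨c, hc, hc', rfl⟩ := hp
    · exact ⟨_, Algebra.subset_adjoin (Or.inl ⟨φ, k, rfl⟩), rfl⟩
    · exact ⟨_, coeff_mem_densities id ⟨hc, hc'⟩, rfl⟩
  | algebraMap c => exact ⟨_, const_mem c, rfl⟩
  | add p r _ _ hp hr =>
    obtain ⟨P, hP, rfl⟩ := hp
    obtain ⟨R, hR, rfl⟩ := hr
    exact ⟨_, add_mem hP hR, rfl⟩
  | mul p r _ _ hp hr =>
    obtain ⟨P, hP, rfl⟩ := hp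
    obtain ⟨R, hR, rfl⟩ := hr
    exact ⟨_, mul_mem hP hR, rfl⟩

end DiffAlg

end

end LoopReduction

/-! ### Calculus of variations: linearizations, formal adjoints, gradients. -/

namespace LoopReduction

set_option linter.unusedSectionVars false

noncomputable section

variable {g : Type*} [LieRing g] [LieAlgebra ℂ g] [Module.Finite ℂ g]

/-! ### Linearization of densities -/

section Linearization

variable {X : Type*} {𝓐 : Subalgebra ℂ (X → ℝ → ℂ)}

/-- Linear differential operators from loops to functions, with coefficients in `𝓐`. -/
def linOps (𝓐 : Subalgebra ℂ (X → ℝ → ℂ)) : Submodule ℂ (X → Loop g → ℝ → ℂ) :=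
  Submodule.span ℂ {L | ∃ c ∈ 𝓐, ∃ (φ : g →ₗ[ℂ] ℂ) (r : ℕ),
    L = fun q s x => c q x * iteratedDeriv r (fun y => φ (s.1 y)) x}

theorem linOps_mul {p : X → ℝ → ℂ} (hp : p ∈ 𝓐) {L : X → Loop g → ℝ → ℂ} (hL : L ∈ linOps 𝓐) :
    (fun q s x => p q x * L q s x) ∈ linOps 𝓐 := by
  induction hL using Submodule.span_induction with
  | mem L hL =>
    obtain ⟨c, hc, φ, r, rfl⟩ := hL
    refine Submodule.subset_span ⟨p * c, mul_mem hp hc, φ, r, ?_⟩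
    funext q s x
    simp [mul_assoc]
  | zero =>
    simp only [Pi.zero_apply, mul_zero]
    exact zero_mem (linOps (g := g) 𝓐)
  | add L L' _ _ h h' =>
    convert add_mem h h' using 1
    funext q s x
    simp [mul_add]
  | smul c L _ h =>
    convert Submodule.smul_mem _ c h using 1
    funext q s x
    simp [mul_left_comm]

theorem linOps_circleFun (h𝓐 : IsDiffAlg 𝓐) {L : X → Loop g → ℝ → ℂ} (hL : L ∈ linOps 𝓐) (q : X)
    (s : Loop g) : L q s ∈ circleFun := by
  induction hL using Submodule.span_induction with
  | mem L hL =>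
    obtain ⟨c, hc, φ, r, rfl⟩ := hL
    exact mul_mem (h𝓐.mem_circleFun c hc q) (iteratedDeriv_mem_circleFun (form_mem s φ) r)
  | zero => exact zero_mem _
  | add L L' _ _ h h' => exact add_mem h h'
  | smul c L _ h => exact Subalgebra.smul_mem _ h c

theorem linOps_add {L : X → Loop g → ℝ → ℂ} (hL : L ∈ linOps 𝓐) (q : X)
    (s t : Loop g) (x : ℝ) : L q (s + t) x = L q s x + L q t x := by
  induction hL using Submodule.span_induction with
  | mem L hL =>
    obtain ⟨c, hc, φ, r, rfl⟩ := hL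
    simp only [Loop.add_apply, map_add, iteratedDeriv_add_circleFun (form_mem s φ) (form_mem t φ)]
    ring
  | zero => simp
  | add L L' _ _ h h' =>
    simp only [Pi.add_apply, h, h']
    ring
  | smul c L _ h =>
    simp only [Pi.smul_apply, h, smul_add]

theorem linOps_smul {L : X → Loop g → ℝ → ℂ} (hL : L ∈ linOps 𝓐) (q : X)
    (a : ℂ) (t : Loop g) (x : ℝ) : L q (a • t) x = a * L q t x := by
  induction hL using Submodule.span_induction with
  | mem L hL =>
    obtain ⟨c, hc, φ, r, rfl⟩ := hL
    simp only [Loop.smul_apply, map_smul, smul_eq_mul,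
      iteratedDeriv_const_mul_circleFun a (form_mem t φ)]
    ring
  | zero => simp
  | add L L' _ _ h h' =>
    simp only [Pi.add_apply, h, h']
    ring
  | smul c L _ h =>
    simp only [Pi.smul_apply, h, smul_eq_mul]
    ring

theorem linOps_sum {L : X → Loop g → ℝ → ℂ} (hL : L ∈ linOps 𝓐) (q : X) {κ : Type*}
    (t : Finset κ) (s : κ → Loop g) (x : ℝ) : L q (∑ j ∈ t, s j) x = ∑ j ∈ t, L q (s j) x := by
  classical
  induction t using Finset.induction_on with
  | empty => simpa using linOps_smul hL q 0 0 x
  | insert a t ha ih => rw [Finset.sum_insert ha, Finset.sum_insert ha, linOps_add hL, ih]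

end Linearization

/-- `L` is the derivative of `p` along curves, and `L₂` its second derivative. -/
structure IsLinearization (p : Loop g → ℝ → ℂ) (L : Loop g → Loop g → ℝ → ℂ)
    (L₂ : Loop g → Loop g → Loop g → ℝ → ℂ) : Prop where
  jet : ∀ {𝕜 : Type} [RCLike 𝕜] [NormedAlgebra 𝕜 ℂ] {γ γ' : 𝕜 → Loop g}, IsJetCurve γ γ' →
    IsJetFamily (fun τ => p (γ τ)) (fun τ => L (γ τ) (γ' τ))
  jet₂ : ∀ {𝕜 : Type} [RCLike 𝕜] [NormedAlgebra 𝕜 ℂ] {γ γ' : 𝕜 → Loop g}, IsJetCurve γ γ' →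
    ∀ s, IsJetFamily (fun τ => L (γ τ) s) (fun τ => L₂ (γ τ) s (γ' τ))
  symm : ∀ q s t, L₂ q s t = L₂ q t s

/-- Induction over the algebra by the Leibniz rule. Stating it for a general set of generators
covers `diffPoly` and `densities` at once, with coefficients of L in the same algebra. -/
theorem exists_linearization {G : Set (Loop g → ℝ → ℂ)}
    (hG : ∀ p ∈ G, p ∈ jets (id : Loop g → Loop g) ∨ ∃ c ∈ circleFun, p = fun _ => c)
    {p : Loop g → ℝ → ℂ} (hp : p ∈ Algebra.adjoin ℂ G) :
    ∃ L ∈ linOps (Algebra.adjoin ℂ G), ∃ L₂, IsLinearization p L L₂ := by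
  have hconst : ∀ c ∈ circleFun, IsLinearization (g := g) (fun _ => c) 0 0 := fun c hc =>
    ⟨fun _ => IsJetFamily.const hc, fun _ _ => IsJetFamily.const (zero_mem _), fun _ _ _ => rfl⟩
  induction hp using Algebra.adjoin_induction with
  | mem p hp =>
    rcases hG p hp with ⟨φ, k, rfl⟩ | ⟨c, hc, rfl⟩
    · refine ⟨fun _ s x => iteratedDeriv k (fun y => φ (s.1 y)) x, Submodule.subset_span
        ⟨1, one_mem _, φ, k, by simp⟩, 0, ?_, ?_, fun _ _ _ => rfl⟩
      · intro 𝕜 _ _ γ γ' h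
        exact (h φ).iteratedDeriv k
      · intro 𝕜 _ _ γ γ' h s
        exact IsJetFamily.const (iteratedDeriv_mem_circleFun (form_mem s φ) k)
    · exact ⟨0, zero_mem _, 0, hconst c hc⟩
  | algebraMap c => exact ⟨0, zero_mem _, 0, hconst _ (const_mem_circleFun c)⟩
  | add p r _ _ hp hr =>
    obtain ⟨L, hL, L₂, h⟩ := hp
    obtain ⟨M, hM, M₂, h'⟩ := hr
    exact ⟨L + M, add_mem hL hM, L₂ + M₂, fun hγ => (h.jet hγ).add (h'.jet hγ),
      fun hγ s => (h.jet₂ hγ s).add (h'.jet₂ hγ s), fun q s t => by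
        simp only [Pi.add_apply, h.symm q s t, h'.symm q s t]⟩
  | mul p r hp' hr' hp hr =>
    obtain ⟨L, hL, L₂, h⟩ := hp
    obtain ⟨M, hM, M₂, h'⟩ := hr
    -- The second derivative of a product contains both mixed terms L(s)M(t) and L(t)M(s), which
    -- keeps it symmetric in s and t.
    refine ⟨(fun q s x => r q x * L q s x) + fun q s x => p q x * M q s x,
      add_mem (linOps_mul hr' hL) (linOps_mul hp' hM), fun q s t x =>
        L₂ q s t x * r q x + L q s x * M q t x + (L q t x * M q s x + p q x * M₂ q s t x),
      fun hγ => ?_, fun hγ s => ?_, fun q s t => ?_⟩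
    · exact ((h.jet hγ).mul (h'.jet hγ)).congr (fun τ x => rfl) (fun τ x => by
        simp only [Pi.add_apply]; ring)
    · exact (((h.jet₂ hγ s).mul (h'.jet hγ)).add ((h.jet hγ).mul (h'.jet₂ hγ s))).congr
        (fun τ x => by simp only [Pi.add_apply]; ring) (fun τ x => rfl)
    · funext x
      rw [h.symm q s t, h'.symm q s t]
      ring

theorem exists_linearization_diffPoly {p : Loop g → ℝ → ℂ}
    (hp : p ∈ diffPoly (id : Loop g → Loop g)) :
    ∃ L ∈ linOps (diffPoly (id : Loop g → Loop g)), ∃ L₂, IsLinearization p L L₂ :=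
  exists_linearization (fun _ hp => Or.inl hp) hp

theorem exists_linearization_densities {p : Loop g → ℝ → ℂ}
    (hp : p ∈ densities (id : Loop g → Loop g)) :
    ∃ L ∈ linOps (densities (id : Loop g → Loop g)), ∃ L₂, IsLinearization p L L₂ :=
  exists_linearization (fun _ hp => hp.imp id fun ⟨c, h1, h2, h3⟩ => ⟨c, ⟨h1, h2⟩, h3⟩) hp

/-! ### Scalar differential operators and formal adjoints -/

section Operators

variable {X : Type*} {𝓐 : Subalgebra ℂ (X → ℝ → ℂ)}

/-- Scalar linear differential operators with coefficients in `𝓐`. -/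
def scalarOps (𝓐 : Subalgebra ℂ (X → ℝ → ℂ)) : Submodule ℂ (X → circleFun → ℝ → ℂ) :=
  Submodule.span ℂ {O | ∃ c ∈ 𝓐, ∃ r : ℕ, O = fun q u x => c q x * iteratedDeriv r u.1 x}

theorem scalarOps_mul {p : X → ℝ → ℂ} (hp : p ∈ 𝓐) {O : X → circleFun → ℝ → ℂ}
    (hO : O ∈ scalarOps 𝓐) : (fun q u x => p q x * O q u x) ∈ scalarOps 𝓐 := by
  induction hO using Submodule.span_induction with
  | mem L hL =>
    obtain ⟨c, hc, r, rfl⟩ := hL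
    refine Submodule.subset_span ⟨p * c, mul_mem hp hc, r, ?_⟩
    funext q s x
    simp [mul_assoc]
  | zero =>
    simp only [Pi.zero_apply, mul_zero]
    exact zero_mem (scalarOps 𝓐)
  | add L L' _ _ h h' =>
    convert add_mem h h' using 1
    funext q s x
    simp [mul_add]
  | smul c L _ h =>
    convert Submodule.smul_mem _ c h using 1
    funext q s x
    simp [mul_left_comm]

theorem id_mem_scalarOps : (fun (_ : X) (u : circleFun) x => u.1 x) ∈ scalarOps 𝓐 :=
  Submodule.subset_span ⟨1, one_mem _, 0, by simp⟩

theorem scalarOps_circleFun (h𝓐 : IsDiffAlg 𝓐) {O : X → circleFun → ℝ → ℂ}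
    (hO : O ∈ scalarOps 𝓐) (q : X) (u : circleFun) : O q u ∈ circleFun := by
  induction hO using Submodule.span_induction with
  | mem L hL =>
    obtain ⟨c, hc, r, rfl⟩ := hL
    exact mul_mem (h𝓐.mem_circleFun c hc q) (iteratedDeriv_mem_circleFun u.2 r)
  | zero => exact zero_mem _
  | add L L' _ _ h h' => exact add_mem h h'
  | smul c L _ h => exact Subalgebra.smul_mem _ h c

theorem scalarOps_deriv (h𝓐 : IsDiffAlg 𝓐) {O : X → circleFun → ℝ → ℂ}
    (hO : O ∈ scalarOps 𝓐) : (fun q u => deriv (O q u)) ∈ scalarOps 𝓐 := by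
  induction hO using Submodule.span_induction with
  | mem L hL =>
    obtain ⟨c, hc, r, rfl⟩ := hL
    have : (fun (q : X) (u : circleFun) => deriv fun x => c q x * iteratedDeriv r u.1 x) =
        (fun q u x => deriv (c q) x * iteratedDeriv r u.1 x) +
          fun q u x => c q x * iteratedDeriv (r + 1) u.1 x := by
      funext q u
      rw [deriv_mul_circleFun (h𝓐.mem_circleFun c hc q) (iteratedDeriv_mem_circleFun u.2 r)]
      simp only [← iteratedDeriv_succ]
      rfl
    rw [this]
    exact add_mem (Submodule.subset_span ⟨_, h𝓐.deriv_mem c hc, r, rfl⟩)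
      (Submodule.subset_span ⟨c, hc, r + 1, rfl⟩)
  | zero =>
    convert zero_mem (scalarOps 𝓐) using 1
    funext q u x
    exact deriv_const x (0 : ℂ)
  | add L L' hL hL' h h' =>
    convert add_mem h h' using 1
    funext q u
    exact deriv_add_circleFun (scalarOps_circleFun h𝓐 hL q u) (scalarOps_circleFun h𝓐 hL' q u)
  | smul c L hL h =>
    convert Submodule.smul_mem _ c h using 1
    funext q u
    exact deriv_const_mul_circleFun c (scalarOps_circleFun h𝓐 hL q u)

theorem scalarOps_iteratedDeriv (h𝓐 : IsDiffAlg 𝓐) {O : X → circleFun → ℝ → ℂ}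
    (hO : O ∈ scalarOps 𝓐) (r : ℕ) : (fun q u => iteratedDeriv r (O q u)) ∈ scalarOps 𝓐 := by
  induction r generalizing O with
  | zero => simpa using hO
  | succ r ih => simpa only [iteratedDeriv_succ'] using ih (scalarOps_deriv h𝓐 hO)

/-- On the constant 1 only the coefficient of order zero survives. It makes the gradient, the formal
adjoint evaluated at 1, a differential polynomial. -/
theorem scalarOps_one {O : X → circleFun → ℝ → ℂ} (hO : O ∈ scalarOps 𝓐) :
    (fun q => O q 1) ∈ 𝓐 := by
  induction hO using Submodule.span_induction with
  | mem L hL =>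
    obtain ⟨c, hc, r, rfl⟩ := hL
    cases r with
    | zero => simpa using hc
    | succ r =>
      have h1 : deriv (1 : ℝ → ℂ) = fun _ => 0 := funext fun x => deriv_const x 1
      have : (fun (q : X) x => c q x * iteratedDeriv (r + 1) (1 : circleFun).1 x) = 0 := by
        funext q x
        rw [iteratedDeriv_succ', OneMemClass.coe_one, h1, iteratedDeriv_zero_fun']
        simp
      rw [this]
      exact zero_mem _
  | zero => exact zero_mem _
  | add L L' _ _ h h' => exact add_mem h h'
  | smul c L _ h => exact Subalgebra.smul_mem _ h c

theorem scalarOps_eq_sum {O : X → circleFun → ℝ → ℂ} (hO : O ∈ scalarOps 𝓐) :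
    ∃ A : ℕ →₀ 𝓐, ∀ q u x, O q u x = A.sum fun r c => c.1 q x * iteratedDeriv r u.1 x := by
  induction hO using Submodule.span_induction with
  | mem L hL =>
    obtain ⟨c, hc, r, rfl⟩ := hL
    refine ⟨Finsupp.single r ⟨c, hc⟩, fun q u x => ?_⟩
    rw [Finsupp.sum_single_index (by simp)]
  | zero => exact ⟨0, fun q u x => by simp⟩
  | add L L' _ _ h h' =>
    obtain ⟨A, hA⟩ := h
    obtain ⟨B, hB⟩ := h'
    refine ⟨A + B, fun q u x => ?_⟩
    rw [Finsupp.sum_add_index' (by simp) (by intros; simp [add_mul]), ← hA, ← hB]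
    rfl
  | smul c L _ h =>
    obtain ⟨A, hA⟩ := h
    refine ⟨c • A, fun q u x => ?_⟩
    rw [Finsupp.sum_smul_index' (by simp), Pi.smul_apply, Pi.smul_apply, Pi.smul_apply, hA,
      smul_eq_mul, Finsupp.mul_sum]
    simp [mul_assoc]

/-- A differential operator from functions to loops, with coefficients in `𝓐`. -/
def IsVecOp (𝓐 : Subalgebra ℂ (X → ℝ → ℂ)) (K : X → circleFun → Loop g) : Prop :=
  ∀ φ : g →ₗ[ℂ] ℂ, (fun q u x => φ ((K q u).1 x)) ∈ scalarOps 𝓐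

namespace IsVecOp

variable {K K' : X → circleFun → Loop g}

theorem add (hK : IsVecOp 𝓐 K) (hK' : IsVecOp 𝓐 K') : IsVecOp 𝓐 fun q u => K q u + K' q u :=
  fun φ => by
    simp only [Loop.add_apply, map_add]
    exact add_mem (hK φ) (hK' φ)

theorem const_smul (c : ℂ) (hK : IsVecOp 𝓐 K) : IsVecOp 𝓐 fun q u => c • K q u :=
  fun φ => by
    simp only [Loop.smul_apply, map_smul]
    exact Submodule.smul_mem _ c (hK φ)

theorem dx (h𝓐 : IsDiffAlg 𝓐) (hK : IsVecOp 𝓐 K) : IsVecOp 𝓐 fun q u => dx (K q u) := fun φ => by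
  convert scalarOps_deriv h𝓐 (hK φ) using 1
  funext q u x
  exact form_dx _ _ _

theorem br {T : X → Loop g} (hT : IsDiffMap 𝓐 T) (hK : IsVecOp 𝓐 K) :
    IsVecOp 𝓐 fun q u => br (T q) (K q u) := fun φ => by
  have := sum_mem (S := scalarOps 𝓐) (t := Finset.univ) fun j _ =>
    scalarOps_mul (hT ((Module.finBasis ℂ g).coord j))
      (hK (((LieModule.toEnd ℂ g g : g →ₗ[ℂ] Module.End ℂ g).compr₂ φ) (Module.finBasis ℂ g j)))
  convert this using 1
  funext q u x
  have := bilin_expand ((LieModule.toEnd ℂ g g : g →ₗ[ℂ] Module.End ℂ g).compr₂ φ) ((T q).1 x)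
    ((K q u).1 x)
  simpa using this

theorem isDiffMap (hK : IsVecOp 𝓐 K) : IsDiffMap 𝓐 fun q => K q 1 := fun φ => scalarOps_one (hK φ)

theorem comp_linOps (h𝓐 : IsDiffAlg 𝓐) (hK : IsVecOp 𝓐 K) {L : X → Loop g → ℝ → ℂ}
    (hL : L ∈ linOps 𝓐) : (fun q u => L q (K q u)) ∈ scalarOps 𝓐 := by
  induction hL using Submodule.span_induction with
  | mem L hL =>
    obtain ⟨c, hc, φ, r, rfl⟩ := hL
    exact scalarOps_mul hc (scalarOps_iteratedDeriv h𝓐 (hK φ) r)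
  | zero => exact zero_mem _
  | add L L' _ _ h h' => exact add_mem h h'
  | smul c L _ h => exact Submodule.smul_mem _ c h

end IsVecOp

variable [LieAlgebra.IsKilling ℂ g]

theorem exists_killing_eq (φ : g →ₗ[ℂ] ℂ) : ∃ y, ∀ z, killingForm ℂ g y z = φ z := by
  have hnd := LieAlgebra.IsKilling.killingForm_nondegenerate ℂ g
  refine ⟨(LinearMap.BilinForm.toDual _ hnd).symm φ, fun z => ?_⟩
  exact LinearMap.congr_fun ((LinearMap.BilinForm.toDual _ hnd).apply_symm_apply φ) z

/-- Integration by parts moves ∂_x^r onto the coefficient, and φ is represented by a vector through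
the Killing form. The weight u = 1 yields gradients; a general u is needed for the adjoint of dΦ. -/
theorem exists_adjoint (h𝓐 : IsDiffAlg 𝓐) {L : X → Loop g → ℝ → ℂ} (hL : L ∈ linOps 𝓐) :
    ∃ K : X → circleFun → Loop g, IsVecOp 𝓐 K ∧ ∀ q (u : circleFun) s,
      ∫ x in (0 : ℝ)..1, u.1 x * L q s x = pair (K q u) s := by
  induction hL using Submodule.span_induction with
  | mem L hL =>
    obtain ⟨c, hc, φ, r, rfl⟩ := hL
    obtain ⟨y, hy⟩ := exists_killing_eq φ
    have hmem : (fun (q : X) (u : circleFun) =>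
        fun x => (-1) ^ r * iteratedDeriv r (fun x => c q x * u.1 x) x) ∈ scalarOps 𝓐 :=
      Submodule.smul_mem _ ((-1) ^ r)
        (scalarOps_iteratedDeriv h𝓐 (scalarOps_mul hc id_mem_scalarOps) r)
    refine ⟨fun q u => tensorLoop ⟨_, scalarOps_circleFun h𝓐 hmem q u⟩ y, fun ψ => ?_,
      fun q u s => ?_⟩
    · convert Submodule.smul_mem _ (ψ y) hmem using 1
      funext q u x
      simp [mul_comm]
    · have h1 : (fun x => u.1 x * (c q x * iteratedDeriv r (fun y => φ (s.1 y)) x)) =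
          fun x => (c q x * u.1 x) * iteratedDeriv r (fun y => φ (s.1 y)) x := by
        funext x; ring
      rw [h1]
      have h2 := integral_mul_iteratedDeriv_circleFun
        (mul_mem (h𝓐.mem_circleFun c hc q) u.2) (form_mem s φ) r
      simp only [Pi.mul_apply] at h2
      rw [h2]
      unfold pair
      congr 1
      funext x
      simp only [tensorLoop_apply, map_smul, LinearMap.smul_apply, hy, smul_eq_mul]
      rfl
  | zero => exact ⟨fun _ _ => 0, fun φ => by
      simp only [Loop.zero_apply, map_zero]
      exact zero_mem (scalarOps 𝓐), by simp⟩
  | add L L' hL hL' h h' =>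
    obtain ⟨K, hK, hK'⟩ := h
    obtain ⟨M, hM, hM'⟩ := h'
    refine ⟨_, hK.add hM, fun q u s => ?_⟩
    rw [pair_add_left, ← hK', ← hM', ← intervalIntegral.integral_add]
    · simp [mul_add]
    · exact intervalIntegrable_of_mem_circleFun (mul_mem u.2 (linOps_circleFun h𝓐 hL q s))
    · exact intervalIntegrable_of_mem_circleFun (mul_mem u.2 (linOps_circleFun h𝓐 hL' q s))
  | smul c L hL h =>
    obtain ⟨K, hK, hK'⟩ := h
    refine ⟨_, hK.const_smul c, fun q u s => ?_⟩
    rw [pair_smul_left, ← hK', ← intervalIntegral.integral_const_mul]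
    simp [mul_left_comm]

end Operators

/-! ### Gradients -/

section Gradients

variable [LieAlgebra.IsKilling ℂ g]

/-- The data of a local functional: its gradient field, the chain rule, and the symmetric second
derivative. -/
theorem exists_gradient {𝓐 : Subalgebra ℂ (Loop g → ℝ → ℂ)} (h𝓐 : IsDiffAlg 𝓐)
    {p : Loop g → ℝ → ℂ} {L : Loop g → Loop g → ℝ → ℂ} {L₂ : Loop g → Loop g → Loop g → ℝ → ℂ}
    (hL : L ∈ linOps 𝓐) (h : IsLinearization p L L₂) :
    ∃ E : Loop g → Loop g, IsDiffMap 𝓐 E ∧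
      (∀ {𝕜 : Type} [RCLike 𝕜] [NormedAlgebra 𝕜 ℂ] {γ γ' : 𝕜 → Loop g}, IsJetCurve γ γ' →
        ∀ τ, HasDerivAt (fun τ => functionalOf p (γ τ)) (pair (E (γ τ)) (γ' τ)) τ) ∧
      ∀ q s t, HasDerivAt (fun θ : ℂ => pair (E (q + θ • t)) s)
        (∫ x in (0 : ℝ)..1, L₂ q s t x) 0 := by
  obtain ⟨K, hK, hK'⟩ := exists_adjoint h𝓐 hL
  have hE : ∀ q s, pair (K q 1) s = ∫ x in (0 : ℝ)..1, L q s x := fun q s => by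
    rw [← hK']; simp
  -- The gradient is the Euler operator: the formal adjoint of the linearization applied to 1.
  refine ⟨fun q => K q 1, hK.isDiffMap, fun hγ τ => ?_, fun q s t => ?_⟩
  · rw [hE]
    exact (h.jet hγ).hasDerivAt_integral τ
  · simp only [hE]
    have := (h.jet₂ (isJetCurve_line q t) s).hasDerivAt_integral 0
    simpa using this

theorem hasGrad_unique {F : Loop g → ℂ} {q v w : Loop g} (hv : HasGrad id F q v)
    (hw : HasGrad id F q w) : v = w :=
  eq_of_pair fun s => (hv s (fun θ => q + θ • s) fun _ => rfl).unique
    (hw s (fun θ => q + θ • s) fun _ => rfl)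

theorem grad_eq {F : Loop g → ℂ} {q v : Loop g} (hv : HasGrad id F q v) : grad id F q = v := by
  have h : ∃ v, HasGrad id F q v := ⟨v, hv⟩
  unfold grad
  rw [dif_pos h]
  exact hasGrad_unique h.choose_spec hv

theorem hasGrad_grad {X : Type*} {i : X → Loop g} {F : X → ℂ} {q : X}
    (h : ∃ v, HasGrad i F q v) : HasGrad i F q (grad i F q) := by
  unfold grad
  rw [dif_pos h]
  exact h.choose_spec

theorem hasGrad_of_chain {F : Loop g → ℂ} {E : Loop g → Loop g}
    (h : ∀ {γ γ' : ℂ → Loop g}, IsJetCurve γ γ' →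
      ∀ τ, HasDerivAt (fun τ => F (γ τ)) (pair (E (γ τ)) (γ' τ)) τ) (q : Loop g) :
    HasGrad id F q (E q) := by
  intro s c hc
  have h1 : c = fun θ => q + θ • s := funext hc
  have := h (isJetCurve_line q s) 0
  rw [h1]
  simpa using this

/-- The gradient of a functional with density in `𝓐`. -/
structure IsRegular (𝓐 : Subalgebra ℂ (Loop g → ℝ → ℂ)) (F : Loop g → ℂ) : Prop where
  hasGrad : ∀ q, HasGrad id F q (grad id F q)
  isDiffMap : IsDiffMap 𝓐 (grad id F)
  chain : ∀ {𝕜 : Type} [RCLike 𝕜] [NormedAlgebra 𝕜 ℂ] {γ γ' : 𝕜 → Loop g}, IsJetCurve γ γ' →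
    ∀ τ, HasDerivAt (fun τ => F (γ τ)) (pair (grad id F (γ τ)) (γ' τ)) τ
  hessian : ∃ B : Loop g → Loop g → Loop g → ℂ, (∀ q s t, B q s t = B q t s) ∧
    ∀ q s t, HasDerivAt (fun θ : ℂ => pair (grad id F (q + θ • t)) s) (B q s t) 0

theorem isRegular_of_linearization {𝓐 : Subalgebra ℂ (Loop g → ℝ → ℂ)} (h𝓐 : IsDiffAlg 𝓐)
    {p : Loop g → ℝ → ℂ} {L : Loop g → Loop g → ℝ → ℂ} {L₂ : Loop g → Loop g → Loop g → ℝ → ℂ}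
    (hL : L ∈ linOps 𝓐) (h : IsLinearization p L L₂) : IsRegular 𝓐 (functionalOf p) := by
  obtain ⟨E, hE, hchain, hhess⟩ := exists_gradient h𝓐 hL h
  have hE' : grad id (functionalOf p) = E :=
    funext fun q => grad_eq (hasGrad_of_chain (fun hγ => hchain hγ) q)
  refine ⟨fun q => ?_, hE'.symm ▸ hE, fun hγ τ => ?_, fun q s t => ∫ x in (0 : ℝ)..1, L₂ q s t x,
    fun q s t => by simp only [h.symm q s t], fun q s t => ?_⟩
  · rw [hE']; exact hasGrad_of_chain (fun hγ => hchain hγ) q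
  · rw [hE']; exact hchain hγ τ
  · rw [hE']; exact hhess q s t

theorem isRegular_of_isLocal {F : Loop g → ℂ} (hF : IsLocal id F) :
    IsRegular (densities id) F := by
  obtain ⟨p, hp, rfl⟩ := hF
  obtain ⟨L, hL, L₂, h⟩ := exists_linearization_densities hp
  exact isRegular_of_linearization (isDiffAlg_densities id) hL h

theorem isRegular_of_diffPoly {p : Loop g → ℝ → ℂ} (hp : p ∈ diffPoly (id : Loop g → Loop g)) :
    IsRegular (diffPoly id) (functionalOf p) := by
  obtain ⟨L, hL, L₂, h⟩ := exists_linearization_diffPoly hp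
  exact isRegular_of_linearization (isDiffAlg_diffPoly id) hL h

/-- The derivative of a map with coordinates in the algebra of densities. -/
theorem exists_derivative {T : Loop g → Loop g} (hT : IsDiffMap (densities id) T) :
    ∃ DT : Loop g → Loop g → Loop g, ∀ {𝕜 : Type} [RCLike 𝕜] [NormedAlgebra 𝕜 ℂ]
      {γ γ' : 𝕜 → Loop g}, IsJetCurve γ γ' →
        IsJetCurve (fun τ => T (γ τ)) (fun τ => DT (γ τ) (γ' τ)) := by
  choose L hL L₂ h using fun j => exists_linearization_densities
    (hT ((Module.finBasis ℂ g).coord j))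
  refine ⟨fun q s => ∑ j, tensorLoop ⟨_, linOps_circleFun (isDiffAlg_densities id) (hL j) q s⟩
    (Module.finBasis ℂ g j), fun hγ => IsJetCurve.of_basis fun j => ((h j).jet hγ).congr
      (fun τ x => rfl) fun τ x => ?_⟩
  simp [Finsupp.single_apply]

end Gradients

end

end LoopReduction

/-! ### The pencil of brackets and the Casimirs of P₁ on the loop algebra. -/

namespace LoopReduction

set_option linter.unusedSectionVars false

noncomputable section

variable {g : Type*} [LieRing g] [LieAlgebra ℂ g] [Module.Finite ℂ g]

/-! ### Poisson brackets of local functionals on the loop algebra -/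

theorem IsJetCurve.const_smul {𝕜 : Type} [RCLike 𝕜] [NormedAlgebra 𝕜 ℂ] {γ γ' : 𝕜 → Loop g}
    (c : ℂ) (hγ : IsJetCurve γ γ') : IsJetCurve (fun τ => c • γ τ) (fun τ => c • γ' τ) :=
  fun φ => ((hγ φ).const_mul c).congr (by simp) (by simp)

theorem IsJetCurve.velocity_mem {𝕜 : Type} [RCLike 𝕜] [NormedAlgebra 𝕜 ℂ] {γ γ' : 𝕜 → Loop g}
    (hγ : IsJetCurve γ γ') {W : Submodule ℂ g} (hW : ∀ τ, γ τ ∈ loopsIn W) (τ : 𝕜) :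
    γ' τ ∈ loopsIn W := by
  intro x
  refine mem_of_forall_form fun φ hφ => ?_
  have h1 := (hγ φ).hasDerivAt 0 τ x
  simp only [iteratedDeriv_zero] at h1
  have h2 : (fun τ => φ ((γ τ).1 x)) = fun _ => 0 := funext fun τ => hφ _ (hW τ x)
  rw [h2] at h1
  exact h1.unique (hasDerivAt_const τ 0)

theorem IsDiffMap.coeff {X : Type*} {i : X → Loop g} (m : Loop g) :
    IsDiffMap (densities i) fun _ => m := fun φ => coeff_mem_densities i (form_mem m φ)

theorem isLocal_pair (c : ℂ) (m : Loop g) : IsLocal id fun q => c * pair q m := by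
  refine ⟨fun q x => c * killingForm ℂ g (q.1 x) (m.1 x), ?_, ?_⟩
  · have h1 : IsDiffMap (densities (id : Loop g → Loop g)) id :=
      (IsDiffMap.self id).mono (diffPoly_le_densities id)
    exact Subalgebra.smul_mem _ (h1.bilin (killingForm ℂ g) (IsDiffMap.coeff m)) c
  · funext q
    unfold functionalOf pair
    rw [intervalIntegral.integral_const_mul]

theorem hasGrad_pair (c : ℂ) (m q : Loop g) : HasGrad id (fun q => c * pair q m) q (c • m) := by
  intro s γ hγ
  have h1 : (fun θ => c * pair (γ θ) m) = fun θ => c * pair q m + θ * (c * pair s m) := by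
    funext θ
    have := hγ θ
    simp only [id] at this
    rw [this, pair_add_left, pair_smul_left]
    ring
  rw [h1, pair_smul_left, pair_comm m s]
  simpa using ((hasDerivAt_id (0 : ℂ)).mul_const (c * pair s m)).const_add (c * pair q m)

section Pencil

variable {ε : ℂ} (hε : ε ≠ 0) (a : g) (lam : ℂ)
include hε

theorem IsDiffMap.pencil {X : Type*} {𝓐 : Subalgebra ℂ (X → ℝ → ℂ)} (h𝓐 : IsDiffAlg 𝓐)
    {T E : X → Loop g} (hT : IsDiffMap 𝓐 T) (hE : IsDiffMap 𝓐 E) :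
    IsDiffMap 𝓐 fun q => pencil ε a lam (T q) (E q) := by
  simp only [pencil_apply hε]
  exact (hE.dx h𝓐).add (((hT.add ((IsDiffMap.const a).const_smul lam)).br hE).const_smul _)

theorem isJetCurve_pencil {𝕜 : Type} [RCLike 𝕜] [NormedAlgebra 𝕜 ℂ] {γ γ' η η' : 𝕜 → Loop g}
    (hγ : IsJetCurve γ γ') (hη : IsJetCurve η η') :
    IsJetCurve (fun τ => pencil ε a lam (γ τ) (η τ))
      (fun τ => pencil ε a lam (γ τ) (η' τ) + ε⁻¹ • br (γ' τ) (η τ)) := by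
  have h := hη.dx.add (((hγ.add (IsJetCurve.const (lam • constLoop a))).br hη).const_smul ε⁻¹)
  have e1 : (fun τ => dx (η τ) + ε⁻¹ • br (γ τ + lam • constLoop a) (η τ)) =
      fun τ => pencil ε a lam (γ τ) (η τ) :=
    funext fun τ => (pencil_apply hε a lam _ _).symm
  have e2 : (fun τ => dx (η' τ) + ε⁻¹ • (br (γ' τ + 0) (η τ) +
      br (γ τ + lam • constLoop a) (η' τ))) =
      fun τ => pencil ε a lam (γ τ) (η' τ) + ε⁻¹ • br (γ' τ) (η τ) := by
    funext τ
    rw [pencil_apply hε, add_zero, smul_add]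
    abel
  rw [e1, e2] at h
  exact h

theorem bracket_mem {𝓐 : Subalgebra ℂ (Loop g → ℝ → ℂ)} (h𝓐 : IsDiffAlg 𝓐)
    (hid : IsDiffMap 𝓐 id) {F G : Loop g → ℂ} (hF : IsDiffMap 𝓐 (grad id F))
    (hG : IsDiffMap 𝓐 (grad id G)) :
    ∃ p ∈ 𝓐, bracket (pencil ε a lam) F G = functionalOf p :=
  ⟨_, hF.bilin (killingForm ℂ g) (IsDiffMap.pencil hε a lam h𝓐 hid hG), rfl⟩

variable [LieAlgebra.IsKilling ℂ g]

theorem isLocal_bracket {F G : Loop g → ℂ} (hF : IsLocal id F) (hG : IsLocal id G) :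
    IsLocal id (bracket (pencil ε a lam) F G) :=
  bracket_mem hε a lam (isDiffAlg_densities id)
    ((IsDiffMap.self id).mono (diffPoly_le_densities id))
    (isRegular_of_isLocal hF).isDiffMap (isRegular_of_isLocal hG).isDiffMap

omit hε in
-- The derivative of the gradient field is a symmetric operator, since (D(q, t)|s) is the second
-- derivative of the density in the directions s and t.
theorem exists_hessian {F : Loop g → ℂ} (hF : IsLocal id F) :
    ∃ D : Loop g → Loop g → Loop g, (∀ {𝕜 : Type} [RCLike 𝕜] [NormedAlgebra 𝕜 ℂ]
      {γ γ' : 𝕜 → Loop g}, IsJetCurve γ γ' →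
        IsJetCurve (fun τ => grad id F (γ τ)) (fun τ => D (γ τ) (γ' τ))) ∧
      ∀ q s t, pair (D q s) t = pair (D q t) s := by
  have hreg := isRegular_of_isLocal hF
  obtain ⟨D, hD⟩ := exists_derivative hreg.isDiffMap
  obtain ⟨B, hB, hB'⟩ := hreg.hessian
  have key : ∀ q s t, pair (D q t) s = B q s t := by
    intro q s t
    have h1 := (hD (isJetCurve_line q t)).hasDerivAt_pair (IsJetCurve.const s) 0
    simp only [zero_smul, add_zero, pair_zero_right] at h1
    exact h1.unique (hB' q s t)
  exact ⟨D, hD, fun q s t => by rw [key, key, hB]⟩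

/-- The pairing (δF|P δG) is differentiated along a line. Symmetry of the Hessians and skewness of
P_λ free the direction s; the last term comes from the linear dependence of P_λ(q) on q. -/
theorem grad_bracket {F G : Loop g → ℂ} (hF : IsLocal id F) (hG : IsLocal id G)
    {D D' : Loop g → Loop g → Loop g}
    (hD : ∀ {γ γ' : ℂ → Loop g}, IsJetCurve γ γ' →
        IsJetCurve (fun τ => grad id F (γ τ)) (fun τ => D (γ τ) (γ' τ)))
    (hDs : ∀ q s t, pair (D q s) t = pair (D q t) s)
    (hD' : ∀ {γ γ' : ℂ → Loop g}, IsJetCurve γ γ' →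
        IsJetCurve (fun τ => grad id G (γ τ)) (fun τ => D' (γ τ) (γ' τ)))
    (hDs' : ∀ q s t, pair (D' q s) t = pair (D' q t) s) (q : Loop g) :
    grad id (bracket (pencil ε a lam) F G) q = D q (pencil ε a lam q (grad id G q)) -
      D' q (pencil ε a lam q (grad id F q)) + ε⁻¹ • br (grad id G q) (grad id F q) := by
  refine eq_of_pair fun s => ?_
  have hl := isJetCurve_line q s
  have h1 := (isRegular_of_isLocal (isLocal_bracket hε a lam hF hG)).chain hl 0
  have h2 := (hD hl).hasDerivAt_pair (isJetCurve_pencil hε a lam hl (hD' hl)) 0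
  simp only [zero_smul, add_zero] at h1 h2
  have h3 := h1.unique h2
  rw [h3, pair_add_left, pair_sub_left, pair_smul_left, pair_add_right, pair_smul_right,
    hDs q s, hDs' q _ s]
  have h4 := pair_pencil hε a lam q (grad id F q) (D' q s)
  have h5 : pair (grad id F q) (br s (grad id G q)) =
      pair (br (grad id G q) (grad id F q)) s := by
    rw [← pair_br, br_skew, pair_neg_left, pair_br, br_skew, pair_neg_right, neg_neg, pair_comm]
  rw [h5, pair_comm (D' q s), h4]
  ring

/-- The Jacobi identity for the pencil of brackets. -/
theorem jacobi_bracket {F G K : Loop g → ℂ} (hF : IsLocal id F) (hG : IsLocal id G)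
    (hK : IsLocal id K) (q : Loop g) :
    bracket (pencil ε a lam) F (bracket (pencil ε a lam) G K) q +
      bracket (pencil ε a lam) G (bracket (pencil ε a lam) K F) q +
      bracket (pencil ε a lam) K (bracket (pencil ε a lam) F G) q = 0 := by
  obtain ⟨A, hA, hA'⟩ := exists_hessian hF
  obtain ⟨B, hB, hB'⟩ := exists_hessian hG
  obtain ⟨C, hC, hC'⟩ := exists_hessian hK
  have key : ∀ F G : Loop g → ℂ, bracket (pencil ε a lam) F G q =
      -pair (pencil ε a lam q (grad id F q)) (grad id G q) := by
    intro F G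
    rw [pair_pencil hε, neg_neg]; rfl
  rw [key, key, key, grad_bracket hε a lam hG hK hB hB' hC hC',
    grad_bracket hε a lam hK hF hC hC' hA hA', grad_bracket hε a lam hF hG hA hA' hB hB']
  simp only [pair_add_right, pair_sub_right, pair_smul_right]
  have h := pair_pencil_cyclic hε a lam q (grad id F q) (grad id G q) (grad id K q)
  rw [br_skew (grad id K q) (grad id G q), br_skew (grad id F q) (grad id K q),
    br_skew (grad id G q) (grad id F q)]
  simp only [pair_neg_right]
  set u := pencil ε a lam q (grad id F q)
  set v := pencil ε a lam q (grad id G q)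
  set w := pencil ε a lam q (grad id K q)
  -- The Hessian terms cancel in pairs by symmetry, and what remains is the cocycle identity.
  have s1 : pair u (B q w) = pair w (B q u) := by rw [pair_comm, hB' q w u, pair_comm]
  have s2 : pair u (C q v) = pair v (C q u) := by rw [pair_comm, hC' q v u, pair_comm]
  have s3 : pair v (A q w) = pair w (A q v) := by rw [pair_comm, hA' q w v, pair_comm]
  rw [s1, s2, s3]
  linear_combination ε⁻¹ * h

omit hε in
theorem mem_orthogonal_of_pair {n : Submodule ℂ g} {v : Loop g}
    (h : ∀ m ∈ loopsIn n, pair v m = 0) : v ∈ loopsIn ((killingForm ℂ g).orthogonal n) := by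
  intro x
  rw [LinearMap.BilinForm.mem_orthogonal_iff]
  intro y hy
  change killingForm ℂ g y (v.1 x) = 0
  rw [LieModule.traceForm_comm]
  exact killing_eq_zero_of_pair h x hy

omit hε in
theorem pair_eq_zero_of_mem_orthogonal {n : Submodule ℂ g} {v m : Loop g}
    (hv : v ∈ loopsIn ((killingForm ℂ g).orthogonal n)) (hm : m ∈ loopsIn n) : pair v m = 0 := by
  refine pair_eq_zero_of_killing fun x => ?_
  rw [LieModule.traceForm_comm]
  exact LinearMap.BilinForm.mem_orthogonal_iff.1 (hv x) _ (hm x)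

/-- If the gradients of `F` and `G` annihilate the distribution `P₂(L(n))` along `e + L(n^⊥)`, so
does the gradient of their bracket. -/
theorem grad_bracket_annihilates {n : Submodule ℂ g} (ha : ∀ x ∈ n, ⁅a, x⁆ = 0) (e : g)
    {F G : Loop g → ℂ} (hF : IsLocal id F) (hG : IsLocal id G)
    (hFn : ∀ s ∈ affineLoops e ((killingForm ℂ g).orthogonal n), ∀ m ∈ loopsIn n,
      pair (grad id F s) (P₂ ε s m) = 0)
    (hGn : ∀ s ∈ affineLoops e ((killingForm ℂ g).orthogonal n), ∀ m ∈ loopsIn n,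
      pair (grad id G s) (P₂ ε s m) = 0)
    {s : Loop g} (hs : s ∈ affineLoops e ((killingForm ℂ g).orthogonal n)) {m : Loop g}
    (hm : m ∈ loopsIn n) :
    pair (grad id (bracket (pencil ε a lam) F G) s) (P₂ ε s m) = 0 := by
  obtain ⟨A, hA, hA'⟩ := exists_hessian hF
  obtain ⟨B, hB, hB'⟩ := exists_hessian hG
  have hP : ∀ q, ∀ m ∈ loopsIn n, P₂ ε q m = pencil ε a lam q m := fun q m hm =>
    (pencil_eq_P₂ a lam q fun x => ha _ (hm x)).symm
  -- Annihilating P(L(n)) is, by skewness, the same as having a Hamiltonian vector field with values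
  -- in L(n)^⊥ = L(b), tangent to S.
  have htan : ∀ G : Loop g → ℂ, (∀ s ∈ affineLoops e ((killingForm ℂ g).orthogonal n),
      ∀ m ∈ loopsIn n, pair (grad id G s) (P₂ ε s m) = 0) →
      pencil ε a lam s (grad id G s) ∈ loopsIn ((killingForm ℂ g).orthogonal n) := by
    intro G hG
    refine mem_orthogonal_of_pair fun m hm => ?_
    rw [pair_pencil hε, ← hP s m hm, hG s hs m hm, neg_zero]
  -- The identity (δF|P m) = 0 holds along S, so it may be differentiated in a direction t tangent
  -- to S. This expresses the Hessian term by δF itself.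
  have hder : ∀ (F : Loop g → ℂ) (D : Loop g → Loop g → Loop g),
      (∀ {γ γ' : ℂ → Loop g}, IsJetCurve γ γ' →
        IsJetCurve (fun τ => grad id F (γ τ)) (fun τ => D (γ τ) (γ' τ))) →
      (∀ s ∈ affineLoops e ((killingForm ℂ g).orthogonal n),
        ∀ m ∈ loopsIn n, pair (grad id F s) (P₂ ε s m) = 0) →
      ∀ t ∈ loopsIn ((killingForm ℂ g).orthogonal n),
        pair (D s t) (pencil ε a lam s m) = -(ε⁻¹ * pair (grad id F s) (br t m)) := by
    intro F D hD hF t ht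
    have hl := isJetCurve_line s t
    have h1 := (hD hl).hasDerivAt_pair (isJetCurve_pencil hε a lam hl (IsJetCurve.const m)) 0
    simp only [zero_smul, add_zero, map_zero, zero_add] at h1
    have h2 : (fun τ : ℂ => pair (grad id F (s + τ • t)) (pencil ε a lam (s + τ • t) m)) =
        fun _ => 0 := by
      funext τ
      rw [← hP _ m hm]
      refine hF _ ?_ m hm
      have h3 : s + τ • t - constLoop e = (s - constLoop e) + τ • t := by abel
      change s + τ • t - constLoop e ∈ loopsIn _
      rw [h3]
      exact add_mem hs (Submodule.smul_mem _ _ ht)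
    rw [h2] at h1
    have h3 := h1.unique (hasDerivAt_const (0 : ℂ) (0 : ℂ))
    rw [pair_smul_right] at h3
    linear_combination h3
  rw [hP s m hm, grad_bracket hε a lam hF hG hA hA' hB hB', pair_add_left, pair_sub_left,
    pair_smul_left, hder F A hA hFn _ (htan G hGn), hder G B hB hGn _ (htan F hFn)]
  have h := pair_pencil_cyclic hε a lam s (grad id F s) (grad id G s) m
  have e1 : pair (grad id F s) (br (pencil ε a lam s (grad id G s)) m) =
      pair (pencil ε a lam s (grad id G s)) (br m (grad id F s)) := by
    rw [← pair_br, pair_comm, ← pair_br, pair_comm]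
  have e2 : pair (grad id G s) (br (pencil ε a lam s (grad id F s)) m) =
      -pair (pencil ε a lam s (grad id F s)) (br (grad id G s) m) := by
    rw [br_skew (grad id G s) m, pair_neg_right, neg_neg, ← pair_br, pair_comm,
      ← pair_br, pair_comm]
  have e3 : pair (br (grad id G s) (grad id F s)) (pencil ε a lam s m) =
      -pair (pencil ε a lam s m) (br (grad id F s) (grad id G s)) := by
    rw [br_skew, pair_neg_left, pair_comm]
  rw [e1, e2, e3]
  linear_combination -ε⁻¹ * h

/-- The derivative of a field with values in L(n) has values in L(n), and n is a subalgebra, so the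
gradient of the bracket is again in L(n). There P₁ vanishes since a centralizes n. -/
theorem casimirs_bracket {n : Submodule ℂ g} (hn : ∀ x ∈ n, ∀ y ∈ n, ⁅x, y⁆ ∈ n)
    (ha : ∀ x ∈ n, ⁅a, x⁆ = 0) {K K' : Loop g → ℂ}
    (hK : K ∈ casimirs ε a n) (hK' : K' ∈ casimirs ε a n) :
    bracket (P₂ ε) K K' ∈ casimirs ε a n := by
  have hP : P₂ ε = pencil ε a 0 := funext fun q => (pencil_zero ε a q).symm
  rw [hP]
  obtain ⟨A, hA, hA'⟩ := exists_hessian hK.1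
  obtain ⟨B, hB, hB'⟩ := exists_hessian hK'.1
  refine ⟨isLocal_bracket hε a 0 hK.1 hK'.1, fun q => ?_⟩
  have hmem : ∀ (K : Loop g → ℂ) (D : Loop g → Loop g → Loop g), (∀ q, grad id K q ∈ loopsIn n) →
      (∀ {γ γ' : ℂ → Loop g}, IsJetCurve γ γ' →
        IsJetCurve (fun τ => grad id K (γ τ)) (fun τ => D (γ τ) (γ' τ))) →
      ∀ t, D q t ∈ loopsIn n := by
    intro K D hK hD t
    have := (hD (isJetCurve_line q t)).velocity_mem (fun τ => hK _) 0
    simpa using this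
  have h1 : grad id (bracket (pencil ε a 0) K K') q ∈ loopsIn n := by
    rw [grad_bracket hε a 0 hK.1 hK'.1 hA hA' hB hB']
    refine add_mem (sub_mem (hmem K A (fun q => (hK.2 q).2) hA _)
      (hmem K' B (fun q => (hK'.2 q).2) hB _)) (Submodule.smul_mem _ _ fun x => ?_)
    exact hn _ ((hK'.2 q).2 x) _ ((hK.2 q).2 x)
  refine ⟨?_, h1⟩
  have : br (constLoop a) (grad id (bracket (pencil ε a 0) K K') q) = 0 :=
    Loop.ext_apply fun x => ha _ (h1 x)
  simp [P₁, this]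

/-- These linear Casimirs suffice to cut out the level surface and to span the distribution. -/
theorem pair_mem_casimirs {n : Submodule ℂ g} (ha : ∀ x ∈ n, ⁅a, x⁆ = 0) {m : Loop g}
    (hm : m ∈ loopsIn n) : (fun q => 1 * pair q m) ∈ casimirs ε a n := by
  refine ⟨isLocal_pair 1 m, fun q => ?_⟩
  rw [grad_eq (hasGrad_pair 1 m q), one_smul]
  have : br (constLoop a) m = 0 := Loop.ext_apply fun x => ha _ (hm x)
  exact ⟨by simp [P₁, this], hm⟩

/-- The level surface of the Casimirs is the affine space over the loops in `n^⊥`. -/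
theorem levelSurface_casimirs {n : Submodule ℂ g} (ha : ∀ x ∈ n, ⁅a, x⁆ = 0) (e : g) :
    levelSurface (casimirs ε a n) (constLoop e) =
      affineLoops e ((killingForm ℂ g).orthogonal n) := by
  ext q
  constructor
  · intro hq
    refine mem_orthogonal_of_pair fun m hm => ?_
    have := hq _ (pair_mem_casimirs hε a ha hm)
    simp only [one_mul] at this
    rw [pair_sub_left, this, sub_self]
  · intro hq K hK
    -- Along the complex line from e to q the gradient lies in L(n) and the direction in L(n^⊥), so
    -- K is constant.
    have h1 := fun τ => (isRegular_of_isLocal hK.1).chain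
      (isJetCurve_line (constLoop e) (q - constLoop e)) τ
    have h2 : ∀ τ : ℂ, pair (grad id K (constLoop e + τ • (q - constLoop e)))
        (q - constLoop e) = 0 := fun τ => by
      rw [pair_comm]
      exact pair_eq_zero_of_mem_orthogonal hq (hK.2 _).2
    simp only [h2] at h1
    have h3 := is_const_of_deriv_eq_zero (fun τ => (h1 τ).differentiableAt)
      (fun τ => (h1 τ).deriv) 1 0
    simpa using h3

theorem hamDistribution_casimirs {n : Submodule ℂ g} (ha : ∀ x ∈ n, ⁅a, x⁆ = 0) (q : Loop g) :
    hamDistribution (P₂ ε) (casimirs ε a n) q = (loopsIn n).map (P₂ ε q) := by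
  refine le_antisymm (Submodule.span_le.2 ?_) ?_
  · rintro _ ⟨K, hK, rfl⟩
    exact ⟨_, (hK.2 q).2, rfl⟩
  · rintro _ ⟨m, hm, rfl⟩
    refine Submodule.subset_span ⟨_, pair_mem_casimirs hε a ha hm, ?_⟩
    simp only
    rw [grad_eq (hasGrad_pair 1 m q), one_smul]

end Pencil

end

end LoopReduction

/-! ### Nilpotent exponentials and the Baker-Campbell-Hausdorff theorem for loops. -/

namespace LoopReduction

set_option linter.unusedSectionVars false

noncomputable section

/-! ### Exponentials of nilpotent endomorphisms -/

section Exponential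

variable {M : Type*} [AddCommGroup M] [Module ℂ M]

theorem expNil_eq_sum {T : Module.End ℂ M} {N : ℕ} (h : T ^ N = 0) :
    expNil T = ∑ k ∈ Finset.range N, ((k.factorial : ℂ)⁻¹) • T ^ k := by
  refine finsum_eq_sum_of_support_subset _ fun k hk => ?_
  by_contra hk'
  rw [Finset.coe_range, Set.mem_Iio, not_lt] at hk'
  exact hk (by simp [pow_eq_zero_of_le hk' h])

theorem expNil_zero : expNil (0 : Module.End ℂ M) = 1 := by
  rw [expNil_eq_sum (N := 1) (by simp)]
  simp

theorem expNil_add {A B : Module.End ℂ M} (h : Commute A B) (hA : IsNilpotent A)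
    (hB : IsNilpotent B) : expNil (A + B) = expNil A * expNil B := by
  -- The exponential `IsNilpotent.exp` is defined over ℚ; restricting scalars identifies it with
  -- `expNil`.
  let _ : Module ℚ (Module.End ℂ M) := Module.compHom _ (algebraMap ℚ ℂ)
  have key : ∀ {T : Module.End ℂ M}, IsNilpotent T → expNil T = IsNilpotent.exp T := by
    rintro T ⟨N, hN⟩
    rw [expNil_eq_sum hN, IsNilpotent.exp_eq_sum hN]
    refine Finset.sum_congr rfl fun k _ => ?_
    change _ = (algebraMap ℚ ℂ (k.factorial : ℚ)⁻¹) • T ^ k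
    simp
  rw [key (h.isNilpotent_add hA hB), key hA, key hB, IsNilpotent.exp_add_of_commute h hA hB]

theorem expNil_neg_mul {A : Module.End ℂ M} (hA : IsNilpotent A) :
    expNil (-A) * expNil A = 1 := by
  rw [← expNil_add (Commute.neg_left (Commute.refl A)) hA.neg hA, neg_add_cancel, expNil_zero]

theorem expNil_mul_neg {A : Module.End ℂ M} (hA : IsNilpotent A) :
    expNil A * expNil (-A) = 1 := by
  rw [← expNil_add (Commute.neg_right (Commute.refl A)) hA hA.neg, add_neg_cancel, expNil_zero]

/-- Used with evaluation at a point, with ad, with `opEnd` and with the inclusion of L(g) into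
operators, to move exponentials between these spaces. -/
theorem intertwine_expNil {M' : Type*} [AddCommGroup M'] [Module ℂ M'] {T : Module.End ℂ M}
    {T' : Module.End ℂ M'} (hT : IsNilpotent T) (hT' : IsNilpotent T') (S : M →ₗ[ℂ] M')
    (h : ∀ x, S (T x) = T' (S x)) (x : M) : S (expNil T x) = expNil T' (S x) := by
  obtain ⟨N, hN⟩ := hT
  obtain ⟨N', hN'⟩ := hT'
  have hpow : ∀ (k : ℕ) (x : M), S ((T ^ k) x) = (T' ^ k) (S x) := by
    intro k
    induction k with
    | zero => simp
    | succ k ih => intro x; rw [pow_succ, pow_succ, Module.End.mul_apply, ih, h]; rfl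
  rw [expNil_eq_sum (pow_eq_zero_of_le (le_max_left N N') hN),
    expNil_eq_sum (pow_eq_zero_of_le (le_max_right N N') hN')]
  simp [hpow, LinearMap.sum_apply]

/-- The adjoint action of an associative algebra of endomorphisms. -/
def adEnd (A : Module.End ℂ M) : Module.End ℂ (Module.End ℂ M) :=
  LinearMap.mulLeft ℂ A - LinearMap.mulRight ℂ A

@[simp] theorem adEnd_apply (A X : Module.End ℂ M) : adEnd A X = A * X - X * A := rfl

theorem isNilpotent_adEnd {A : Module.End ℂ M} (hA : IsNilpotent A) : IsNilpotent (adEnd A) :=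
  (LinearMap.commute_mulLeft_right A A).isNilpotent_sub
    ((LinearMap.isNilpotent_mulLeft_iff ℂ A).2 hA) ((LinearMap.isNilpotent_mulRight_iff ℂ A).2 hA)

/-- Left and right multiplication commute, so the exponential of their difference is conjugation by
the exponential. -/
theorem expNil_adEnd {A : Module.End ℂ M} (hA : IsNilpotent A) (X : Module.End ℂ M) :
    expNil (adEnd A) X = expNil A * X * expNil (-A) := by
  have hL := (LinearMap.isNilpotent_mulLeft_iff ℂ A).2 hA
  have hR := (LinearMap.isNilpotent_mulRight_iff ℂ A).2 hA
  have h1 : adEnd A = LinearMap.mulLeft ℂ A + -LinearMap.mulRight ℂ A := sub_eq_add_neg _ _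
  rw [h1, expNil_add (LinearMap.commute_mulLeft_right A A).neg_right hL hR.neg,
    Module.End.mul_apply]
  obtain ⟨N, hN⟩ := hA
  have h2 : ∀ Y, expNil (LinearMap.mulLeft ℂ A) Y = expNil A * Y := fun Y => by
    rw [expNil_eq_sum hN, expNil_eq_sum (N := N) (by rw [LinearMap.pow_mulLeft, hN]; simp)]
    simp only [LinearMap.sum_apply, LinearMap.smul_apply, LinearMap.pow_mulLeft,
      LinearMap.mulLeft_apply, Finset.sum_mul, smul_mul_assoc]
  have h3 : -LinearMap.mulRight ℂ A = LinearMap.mulRight ℂ (-A) := by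
    ext; simp
  have h4 : ∀ Y, expNil (-LinearMap.mulRight ℂ A) Y = Y * expNil (-A) := fun Y => by
    have hN' : (-A) ^ N = 0 := by rw [neg_pow, hN, mul_zero]
    rw [h3, expNil_eq_sum hN', expNil_eq_sum (N := N) (by rw [LinearMap.pow_mulRight, hN']; simp)]
    simp only [LinearMap.sum_apply, LinearMap.smul_apply, LinearMap.pow_mulRight,
      LinearMap.mulRight_apply, Finset.mul_sum, mul_smul_comm]
  rw [h4, h2, mul_assoc]

end Exponential

/-! ### Filtered endomorphisms -/

section Filtration

variable {M : Type*} [AddCommGroup M] [Module ℂ M]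

/-- The endomorphisms that lower a filtration by `k`. -/
def lowering (Fil : ℤ → Submodule ℂ M) (k : ℤ) : Submodule ℂ (Module.End ℂ M) where
  carrier := {A | ∀ j, ∀ x ∈ Fil j, A x ∈ Fil (j - k)}
  add_mem' hA hB j x hx := add_mem (hA j x hx) (hB j x hx)
  zero_mem' _ _ _ := zero_mem _
  smul_mem' c _ hA j x hx := Submodule.smul_mem _ c (hA j x hx)

variable {Fil : ℤ → Submodule ℂ M}

theorem lowering_mul {a b : ℤ} {A B : Module.End ℂ M} (hA : A ∈ lowering Fil a)
    (hB : B ∈ lowering Fil b) : A * B ∈ lowering Fil (a + b) := by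
  intro j x hx
  have := hA _ _ (hB j x hx)
  rwa [sub_sub, add_comm b a] at this

theorem one_mem_lowering : (1 : Module.End ℂ M) ∈ lowering Fil 0 := by
  intro j x hx
  simpa using hx

theorem lowering_anti (hFil : Monotone Fil) {a b : ℤ} (hab : a ≤ b) :
    lowering Fil b ≤ lowering Fil a := fun _ hA j x hx => hFil (by omega) (hA j x hx)

theorem lowering_pow {A : Module.End ℂ M} (hA : A ∈ lowering Fil 1) (n : ℕ) :
    A ^ n ∈ lowering Fil n := by
  induction n with
  | zero => simpa using one_mem_lowering
  | succ n ih => rw [pow_succ, Nat.cast_succ]; exact lowering_mul ih hA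

/-- A finite exhaustive separated filtration. -/
structure IsFiniteFiltration (Fil : ℤ → Submodule ℂ M) (N : ℕ) : Prop where
  mono : Monotone Fil
  top : Fil N = ⊤
  bot : Fil (-N - 1) = ⊥

theorem IsFiniteFiltration.eq_zero {N : ℕ} (h : IsFiniteFiltration Fil N) {k : ℤ}
    (hk : 2 * N + 1 ≤ k) {A : Module.End ℂ M} (hA : A ∈ lowering Fil k) : A = 0 := by
  refine LinearMap.ext fun x => ?_
  have h1 := hA N x (by rw [h.top]; trivial)
  have h2 := h.mono (show (N : ℤ) - k ≤ -N - 1 by omega) h1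
  rw [h.bot] at h2
  exact h2

theorem IsFiniteFiltration.pow_eq_zero {N : ℕ} (h : IsFiniteFiltration Fil N)
    {A : Module.End ℂ M} (hA : A ∈ lowering Fil 1) : A ^ (2 * N + 2) = 0 :=
  h.eq_zero (by push_cast; omega) (lowering_pow hA _)

theorem IsFiniteFiltration.isNilpotent {N : ℕ} (h : IsFiniteFiltration Fil N)
    {A : Module.End ℂ M} (hA : A ∈ lowering Fil 1) : IsNilpotent A := ⟨_, h.pow_eq_zero hA⟩

theorem pow_sub_pow_mem {A B : Module.End ℂ M} (hA : A ∈ lowering Fil 1)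
    (hB : B ∈ lowering Fil 1) {k : ℤ} (hAB : A - B ∈ lowering Fil k) (n : ℕ) :
    A ^ (n + 1) - B ^ (n + 1) ∈ lowering Fil (n + k) := by
  induction n with
  | zero => simpa using hAB
  | succ n ih =>
    have h1 : A ^ (n + 1 + 1) - B ^ (n + 1 + 1) =
        A ^ (n + 1) * (A - B) + (A ^ (n + 1) - B ^ (n + 1)) * B := by
      rw [pow_succ A (n + 1), pow_succ B (n + 1)]; noncomm_ring
    rw [h1]
    have h2 := lowering_mul (lowering_pow hA (n + 1)) hAB
    have h3 := lowering_mul ih hB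
    refine add_mem (by exact_mod_cast h2) ?_
    convert h3 using 2
    push_cast; ring

/-- First-order Taylor expansion. In the terms of order at least 2, the difference A - B, which
lowers by k, comes with at least one further factor lowering by 1. -/
theorem IsFiniteFiltration.expNil_sub {N : ℕ} (h : IsFiniteFiltration Fil N)
    {A B : Module.End ℂ M} (hA : A ∈ lowering Fil 1)
    (hB : B ∈ lowering Fil 1) {k : ℤ} (hAB : A - B ∈ lowering Fil k) :
    expNil A - expNil B - (A - B) ∈ lowering Fil (k + 1) := by
  rw [expNil_eq_sum (h.pow_eq_zero hA), expNil_eq_sum (h.pow_eq_zero hB),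
    ← Finset.sum_sub_distrib, Finset.sum_range_succ', Finset.sum_range_succ']
  simp only [← smul_sub]
  have h1 : ∀ X Y : Module.End ℂ M, X + ((((0 + 1).factorial : ℕ) : ℂ)⁻¹ • (A ^ (0 + 1) - B ^ (0 + 1))) +
      (((0).factorial : ℕ) : ℂ)⁻¹ • (A ^ 0 - B ^ 0) - (A - B) = X := by
    intro X _
    simp
  rw [h1 _ 0]
  refine sum_mem fun n _ => Submodule.smul_mem _ _ ?_
  refine lowering_anti h.mono ?_ (pow_sub_pow_mem hA hB hAB (n + 1))
  push_cast
  omega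

theorem IsFiniteFiltration.expNil_sub_one {N : ℕ} (h : IsFiniteFiltration Fil N)
    {A : Module.End ℂ M} (hA : A ∈ lowering Fil 1) :
    expNil A - 1 - A ∈ lowering Fil 2 := by
  have := h.expNil_sub hA (zero_mem _) (k := 1) (by simpa using hA)
  simpa [expNil_zero] using this

theorem IsFiniteFiltration.expNil_sub_one' {N : ℕ} (h : IsFiniteFiltration Fil N)
    {A : Module.End ℂ M} (hA : A ∈ lowering Fil 1) : expNil A - 1 ∈ lowering Fil 1 := by
  have := add_mem (lowering_anti h.mono (by norm_num) (h.expNil_sub_one hA)) hA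
  simpa using this

end Filtration

variable {g : Type*} [LieRing g] [LieAlgebra ℂ g] [Module.Finite ℂ g]

/-! ### Inner derivations -/

section Inner

variable [LieAlgebra.IsKilling ℂ g]

theorem eq_zero_of_lie {x : g} (h : ∀ y : g, ⁅x, y⁆ = 0) : x = 0 := by
  refine (LieAlgebra.IsKilling.killingForm_nondegenerate ℂ g).1 x fun y => ?_
  have h1 : LieAlgebra.ad ℂ g x = 0 := LinearMap.ext h
  rw [killingForm_apply_apply, h1, LinearMap.zero_comp, map_zero]

/-- A linear inverse recovers an element from its inner derivation. Linearity matters when it is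
applied pointwise to a loop, because the result is again smooth. -/
theorem exists_ad_leftInverse :
    ∃ r : Module.End ℂ g →ₗ[ℂ] g, ∀ x, r (LieAlgebra.ad ℂ g x) = x := by
  have hker : LinearMap.ker (LieAlgebra.ad ℂ g : g →ₗ[ℂ] Module.End ℂ g) = ⊥ := by
    rw [LinearMap.ker_eq_bot']
    exact fun x hx => eq_zero_of_lie fun y => LinearMap.congr_fun hx y
  obtain ⟨r, hr⟩ := LinearMap.exists_leftInverse_of_injective _ hker
  exact ⟨r, fun x => LinearMap.congr_fun hr x⟩

theorem exists_ad_eq {δ : Module.End ℂ g} (hδ : ∀ x y, δ ⁅x, y⁆ = ⁅δ x, y⁆ + ⁅x, δ y⁆) :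
    ∃ w, LieAlgebra.ad ℂ g w = δ := by
  let D : LieDerivation ℂ g g := ⟨δ, fun x y => by rw [hδ, ← lie_skew y]; abel⟩
  obtain ⟨w, hw⟩ := LieDerivation.IsKilling.exists_eq_ad D
  refine ⟨w, LinearMap.ext fun x => ?_⟩
  rw [← LieDerivation.coe_ad_apply_eq_ad_apply, hw]

end Inner

/-- A family of endomorphisms that is smooth on each vector is smooth in matrix entries, so any
linear function of it with values in g is a loop. -/
theorem loop_of_endomorphisms {V : ℝ → Module.End ℂ g} (hV : ∀ y, ∃ q : Loop g, ∀ x, q.1 x = V x y)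
    (ψ : Module.End ℂ g →ₗ[ℂ] g) : ∃ w : Loop g, ∀ x, w.1 x = ψ (V x) := by
  choose q hq using hV
  have hsum : ∀ A : Module.End ℂ g, A = ∑ j, LinearMap.smulRight ((Module.finBasis ℂ g).coord j)
      (A (Module.finBasis ℂ g j)) := by
    intro A
    refine LinearMap.ext fun y => ?_
    conv_lhs => rw [← (Module.finBasis ℂ g).sum_repr y]
    simp only [map_sum, map_smul, LinearMap.sum_apply, LinearMap.smulRight_apply,
      Module.Basis.coord_apply]
  refine ⟨∑ j, Loop.map (ψ ∘ₗ LinearMap.smulRightₗ ((Module.finBasis ℂ g).coord j))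
    (q (Module.finBasis ℂ g j)), fun x => ?_⟩
  rw [hsum (V x), map_sum]
  simp [hq]

/-! ### Exponentials in the loop algebra -/

/-- The filtration of the loop algebra. -/
def loopFil (gr : ℤ → Submodule ℂ g) (j : ℤ) : Submodule ℂ (Loop g) := loopsIn (below gr j)

/-- The filtration of the space of first order operators. -/
def opFil (gr : ℤ → Submodule ℂ g) (j : ℤ) : Submodule ℂ (ℂ × Loop g) where
  carrier := {X | (j < 2 → X.1 = 0) ∧ X.2 ∈ loopsIn (below gr j)}
  add_mem' := fun hX hY => ⟨fun hj => by simp [hX.1 hj, hY.1 hj], add_mem hX.2 hY.2⟩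
  zero_mem' := ⟨fun _ => rfl, zero_mem _⟩
  smul_mem' := fun c _ hX => ⟨fun hj => by simp [hX.1 hj], Submodule.smul_mem _ c hX.2⟩

/-- The operator `c ∂_x + ad q` on the loop algebra. -/
def opEnd : (ℂ × Loop g) →ₗ[ℂ] Module.End ℂ (Loop g) :=
  LinearMap.coprod (LinearMap.toSpanSingleton ℂ _ dx) br

theorem opEnd_apply (X : ℂ × Loop g) : opEnd X = X.1 • dx + br X.2 := by
  simp [opEnd]

theorem adOp_apply (m : Loop g) (X : ℂ × Loop g) :
    adOp m X = (0, br m X.2 - X.1 • dx m) := by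
  simp [adOp]

/-- The abstract action on pairs becomes the commutator of honest operators on L(g), because ∂_x is
a derivation of the bracket. -/
theorem opEnd_adOp (m : Loop g) (X : ℂ × Loop g) : opEnd (adOp m X) = adEnd (br m) (opEnd X) := by
  refine LinearMap.ext fun s => ?_
  simp only [opEnd_apply, adOp_apply, adEnd_apply, zero_smul, zero_add, map_sub, map_smul,
    LinearMap.sub_apply, LinearMap.smul_apply, Module.End.mul_apply, LinearMap.add_apply, map_add,
    dx_br, br_leibniz m X.2 s]
  module

/-- Constant loops are killed by ∂_x, so they detect the order-zero part; ad is injective since the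
Killing form is nondegenerate. -/
theorem eq_of_opEnd [LieAlgebra.IsKilling ℂ g] {X Y : ℂ × Loop g} (h1 : X.1 = Y.1)
    (h2 : opEnd X = opEnd Y) : X = Y := by
  refine Prod.ext h1 (Loop.ext_apply fun x => sub_eq_zero.1 (eq_zero_of_lie fun y => ?_))
  rw [opEnd_apply, opEnd_apply, h1] at h2
  have h3 := congrArg (fun A : Module.End ℂ (Loop g) => (A (constLoop y)).1 x) h2
  simp only [LinearMap.add_apply, LinearMap.smul_apply, dx_constLoop, smul_zero, zero_add,
    br_apply, constLoop_apply] at h3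
  rw [sub_lie, h3, sub_self]

namespace IsGradedTriple

variable {gr : ℤ → Submodule ℂ g} {e h f : g} (H : IsGradedTriple gr e h f)
include H

theorem exists_filtration : ∃ N : ℕ, IsFiniteFiltration (below gr) N ∧
    IsFiniteFiltration (loopFil gr) N ∧ IsFiniteFiltration (opFil gr) N := by
  obtain ⟨N, hN2, hN, hN'⟩ := H.below_eq_top
  refine ⟨N, ⟨fun i j hij => below_mono gr hij, hN, hN'⟩,
    ⟨fun i j hij => loopsIn_mono (below_mono gr hij), ?_, ?_⟩,
    ⟨fun i j hij X hX => ⟨fun hj => hX.1 (by omega), loopsIn_mono (below_mono gr hij) hX.2⟩,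
      ?_, ?_⟩⟩
  · rw [eq_top_iff]
    intro q _ x
    rw [hN]; trivial
  · rw [eq_bot_iff]
    intro q hq
    refine Loop.ext_apply fun x => ?_
    have := hq x
    rw [hN'] at this
    exact this
  · rw [eq_top_iff]
    intro X _
    refine ⟨fun hj => by omega, fun x => ?_⟩
    rw [hN]; trivial
  · rw [eq_bot_iff]
    intro X hX
    refine Prod.ext (hX.1 (by omega)) (Loop.ext_apply fun x => ?_)
    have := hX.2 x
    rw [hN'] at this
    exact this

theorem ad_lowering {k : ℤ} {x : g} (hx : x ∈ below gr (-k)) :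
    LieAlgebra.ad ℂ g x ∈ lowering (below gr) k := by
  intro j y hy
  rw [sub_eq_neg_add]
  exact H.lie_mem_below hx hy

theorem br_lowering {k : ℤ} {m : Loop g} (hm : m ∈ loopsIn (below gr (-k))) :
    br m ∈ lowering (loopFil gr) k := by
  intro j q hq x
  rw [sub_eq_neg_add]
  exact H.lie_mem_below (hm x) (hq x)

/-- In `opFil` the operator ∂_x counts as degree 2, like e. For m of degree at most -k the term m'
has degree at most -k ≤ 2 - k, so the derivative never spoils the filtration. -/
theorem adOp_lowering {k : ℤ} {m : Loop g} (hm : m ∈ loopsIn (below gr (-k))) :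
    adOp m ∈ lowering (opFil gr) k := by
  intro j X hX
  rw [adOp_apply]
  refine ⟨fun _ => rfl, sub_mem (H.br_lowering hm j X.2 hX.2) ?_⟩
  by_cases hj : j < 2
  · rw [hX.1 hj, zero_smul]; exact zero_mem _
  · exact Submodule.smul_mem _ _ (loopsIn_mono (below_mono gr (by omega)) (dx_mem hm))

theorem isNilpotent_ad {x : g} (hx : x ∈ below gr (-1)) : IsNilpotent (LieAlgebra.ad ℂ g x) := by
  obtain ⟨N, h1, -, -⟩ := H.exists_filtration
  exact h1.isNilpotent (H.ad_lowering hx)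

theorem isNilpotent_br {m : Loop g} (hm : m ∈ loopsIn (below gr (-1))) : IsNilpotent (br m) := by
  obtain ⟨N, -, h1, -⟩ := H.exists_filtration
  exact h1.isNilpotent (H.br_lowering hm)

theorem isNilpotent_adOp {m : Loop g} (hm : m ∈ loopsIn (below gr (-1))) :
    IsNilpotent (adOp m) := by
  obtain ⟨N, -, -, h1⟩ := H.exists_filtration
  exact h1.isNilpotent (H.adOp_lowering hm)

theorem expNil_br_apply {m : Loop g} (hm : m ∈ loopsIn (below gr (-1))) (q : Loop g) (x : ℝ) :
    (expNil (br m) q).1 x = expNil (LieAlgebra.ad ℂ g (m.1 x)) (q.1 x) := by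
  let ev : Loop g →ₗ[ℂ] g := ⟨⟨fun q => q.1 x, fun _ _ => rfl⟩, fun _ _ => rfl⟩
  exact intertwine_expNil (H.isNilpotent_br hm) (H.isNilpotent_ad (hm x)) ev (fun q => rfl) q

/-- By `expNil_adEnd`, ad(exp(ad x)y) is ad y conjugated by exp(ad x); evaluating at exp(ad x)z
gives the automorphism property. -/
theorem expNil_ad_lie {x : g} (hx : x ∈ below gr (-1)) (y z : g) :
    expNil (LieAlgebra.ad ℂ g x) ⁅y, z⁆ =
      ⁅expNil (LieAlgebra.ad ℂ g x) y, expNil (LieAlgebra.ad ℂ g x) z⁆ := by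
  have hn := H.isNilpotent_ad hx
  have h1 := intertwine_expNil hn (isNilpotent_adEnd hn)
    (LieAlgebra.ad ℂ g : g →ₗ[ℂ] Module.End ℂ g) (fun y => (ad_mul_sub x y).symm) y
  rw [expNil_adEnd hn] at h1
  have h2 := LinearMap.congr_fun h1 (expNil (LieAlgebra.ad ℂ g x) z)
  simp only [Module.End.mul_apply] at h2
  have h3 := LinearMap.congr_fun (expNil_neg_mul hn) z
  simp only [Module.End.mul_apply, Module.End.one_apply] at h3
  rw [h3] at h2
  exact h2.symm

theorem lowering_iff {k : ℤ} {A : Module.End ℂ g} :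
    A ∈ lowering (below gr) k ↔ ∀ i, ∀ x ∈ gr i, A x ∈ below gr (i - k) := by
  refine ⟨fun hA i x hx => hA i x (gr_le_below gr le_rfl hx), fun hA j x hx => ?_⟩
  refine below_induction (P := fun x => A x ∈ below gr (j - k)) ?_ ?_ hx
  · intro i hi x hx
    exact below_mono gr (by omega) (hA i x hx)
  · intro x y hx hy
    rw [map_add]; exact add_mem hx hy

/-- The leading part of an endomorphism that lowers the degree by `k`. -/
theorem exists_leading (k : ℤ) : ∃ lead : Module.End ℂ g →ₗ[ℂ] Module.End ℂ g,
    ∀ A i, ∀ x ∈ gr i, lead A x = H.pr (i - k) (A x) := by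
  obtain ⟨N, -, hN⟩ := H.exists_bound
  refine ⟨∑ j ∈ Finset.Icc (-N : ℤ) N,
    LinearMap.mulLeft ℂ (H.pr (j - k)) * LinearMap.mulRight ℂ (H.pr j), fun A i x hx => ?_⟩
  simp only [LinearMap.sum_apply, Module.End.mul_apply, LinearMap.mulLeft_apply,
    LinearMap.mulRight_apply]
  by_cases hi : i ∈ Finset.Icc (-N : ℤ) N
  · rw [Finset.sum_eq_single i _ (fun h => absurd hi h), H.pr_of_mem hx]
    intro j _ hj
    rw [H.pr_of_mem_ne hx hj.symm, map_zero, map_zero]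
  · have : x = 0 := by
      have := hN i (by rw [Finset.mem_Icc] at hi; omega)
      rw [this] at hx
      exact hx
    simp [this]

variable [LieAlgebra.IsKilling ℂ g]

/-- The leading part of a unipotent automorphism is an inner derivation. -/
theorem exists_leading_inner {k : ℤ} (hk : 1 ≤ k) : ∃ ψ : Module.End ℂ g →ₗ[ℂ] g,
    (∀ A, ψ A ∈ below gr (-k)) ∧ ∀ v : Module.End ℂ g, (∀ x y, v ⁅x, y⁆ = ⁅v x, v y⁆) →
      v - 1 ∈ lowering (below gr) k →
        v - 1 - LieAlgebra.ad ℂ g (ψ (v - 1)) ∈ lowering (below gr) (k + 1) := by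
  obtain ⟨lead, hlead⟩ := H.exists_leading k
  obtain ⟨r, hr⟩ := exists_ad_leftInverse (g := g)
  -- The correction is a fixed linear function of v - 1, so it can be applied pointwise to a smooth
  -- family of automorphisms.
  refine ⟨H.pr (-k) ∘ₗ r ∘ₗ lead, fun A => H.pr_mem_below le_rfl _, fun v hv hvk => ?_⟩
  set A := v - 1 with hA
  -- A = v - 1 is a derivation up to [Ax, Ay], which lowers the degree by 2k. As k ≥ 1, this error
  -- disappears from the leading part.
  have hAlie : ∀ x y, A ⁅x, y⁆ = ⁅A x, y⁆ + ⁅x, A y⁆ + ⁅A x, A y⁆ := by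
    intro x y
    simp only [hA, LinearMap.sub_apply, Module.End.one_apply, hv, sub_lie, lie_sub]
    abel
  have hpr : ∀ {i j : ℤ} {x y : g}, x ∈ below gr i → y ∈ gr j →
      H.pr (i + j) ⁅x, y⁆ = ⁅H.pr i x, y⁆ := by
    intro i j x y _ hy
    rw [← lie_skew, ← lie_skew (H.pr i x), map_neg, add_comm, H.pr_lie hy]
  have hder : ∀ x y, lead A ⁅x, y⁆ = ⁅lead A x, y⁆ + ⁅x, lead A y⁆ := by
    intro x y
    refine H.induction (P := fun x => lead A ⁅x, y⁆ = ⁅lead A x, y⁆ + ⁅x, lead A y⁆) ?_ ?_ x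
    · intro i x hx
      refine H.induction (P := fun y => lead A ⁅x, y⁆ = ⁅lead A x, y⁆ + ⁅x, lead A y⁆) ?_ ?_ y
      · intro j y hy
        have hAx := hvk i x (gr_le_below gr le_rfl hx)
        have hAy := hvk j y (gr_le_below gr le_rfl hy)
        rw [hlead A _ _ (H.lie_mem i j x hx y hy), hlead A i x hx, hlead A j y hy, hAlie, map_add,
          map_add]
        have e1 := hpr hAx hy
        have e2 := H.pr_lie hx (j - k) (A y)
        have e3 := H.mem_below_iff.1 (H.lie_mem_below hAx hAy) (i + j - k) (by omega)
        rw [show i - k + j = i + j - k by ring] at e1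
        rw [show i + (j - k) = i + j - k by ring] at e2
        rw [e1, e2, e3, add_zero]
      · intro y y' hy hy'
        simp only [lie_add, map_add, hy, hy']
        abel
    · intro x x' hx hx'
      simp only [add_lie, map_add, hx, hx']
      abel
  obtain ⟨w, hw⟩ := exists_ad_eq hder
  -- Since the leading part is homogeneous of degree -k, only the component of w of that degree
  -- acts.
  have hw' : LieAlgebra.ad ℂ g (H.pr (-k) w) = lead A := by
    refine LinearMap.ext fun x => H.induction
      (P := fun x => LieAlgebra.ad ℂ g (H.pr (-k) w) x = lead A x) ?_ ?_ x
    · intro i x hx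
      have h1 : ⁅w, x⁆ = lead A x := LinearMap.congr_fun hw x
      obtain ⟨N, -, hN, -⟩ := H.below_eq_top
      have h2 : H.pr (-k + i) ⁅w, x⁆ = ⁅H.pr (-k) w, x⁆ := by
        rw [← lie_skew, ← lie_skew (H.pr (-k) w), map_neg, add_comm, H.pr_lie hx]
      change ⁅H.pr (-k) w, x⁆ = _
      rw [← h2, h1, hlead A i x hx]
      exact H.pr_of_mem (by rw [neg_add_eq_sub]; exact H.pr_mem _ _)
    · intro x y hx hy
      rw [map_add, map_add, hx, hy]
  have h1 : (H.pr (-k) ∘ₗ r ∘ₗ lead) A = H.pr (-k) w := by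
    simp only [LinearMap.comp_apply]
    rw [← hw, hr]
  rw [h1, hw', H.lowering_iff]
  intro i x hx
  rw [LinearMap.sub_apply, hlead A i x hx]
  refine H.mem_below_iff.2 fun j hj => ?_
  rw [map_sub]
  by_cases hji : j = i - k
  · subst hji
    rw [H.pr_of_mem (H.pr_mem _ _), sub_self]
  · rw [H.mem_below_iff.1 (hvk i x (gr_le_below gr le_rfl hx)) j (by omega),
      H.pr_of_mem_ne (H.pr_mem (i - k) (A x)) (Ne.symm hji), sub_zero]

/-- The Baker-Campbell-Hausdorff theorem for loops in the nilpotent subalgebra of negative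
degree. -/
theorem exists_bch {m m' : Loop g} (hm : m ∈ loopsIn (below gr (-1)))
    (hm' : m' ∈ loopsIn (below gr (-1))) :
    ∃ z : Loop g, z - (m + m') ∈ loopsIn (below gr (-2)) ∧
      expNil (br m) * expNil (br m') = expNil (br z) := by
  obtain ⟨N, hN, hNl, -⟩ := H.exists_filtration
  have h21 : below gr (-2) ≤ below gr (-1) := below_mono gr (by norm_num)
  let E : g → Module.End ℂ g := fun x => expNil (LieAlgebra.ad ℂ g x)
  have hneg : ∀ x : g, LieAlgebra.ad ℂ g (-x) = -LieAlgebra.ad ℂ g x := fun x => map_neg _ x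
  -- Successive approximation: z is corrected degree by degree until exp(-z) exp(m) exp(m') is the
  -- identity.
  have key : ∀ k : ℕ, ∃ z : Loop g, z - (m + m') ∈ loopsIn (below gr (-2)) ∧
      ∀ x, E (-z.1 x) * (E (m.1 x) * E (m'.1 x)) - 1 ∈ lowering (below gr) (k + 2) := by
    intro k
    induction k with
    | zero =>
      -- For z = m + m' the first-order terms of the three exponentials cancel, and everything else
      -- lowers the degree by at least 2.
      refine ⟨m + m', by rw [sub_self]; exact zero_mem _, fun x => ?_⟩
      have h0 : -(m + m').1 x ∈ below gr (-1) := neg_mem (add_mem (hm x) (hm' x))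
      have e1 := hN.expNil_sub_one (H.ad_lowering (hm x))
      have e2 := hN.expNil_sub_one (H.ad_lowering (hm' x))
      have e3 := hN.expNil_sub_one (H.ad_lowering h0)
      have f1 := hN.expNil_sub_one' (H.ad_lowering (hm x))
      have f2 := hN.expNil_sub_one' (H.ad_lowering (hm' x))
      have f3 := hN.expNil_sub_one' (H.ad_lowering h0)
      have hsum : LieAlgebra.ad ℂ g (-(m + m').1 x) =
          -LieAlgebra.ad ℂ g (m.1 x) - LieAlgebra.ad ℂ g (m'.1 x) := by
        rw [Loop.add_apply, neg_add, map_add, map_neg, map_neg, sub_eq_add_neg]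
      rw [hsum] at e3
      have p1 := lowering_mul f1 f2
      have p2 := lowering_mul f3 f1
      have p3 := lowering_mul f3 f2
      have p4 := lowering_anti hN.mono (show (2 : ℤ) ≤ 1 + (1 + 1) by norm_num) (lowering_mul f3 p1)
      norm_num at p1 p2 p3 p4
      have := add_mem (add_mem (add_mem (add_mem (add_mem (add_mem e1 e2) e3) p1) p2) p3) p4
      rw [Nat.cast_zero, zero_add]
      convert this using 1
      simp only [E]
      rw [hsum]
      noncomm_ring
    | succ k ih =>
      obtain ⟨z, hz, hzk⟩ := ih
      have hz1 : z ∈ loopsIn (below gr (-1)) := by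
        have := add_mem (loopsIn_mono h21 hz) (add_mem hm hm')
        simpa using this
      have hzn1 : -z ∈ loopsIn (below gr (-1)) := neg_mem hz1
      obtain ⟨ψ, hψ, hψ'⟩ := H.exists_leading_inner (show (1 : ℤ) ≤ (k : ℤ) + 2 by omega)
      obtain ⟨w, hw⟩ := loop_of_endomorphisms
        (V := fun x => E (-z.1 x) * (E (m.1 x) * E (m'.1 x)) - 1) (fun y => by
          refine ⟨expNil (br (-z)) (expNil (br m) (expNil (br m') (constLoop y))) - constLoop y,
            fun x => ?_⟩
          rw [Loop.sub_apply, H.expNil_br_apply hzn1, H.expNil_br_apply hm,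
            H.expNil_br_apply hm']
          rfl) ψ
      have hwk : ∀ x, w.1 x ∈ below gr (-(k + 2)) := fun x => by rw [hw]; exact hψ _
      refine ⟨z + w, ?_, fun x => ?_⟩
      · have h1 : z + w - (m + m') = (z - (m + m')) + w := by abel
        rw [h1]
        exact add_mem hz fun x => below_mono gr (by omega) (hwk x)
      · have hu : E (m.1 x) * E (m'.1 x) - 1 ∈ lowering (below gr) 1 := by
          have f1 := hN.expNil_sub_one' (H.ad_lowering (hm x))
          have f2 := hN.expNil_sub_one' (H.ad_lowering (hm' x))
          have p1 := lowering_anti hN.mono (show (1 : ℤ) ≤ 1 + 1 by norm_num) (lowering_mul f1 f2)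
          convert add_mem (add_mem p1 f1) f2 using 1
          simp only [E]
          noncomm_ring
        have hauto : ∀ y y', (E (-z.1 x) * (E (m.1 x) * E (m'.1 x))) ⁅y, y'⁆ =
            ⁅(E (-z.1 x) * (E (m.1 x) * E (m'.1 x))) y,
              (E (-z.1 x) * (E (m.1 x) * E (m'.1 x))) y'⁆ := by
          intro y y'
          simp only [Module.End.mul_apply, E]
          rw [H.expNil_ad_lie (hm' x), H.expNil_ad_lie (hm x)]
          exact H.expNil_ad_lie (hzn1 x) _ _
        -- Up to terms lowering by k + 3, replacing z by z + w subtracts ad w from the product,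
        -- which removes its leading part.
        have h1 := hψ' _ hauto (hzk x)
        rw [← hw] at h1
        have hw1 : w.1 x ∈ below gr (-1) := below_mono gr (by omega) (hwk x)
        have hadw := H.ad_lowering (hwk x)
        have h2 := hN.expNil_sub (A := LieAlgebra.ad ℂ g (-(z + w).1 x))
          (B := LieAlgebra.ad ℂ g (-z.1 x)) (k := k + 2)
          (H.ad_lowering (neg_mem (add_mem (hz1 x) hw1))) (H.ad_lowering (hzn1 x)) (by
            rw [← map_sub, Loop.add_apply, neg_add, add_sub_cancel_left, hneg]
            exact neg_mem hadw)
        have h3 : LieAlgebra.ad ℂ g (-(z + w).1 x) - LieAlgebra.ad ℂ g (-z.1 x) =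
            -LieAlgebra.ad ℂ g (w.1 x) := by
          rw [← map_sub, Loop.add_apply, neg_add, add_sub_cancel_left, hneg]
        rw [h3] at h2
        have h4 := lowering_mul hadw hu
        have h5 := lowering_mul h2 hu
        have h5' := lowering_anti hN.mono (show ((k : ℤ) + 2 + 1) ≤ k + 2 + 1 + 1 by omega) h5
        have h6 := add_mem (sub_mem (add_mem h1 h2) h4) h5'
        have h7 : ((k + 1 : ℕ) : ℤ) + 2 = k + 2 + 1 := by push_cast; ring
        rw [h7]
        convert h6 using 1
        simp only [E]
        noncomm_ring
  -- An endomorphism lowering by 2N + 1 or more is zero; this index gives 2N + 3.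
  obtain ⟨z, hz, hzN⟩ := key (2 * N + 1)
  have hz1 : z ∈ loopsIn (below gr (-1)) := by
    have := add_mem (loopsIn_mono h21 hz) (add_mem hm hm')
    simpa using this
  refine ⟨z, hz, LinearMap.ext fun q => Loop.ext_apply fun x => ?_⟩
  have h1 := hN.eq_zero (by push_cast; omega) (hzN x)
  have h2 := expNil_mul_neg (H.isNilpotent_ad (hz1 x))
  rw [sub_eq_zero] at h1
  have h3 : E (m.1 x) * E (m'.1 x) = E (z.1 x) := by
    calc E (m.1 x) * E (m'.1 x) = (E (z.1 x) * E (-z.1 x)) * (E (m.1 x) * E (m'.1 x)) := by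
          simp only [E, hneg]; rw [h2, one_mul]
      _ = E (z.1 x) := by rw [mul_assoc, h1, mul_one]
  rw [Module.End.mul_apply, H.expNil_br_apply hm, H.expNil_br_apply hm', H.expNil_br_apply hz1]
  exact LinearMap.congr_fun h3 (q.1 x)

end IsGradedTriple

end

end LoopReduction

/-! ### The gauge group: products, momentum map, isotropy group. -/

namespace LoopReduction

set_option linter.unusedSectionVars false

noncomputable section

theorem neg_pow_eq_zero {M : Type*} [AddCommGroup M] [Module ℂ M] {T : Module.End ℂ M} {N : ℕ}
    (hT : T ^ N = 0) : (-T) ^ N = 0 := by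
  rw [neg_pow, hT, mul_zero]

theorem expNil_sub_mem {M : Type*} [AddCommGroup M] [Module ℂ M] {T : Module.End ℂ M}
    (hT : IsNilpotent T) {W : Submodule ℂ M} (hW : ∀ w ∈ W, T w ∈ W) {x : M} (hx : T x ∈ W) :
    expNil T x - x ∈ W := by
  obtain ⟨N, hN⟩ := hT
  have hpow : ∀ k : ℕ, (T ^ (k + 1)) x ∈ W := by
    intro k
    induction k with
    | zero => simpa using hx
    | succ k ih => rw [pow_succ', Module.End.mul_apply]; exact hW _ ih
  rw [expNil_eq_sum (pow_eq_zero_of_le (Nat.le_succ N) hN), Finset.sum_range_succ']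
  simp only [LinearMap.add_apply, LinearMap.sum_apply, LinearMap.smul_apply, pow_zero,
    Module.End.one_apply, Nat.factorial_zero, Nat.cast_one, inv_one, one_smul, add_sub_cancel_right]
  exact sum_mem fun k _ => Submodule.smul_mem _ _ (hpow k)

theorem expNil_mem {M : Type*} [AddCommGroup M] [Module ℂ M] {T : Module.End ℂ M}
    (hT : IsNilpotent T) {W : Submodule ℂ M} (hW : ∀ w ∈ W, T w ∈ W) {x : M} (hx : x ∈ W) :
    expNil T x ∈ W := by
  have := add_mem (expNil_sub_mem hT hW (hW x hx)) hx
  simpa using this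

variable {g : Type*} [LieRing g] [LieAlgebra ℂ g] [Module.Finite ℂ g]

theorem adOp_add (m m' : Loop g) : adOp (m + m') = adOp m + adOp m' := by
  refine LinearMap.ext fun X => ?_
  simp only [LinearMap.add_apply, adOp_apply, map_add, smul_add, Prod.mk_add_mk, add_zero]
  congr 1
  abel

theorem adOp_smul (c : ℂ) (m : Loop g) : adOp (c • m) = c • adOp m := by
  refine LinearMap.ext fun X => ?_
  simp only [LinearMap.smul_apply, adOp_apply, map_smul, Prod.smul_mk, smul_sub, smul_zero,
    smul_comm c]

theorem adOp_neg (m : Loop g) : adOp (-m) = -adOp m := by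
  refine LinearMap.ext fun X => ?_
  change adOp (-m) X = -adOp m X
  rw [adOp_apply, adOp_apply]
  refine Prod.ext neg_zero.symm ?_
  change br (-m) X.2 - X.1 • dx (-m) = -(br m X.2 - X.1 • dx m)
  rw [map_neg, map_neg, smul_neg, LinearMap.neg_apply]
  abel

theorem pair_expNil_br {m : Loop g} (hm : IsNilpotent (br m)) (q w : Loop g) :
    pair (expNil (br m) q) w = pair q (expNil (br (-m)) w) := by
  obtain ⟨N, hN⟩ := hm
  have hN' : br (-m) ^ N = 0 := by
    rw [map_neg]
    exact neg_pow_eq_zero hN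
  have hpow : ∀ (k : ℕ) (q w : Loop g), pairing ((br m ^ k) q) w = pairing q ((br (-m) ^ k) w) := by
    intro k
    induction k with
    | zero => intro q w; rfl
    | succ k ih =>
      intro q w
      rw [pow_succ, pow_succ', Module.End.mul_apply, Module.End.mul_apply, ih, pairing_apply,
        pairing_apply, pair_br_left, map_neg, LinearMap.neg_apply, pair_neg_right]
  rw [← pairing_apply, ← pairing_apply, expNil_eq_sum hN, expNil_eq_sum hN']
  simp only [LinearMap.sum_apply, LinearMap.smul_apply, map_sum, map_smul, hpow]

namespace IsGradedTriple

variable {gr : ℤ → Submodule ℂ g} {e h f : g} (H : IsGradedTriple gr e h f)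
include H

theorem expNil_adOp_fst {m : Loop g} (hm : m ∈ loopsIn (below gr (-1))) (X : ℂ × Loop g) :
    (expNil (adOp m) X).1 = X.1 := by
  have := intertwine_expNil (H.isNilpotent_adOp hm) IsNilpotent.zero (LinearMap.fst ℂ ℂ (Loop g))
    (fun X => by simp [adOp_apply]) X
  simpa [expNil_zero] using this

theorem opEnd_expNil {m : Loop g} (hm : m ∈ loopsIn (below gr (-1))) (X : ℂ × Loop g) :
    opEnd (expNil (adOp m) X) = expNil (br m) * opEnd X * expNil (-br m) := by
  rw [intertwine_expNil (H.isNilpotent_adOp hm) (isNilpotent_adEnd (H.isNilpotent_br hm)) opEnd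
    (opEnd_adOp m), expNil_adEnd (H.isNilpotent_br hm)]

theorem expNil_adOp_zero {m : Loop g} (hm : m ∈ loopsIn (below gr (-1))) (w : Loop g) :
    expNil (adOp m) (0, w) = (0, expNil (br m) w) :=
  (intertwine_expNil (H.isNilpotent_br hm) (H.isNilpotent_adOp hm) (LinearMap.inr ℂ ℂ (Loop g))
    (fun X => by simp [adOp_apply]) w).symm

theorem expNil_neg_adOp_mul {m : Loop g} (hm : m ∈ loopsIn (below gr (-1))) :
    expNil (adOp (-m)) * expNil (adOp m) = 1 := by
  rw [adOp_neg, expNil_neg_mul (H.isNilpotent_adOp hm)]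

/-- The exponential of a loop, as a unit. -/
theorem exists_unit {m : Loop g} (hm : m ∈ loopsIn (below gr (-1))) :
    ∃ u : (Module.End ℂ (ℂ × Loop g))ˣ, (u : Module.End ℂ (ℂ × Loop g)) = expNil (adOp m) ∧
      ((u⁻¹ : (Module.End ℂ (ℂ × Loop g))ˣ) : Module.End ℂ (ℂ × Loop g)) = expNil (adOp (-m)) := by
  have h1 := H.expNil_neg_adOp_mul (neg_mem hm)
  rw [neg_neg] at h1
  exact ⟨⟨_, _, h1, H.expNil_neg_adOp_mul hm⟩, rfl, rfl⟩

theorem inv_eq_expNil {m : Loop g} (hm : m ∈ loopsIn (below gr (-1)))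
    {u : (Module.End ℂ (ℂ × Loop g))ˣ} (hu : (u : Module.End ℂ (ℂ × Loop g)) = expNil (adOp m)) :
    ((u⁻¹ : (Module.End ℂ (ℂ × Loop g))ˣ) : Module.End ℂ (ℂ × Loop g)) = expNil (adOp (-m)) := by
  obtain ⟨u', h1, h2⟩ := H.exists_unit hm
  rw [show u = u' from Units.ext (by rw [hu, h1]), h2]

theorem gaugeBy_eq (ε : ℂ) (m q : Loop g) : gaugeBy ε m q = (expNil (adOp (-m)) (ε, q)).2 := by
  rw [adOp_neg]; rfl

theorem expNil_eq_gaugeBy (ε : ℂ) {m : Loop g} (hm : m ∈ loopsIn (below gr (-1))) (q : Loop g) :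
    expNil (adOp (-m)) (ε, q) = (ε, gaugeBy ε m q) :=
  Prod.ext (H.expNil_adOp_fst (neg_mem hm) _) (H.gaugeBy_eq ε m q).symm

theorem gaugeBy_neg_gaugeBy (ε : ℂ) {m : Loop g} (hm : m ∈ loopsIn (below gr (-1))) (q : Loop g) :
    gaugeBy ε (-m) (gaugeBy ε m q) = q := by
  rw [H.gaugeBy_eq, ← H.expNil_eq_gaugeBy ε hm, ← Module.End.mul_apply,
    H.expNil_neg_adOp_mul (neg_mem hm), Module.End.one_apply]

theorem gaugeBy_zero (ε : ℂ) (q : Loop g) : gaugeBy ε 0 q = q := by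
  have h0 : adOp (0 : Loop g) = 0 := by rw [← zero_smul ℂ (0 : Loop g), adOp_smul, zero_smul]
  rw [H.gaugeBy_eq, neg_zero, h0, expNil_zero, Module.End.one_apply]

variable [LieAlgebra.IsKilling ℂ g]

/-- The product formula is known on L(g). Conjugation carries it to `opEnd`, which together with the
coefficient of ∂_x determines an operator. -/
theorem exists_adOp_bch {m m' : Loop g} (hm : m ∈ loopsIn (below gr (-1)))
    (hm' : m' ∈ loopsIn (below gr (-1))) :
    ∃ z : Loop g, z - (m + m') ∈ loopsIn (below gr (-2)) ∧
      expNil (adOp m) * expNil (adOp m') = expNil (adOp z) := by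
  obtain ⟨z, hz, hzz⟩ := H.exists_bch hm hm'
  have hz1 : z ∈ loopsIn (below gr (-1)) := by
    have := add_mem (loopsIn_mono (below_mono gr (show (-2 : ℤ) ≤ -1 by norm_num)) hz)
      (add_mem hm hm')
    simpa using this
  refine ⟨z, hz, LinearMap.ext fun X => eq_of_opEnd ?_ ?_⟩
  · rw [Module.End.mul_apply, H.expNil_adOp_fst hm, H.expNil_adOp_fst hm', H.expNil_adOp_fst hz1]
  · have hinv : expNil (-br m') * expNil (-br m) = expNil (-br z) := by
      have e1 := expNil_neg_mul (H.isNilpotent_br hm)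
      have e2 := expNil_neg_mul (H.isNilpotent_br hm')
      have e3 := expNil_mul_neg (H.isNilpotent_br hz1)
      calc expNil (-br m') * expNil (-br m)
          = expNil (-br m') * expNil (-br m) * (expNil (br z) * expNil (-br z)) := by
            rw [e3, mul_one]
        _ = expNil (-br m') * (expNil (-br m) * expNil (br m)) * expNil (br m') *
            expNil (-br z) := by rw [← hzz]; noncomm_ring
        _ = expNil (-br z) := by rw [e1, mul_one, e2, one_mul]
    rw [Module.End.mul_apply, H.opEnd_expNil hm, H.opEnd_expNil hm', H.opEnd_expNil hz1, ← hzz,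
      ← hinv]
    noncomm_ring

/-- The Baker-Campbell-Hausdorff correction to m + m' has degree at most -2, hence stays in any W
containing g_{≤-2}; products of exponentials are therefore single exponentials. -/
theorem mem_adjointGroup {W : Submodule ℂ g} (h1 : below gr (-2) ≤ W) (h2 : W ≤ below gr (-1))
    {u : (Module.End ℂ (ℂ × Loop g))ˣ} :
    u ∈ adjointGroup W ↔
      ∃ m ∈ loopsIn W, (u : Module.End ℂ (ℂ × Loop g)) = expNil (adOp m) := by
  refine ⟨fun hu => ?_, fun hu => Subgroup.subset_closure hu⟩
  have h2' := loopsIn_mono h2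
  refine Subgroup.closure_induction (p := fun (u : (Module.End ℂ (ℂ × Loop g))ˣ) _ => ∃ m ∈ loopsIn W,
    (u : Module.End ℂ (ℂ × Loop g)) = expNil (adOp m)) (fun u hu => hu) ?_ ?_ ?_ hu
  · refine ⟨0, zero_mem _, ?_⟩
    have h0 : adOp (0 : Loop g) = 0 := by rw [← zero_smul ℂ (0 : Loop g), adOp_smul, zero_smul]
    rw [h0, expNil_zero]; rfl
  · rintro u v - - ⟨m, hm, hu⟩ ⟨m', hm', hv⟩
    obtain ⟨z, hz, hzz⟩ := H.exists_adOp_bch (h2' hm) (h2' hm')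
    refine ⟨z, ?_, by rw [Units.val_mul, hu, hv, hzz]⟩
    have := add_mem (loopsIn_mono h1 hz) (add_mem hm hm')
    simpa using this
  · rintro u - ⟨m, hm, hu⟩
    exact ⟨-m, neg_mem hm, H.inv_eq_expNil (h2' hm) hu⟩

theorem exists_act_iff {W : Submodule ℂ g} (h1 : below gr (-2) ≤ W) (h2 : W ≤ below gr (-1))
    (ε : ℂ) {s t : Loop g} :
    (∃ u ∈ adjointGroup W, t = act ε u s) ↔ ∃ m ∈ loopsIn W, t = gaugeBy ε m s := by
  constructor
  · rintro ⟨u, hu, rfl⟩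
    obtain ⟨m, hm, hum⟩ := (H.mem_adjointGroup h1 h2).1 hu
    refine ⟨-m, neg_mem hm, ?_⟩
    rw [H.gaugeBy_eq, neg_neg, ← hum]; rfl
  · rintro ⟨m, hm, rfl⟩
    obtain ⟨u, hu, -⟩ := H.exists_unit (neg_mem (loopsIn_mono h2 hm))
    refine ⟨u, (H.mem_adjointGroup h1 h2).2 ⟨-m, neg_mem hm, hu⟩, ?_⟩
    rw [H.gaugeBy_eq, ← hu]; rfl

theorem gaugeBy_gaugeBy {W : Submodule ℂ g} (h1 : below gr (-2) ≤ W) (h2 : W ≤ below gr (-1))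
    (ε : ℂ) {m m' : Loop g} (hm : m ∈ loopsIn W) (hm' : m' ∈ loopsIn W) :
    ∃ z ∈ loopsIn W, ∀ q, gaugeBy ε m (gaugeBy ε m' q) = gaugeBy ε z q := by
  have h2' := loopsIn_mono h2
  obtain ⟨z, hz, hzz⟩ := H.exists_adOp_bch (neg_mem (h2' hm)) (neg_mem (h2' hm'))
  refine ⟨-z, neg_mem ?_, fun q => ?_⟩
  · have := add_mem (loopsIn_mono h1 hz) (add_mem (neg_mem hm) (neg_mem hm'))
    simpa only [sub_add_cancel] using this
  · rw [H.gaugeBy_eq, ← H.expNil_eq_gaugeBy ε (h2' hm'), H.gaugeBy_eq, neg_neg, ← hzz]; rfl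

/-- Equivariance of the momentum map. -/
theorem momentum_act {n : Submodule ℂ g} (h1 : below gr (-2) ≤ n) (h2 : n ≤ below gr (-1))
    (hn : ∀ x ∈ n, ∀ y ∈ n, ⁅x, y⁆ ∈ n) (ε : ℂ) {u : (Module.End ℂ (ℂ × Loop g))ˣ}
    (hu : u ∈ adjointGroup n) (q : Loop g) (w : loopsIn n) :
    ∃ w' : loopsIn n, (w' : Loop g) = adAct u⁻¹ w ∧
      momentum n (act ε u q) w = momentum n q w' := by
  obtain ⟨m, hm, hum⟩ := (H.mem_adjointGroup h1 h2).1 hu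
  have hm' := loopsIn_mono h2 hm
  have hinv := H.inv_eq_expNil hm' hum
  have hw' : adAct u⁻¹ (w : Loop g) = expNil (br (-m)) w := by
    unfold adAct
    rw [hinv, H.expNil_adOp_zero (neg_mem hm')]
  refine ⟨⟨adAct u⁻¹ (w : Loop g), ?_⟩, rfl, ?_⟩
  · rw [hw']
    exact expNil_mem (W := loopsIn n) (H.isNilpotent_br (neg_mem hm'))
      (fun v hv x => hn _ (neg_mem (hm x)) _ (hv x)) w.2
  · change pair (act ε u q) w = pair q (adAct u⁻¹ (w : Loop g))
    rw [hw', ← pair_expNil_br (H.isNilpotent_br hm')]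
    -- The gauge action differs from exp(ad m)q only by terms built from m'. They have negative
    -- degree, so they pair to zero with L(n).
    have h3 : act ε u q - expNil (br m) q ∈ loopsIn (below gr (-1)) := by
      have e1 : ((ε, q) : ℂ × Loop g) = (ε, 0) + (0, q) := by simp
      have e2 : act ε u q = (expNil (adOp m) (ε, 0)).2 + expNil (br m) q := by
        unfold act
        rw [hum, e1, map_add, H.expNil_adOp_zero hm']; rfl
      rw [e2, add_sub_cancel_right]
      have h4 := expNil_sub_mem (H.isNilpotent_adOp hm')
        (W := (⊥ : Submodule ℂ ℂ).prod (loopsIn (below gr (-1)))) (x := (ε, 0)) ?_ ?_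
      · simpa using h4.2
      · rintro w ⟨hw, hw'⟩
        have hw0 : w.1 = 0 := hw
        rw [adOp_apply, hw0, zero_smul, sub_zero]
        exact ⟨rfl, fun x => below_mono gr (by norm_num) (H.lie_mem_below (hm' x) (hw' x))⟩
      · rw [adOp_apply, map_zero, zero_sub]
        exact ⟨rfl, neg_mem (Submodule.smul_mem _ _ (dx_mem hm'))⟩
    have h5 : pair (act ε u q - expNil (br m) q) w = 0 :=
      pair_eq_zero_of_killing fun x => H.killing_below (h3 x) (h2 (w.2 x)) (by norm_num)
    rw [pair_sub_left, sub_eq_zero] at h5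
    exact h5

theorem below_le_lowerPart {l : Submodule ℂ g} (hl : l ≤ gr (-1)) :
    below gr (-2) ≤ lowerPart gr l := fun x hx => (H.mem_lowerPart hl).2
  ⟨below_mono gr (by norm_num) hx, by
    rw [H.mem_below_iff.1 hx (-1) (by norm_num)]; exact zero_mem _⟩

/-- The isotropy group of `e`. -/
theorem isotropy_eq {l : Submodule ℂ g} (hl : l ≤ gr (-1))
    (hl_iso : ∀ x ∈ l, ∀ y ∈ l, killingForm ℂ g e ⁅x, y⁆ = 0) :
    isotropy (lowerPart gr (coisotropic gr e l)) e =
      (adjointGroup (lowerPart gr l) : Set (Module.End ℂ (ℂ × Loop g))ˣ) := by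
  set n := lowerPart gr (coisotropic gr e l) with hn
  have hc := H.coisotropic_le l
  have h1 : below gr (-2) ≤ n := H.below_le_lowerPart hc
  have h2 : n ≤ below gr (-1) := H.lowerPart_le hc
  have h1' : below gr (-2) ≤ lowerPart gr l := H.below_le_lowerPart hl
  have h2' : lowerPart gr l ≤ below gr (-1) := H.lowerPart_le hl
  have hle : lowerPart gr l ≤ n := H.lowerPart_mono fun x hx => ⟨hl hx, hl_iso x hx⟩
  -- From second order on, exp(-ad m)w has degree at most -3 and is orthogonal to e, so only the
  -- linear term in m matters.
  have key : ∀ {m}, m ∈ loopsIn (below gr (-1)) → ∀ {u : (Module.End ℂ (ℂ × Loop g))ˣ},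
      (u : Module.End ℂ (ℂ × Loop g)) = expNil (adOp m) → ∀ w ∈ loopsIn n,
      pair (constLoop e) (adAct u⁻¹ w) = pair (constLoop e) w - pair (constLoop e) (br m w) := by
    intro m hm u hu w hw
    have hw' : adAct u⁻¹ (w : Loop g) = expNil (br (-m)) w := by
      unfold adAct
      rw [H.inv_eq_expNil hm hu, H.expNil_adOp_zero (neg_mem hm)]
    obtain ⟨N, -, hN, -⟩ := H.exists_filtration
    have h3 := hN.expNil_sub_one (H.br_lowering (neg_mem hm)) (-1) w (loopsIn_mono h2 hw)
    have h4 : pair (constLoop e) ((expNil (br (-m)) - 1 - br (-m)) w) = 0 :=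
      pair_eq_zero_of_killing fun x => H.killing_below (gr_le_below gr le_rfl H.e_mem) (h3 x)
        (by norm_num)
    have h5 : (expNil (br (-m)) - 1 - br (-m)) w = expNil (br (-m)) w - w - br (-m) w := rfl
    rw [h5, pair_sub_right, pair_sub_right, map_neg, LinearMap.neg_apply, pair_neg_right] at h4
    rw [hw', map_neg]
    linear_combination h4
  ext u
  constructor
  · rintro ⟨hu, hu'⟩
    obtain ⟨m, hm, hum⟩ := (H.mem_adjointGroup h1 h2).1 hu
    refine (H.mem_adjointGroup h1' h2').2 ⟨m, fun x => ?_, hum⟩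
    -- Invariance of e forces the component of m in degree -1 to be orthogonal to l', hence to lie
    -- in l'' = l.
    refine (H.mem_lowerPart hl).2 ⟨h2 (hm x), H.mem_of_coisotropic hl (H.pr_mem _ _) fun y hy => ?_⟩
    rw [H.killing_e _ (hc hy)]
    have h3 : ∀ w ∈ loopsIn n, pair (br (constLoop e) m) w = 0 := by
      intro w hw
      have := key (loopsIn_mono h2 hm) hum w hw
      rw [hu' w hw] at this
      rw [pair_br]
      linear_combination this
    have h4 := killing_eq_zero_of_pair h3 x (y := y) ((H.mem_lowerPart hc).2
      ⟨gr_le_below gr le_rfl (hc hy), by rw [H.pr_of_mem (hc hy)]; exact hy⟩)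
    rw [br_apply, constLoop_apply] at h4
    rw [← h4]
    exact (LieModule.traceForm_apply_lie_apply ℂ g g e (m.1 x) y).symm
  · intro hu
    obtain ⟨m, hm, hum⟩ := (H.mem_adjointGroup h1' h2').1 hu
    refine ⟨(H.mem_adjointGroup h1 h2).2 ⟨m, loopsIn_mono hle hm, hum⟩, fun w hw => ?_⟩
    rw [key (loopsIn_mono h2' hm) hum w hw, sub_eq_self]
    refine pair_eq_zero_of_killing fun x => ?_
    rw [constLoop_apply, br_apply]
    have e1 := (H.mem_lowerPart hl).1 (hm x)
    have e2 := (H.mem_lowerPart hc).1 (hw x)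
    have e3 : w.1 x = H.pr (-1) (w.1 x) + (w.1 x - H.pr (-1) (w.1 x)) := by abel
    have e4 : w.1 x - H.pr (-1) (w.1 x) ∈ below gr (-2) := by
      refine H.mem_below_iff.2 fun i hi => ?_
      rw [map_sub]
      by_cases hi1 : i = -1
      · subst hi1
        rw [H.pr_of_mem (H.pr_mem _ _), sub_self]
      · rw [H.mem_below_iff.1 e2.1 i (by omega), H.pr_of_mem_ne (H.pr_mem (-1) _) (Ne.symm hi1),
          sub_zero]
    rw [e3, lie_add, map_add, H.killing_below (gr_le_below gr le_rfl H.e_mem)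
      (H.lie_mem_below e1.1 e4) (by norm_num), add_zero, ← H.killing_e _ (hc e2.2),
      ← lie_skew, map_neg, e2.2.2 _ e1.2, neg_zero]

end IsGradedTriple

end

end LoopReduction

/-! ### Differentiation along smooth paths and along gauge flows. -/

namespace LoopReduction

set_option linter.unusedSectionVars false

noncomputable section

variable {g : Type*} [LieRing g] [LieAlgebra ℂ g] [Module.Finite ℂ g]

/-! ### Velocities -/

theorem IsJetCurve.hasDerivAt_form {𝕜 : Type} [RCLike 𝕜] [NormedAlgebra 𝕜 ℂ]
    {γ γ' : 𝕜 → Loop g} (hγ : IsJetCurve γ γ') (φ : g →ₗ[ℂ] ℂ) (x : ℝ) (τ : 𝕜) :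
    HasDerivAt (fun τ => φ ((γ τ).1 x)) (φ ((γ' τ).1 x)) τ := by
  simpa using (hγ φ).hasDerivAt 0 τ x

theorem IsJetCurve.isVelocity {γ γ' : ℝ → Loop g} (hγ : IsJetCurve γ γ') (τ : ℝ) :
    IsVelocity γ τ (γ' τ) := fun φ x => hγ.hasDerivAt_form φ x τ

theorem isVelocity_unique {γ : ℝ → Loop g} {τ : ℝ} {v w : Loop g} (hv : IsVelocity γ τ v)
    (hw : IsVelocity γ τ w) : v = w :=
  Loop.ext_apply fun x => eq_of_forall_form fun φ => (hv φ x).unique (hw φ x)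

theorem IsJetCurve.unique {𝕜 : Type} [RCLike 𝕜] [NormedAlgebra 𝕜 ℂ] {γ γ' γ'' : 𝕜 → Loop g}
    (hγ : IsJetCurve γ γ') (hγ' : IsJetCurve γ γ'') (τ : 𝕜) : γ' τ = γ'' τ :=
  Loop.ext_apply fun x => eq_of_forall_form fun φ =>
    (hγ.hasDerivAt_form φ x τ).unique (hγ'.hasDerivAt_form φ x τ)

theorem IsJetCurve.eq_of_zero {γ γ' : ℝ → Loop g} (hγ : IsJetCurve γ γ') (h : ∀ τ, γ' τ = 0)
    (τ τ' : ℝ) : γ τ = γ τ' := by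
  refine Loop.ext_apply fun x => eq_of_forall_form fun φ => ?_
  refine is_const_of_deriv_eq_zero (f := fun τ => φ ((γ τ).1 x))
    (fun τ => (hγ.hasDerivAt_form φ x τ).differentiableAt) (fun τ => ?_) τ τ'
  rw [(hγ.hasDerivAt_form φ x τ).deriv, h]
  simp

/-! ### Smooth paths of loops -/

section Smooth

variable {E : Type*} [NormedAddCommGroup E] [NormedSpace ℝ E]

theorem contDiff_fderiv_apply {f : E → ℂ} (hf : ContDiff ℝ ∞ f) (v : E) :
    ContDiff ℝ ∞ fun p => fderiv ℝ f p v :=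
  (hf.fderiv_right (m := ∞) (by simp)).clm_apply contDiff_const

theorem fderiv_apply_comm {f : E → ℂ} (hf : ContDiff ℝ ∞ f) (v w p : E) :
    fderiv ℝ (fun p => fderiv ℝ f p v) p w = fderiv ℝ (fun p => fderiv ℝ f p w) p v := by
  have hd : DifferentiableAt ℝ (fderiv ℝ f) p :=
    ((hf.fderiv_right (m := ∞) (by simp)).differentiable (by simp)).differentiableAt
  have hs : IsSymmSndFDerivAt ℝ f p := by
    refine hf.contDiffAt.isSymmSndFDerivAt ?_
    simp only [minSmoothness_of_isRCLikeNormedField]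
    exact WithTop.coe_le_coe.2 le_top
  have key : ∀ u z : E, fderiv ℝ (fun p => fderiv ℝ f p u) p z = fderiv ℝ (fderiv ℝ f) p z u := by
    intro u z
    rw [fderiv_clm_apply hd (differentiableAt_const u)]
    simp
  rw [key, key, hs]

theorem hasDerivAt_slice_fst {f : ℝ × ℝ → ℂ} (hf : ContDiff ℝ ∞ f) (τ x : ℝ) :
    HasDerivAt (fun τ => f (τ, x)) (fderiv ℝ f (τ, x) (1, 0)) τ := by
  have h1 : HasFDerivAt f (fderiv ℝ f (τ, x)) (τ, x) :=
    (hf.differentiable (by simp)).differentiableAt.hasFDerivAt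
  exact h1.comp_hasDerivAt τ ((hasDerivAt_id τ).prodMk (hasDerivAt_const τ x))

theorem hasDerivAt_slice_snd {f : ℝ × ℝ → ℂ} (hf : ContDiff ℝ ∞ f) (τ x : ℝ) :
    HasDerivAt (fun x => f (τ, x)) (fderiv ℝ f (τ, x) (0, 1)) x := by
  have h1 : HasFDerivAt f (fderiv ℝ f (τ, x)) (τ, x) :=
    (hf.differentiable (by simp)).differentiableAt.hasFDerivAt
  exact h1.comp_hasDerivAt x ((hasDerivAt_const x τ).prodMk (hasDerivAt_id x))

/-- Mixed partial derivatives commute, so the τ-derivative of the r-th x-derivative is the r-th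
x-derivative of the velocity. -/
theorem exists_iteratedDeriv_slice {f : ℝ × ℝ → ℂ} (hf : ContDiff ℝ ∞ f) (r : ℕ) :
    ∃ F : ℝ × ℝ → ℂ, ContDiff ℝ ∞ F ∧
      (∀ τ x, iteratedDeriv r (fun x => f (τ, x)) x = F (τ, x)) ∧
      ∀ τ x, iteratedDeriv r (fun x => fderiv ℝ f (τ, x) (1, 0)) x =
        fderiv ℝ F (τ, x) (1, 0) := by
  induction r with
  | zero => exact ⟨f, hf, fun τ x => by simp, fun τ x => by simp⟩
  | succ r ih =>
    obtain ⟨F, hF, h1, h2⟩ := ih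
    refine ⟨fun p => fderiv ℝ F p (0, 1), contDiff_fderiv_apply hF _, fun τ x => ?_, fun τ x => ?_⟩
    · rw [iteratedDeriv_succ, funext (h1 τ), (hasDerivAt_slice_snd hF τ x).deriv]
    · rw [iteratedDeriv_succ, funext (h2 τ),
        (hasDerivAt_slice_snd (contDiff_fderiv_apply hF (1, 0)) τ x).deriv, fderiv_apply_comm hF]

end Smooth

/-- The joint smoothness required of a `TangentPath` is what makes the chain rule for differential
polynomials available along it. -/
theorem isJetCurve_of_contDiff {γ γ' : ℝ → Loop g}
    (hγ : ∀ φ : g →ₗ[ℂ] ℂ, ContDiff ℝ ∞ fun p : ℝ × ℝ => φ ((γ p.1).1 p.2))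
    (hγ' : ∀ τ, IsVelocity γ τ (γ' τ)) : IsJetCurve γ γ' := by
  intro φ
  have h0 : ∀ τ, (fun x => φ ((γ' τ).1 x)) =
      fun x => fderiv ℝ (fun p : ℝ × ℝ => φ ((γ p.1).1 p.2)) (τ, x) (1, 0) := fun τ =>
    funext fun x => (hγ' τ φ x).unique (hasDerivAt_slice_fst (hγ φ) τ x)
  refine ⟨fun τ => form_mem (γ τ) φ, fun τ => form_mem (γ' τ) φ, fun r τ x => ?_, fun r => ?_,
    fun r => ?_⟩
  all_goals obtain ⟨F, hF, h1, h2⟩ := exists_iteratedDeriv_slice (hγ φ) r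
  · simp only [h0, h2]
    simpa only [← h1] using hasDerivAt_slice_fst hF τ x
  · have h3 : (fun p : ℝ × ℝ => iteratedDeriv r (fun x => φ ((γ p.1).1 x)) p.2) = F :=
      funext fun p => h1 p.1 p.2
    rw [h3]
    exact hF.continuous
  · have h3 : (fun p : ℝ × ℝ => iteratedDeriv r (fun x => φ ((γ' p.1).1 x)) p.2) =
        fun p => fderiv ℝ F p (1, 0) := funext fun p => by
      rw [h0]
      exact h2 p.1 p.2
    rw [h3]
    exact (contDiff_fderiv_apply hF (1, 0)).continuous

/-! ### Gauge flows -/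

namespace IsGradedTriple

variable {gr : ℤ → Submodule ℂ g} {e h f : g} (H : IsGradedTriple gr e h f)
include H

/-- Since ad m is nilpotent, the flow is polynomial in c; the second formula says that its
c-derivative is [m·q, m] + εm', taken at cm. -/
theorem exists_gaugeBy_eq_sum (ε : ℂ) {m : Loop g} (hm : m ∈ loopsIn (below gr (-1)))
    (q : Loop g) : ∃ (N : ℕ) (C : ℕ → Loop g),
      (∀ c : ℂ, gaugeBy ε (c • m) q = ∑ k ∈ Finset.range N, c ^ k • C k) ∧
      ∀ c : ℂ, ∑ k ∈ Finset.range N, ((k : ℂ) * c ^ (k - 1)) • C k =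
        br (gaugeBy ε (c • m) q) m + ε • dx m := by
  obtain ⟨N, hN⟩ := H.isNilpotent_adOp (neg_mem hm)
  set T := adOp (-m) with hT
  have hpow : ∀ (c : ℂ) (k : ℕ), adOp (-(c • m)) ^ k = c ^ k • T ^ k := by
    intro c k
    have h1 : -(c • m) = c • -m := Loop.ext_apply fun x => by simp
    rw [h1, adOp_smul, smul_pow]
  have hexp : ∀ (c : ℂ) (n : ℕ), N ≤ n → expNil (adOp (-(c • m))) (ε, q) =
      ∑ k ∈ Finset.range n, c ^ k • ((k.factorial : ℂ)⁻¹ • (T ^ k) (ε, q)) := by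
    intro c n hn
    rw [expNil_eq_sum (N := n) (by rw [hpow, pow_eq_zero_of_le hn hN, smul_zero]),
      LinearMap.sum_apply]
    refine Finset.sum_congr rfl fun k _ => ?_
    rw [hpow, LinearMap.smul_apply, LinearMap.smul_apply, smul_comm]
  have hsnd : ∀ (n : ℕ) (c : ℕ → ℂ) (Y : ℕ → ℂ × Loop g),
      (∑ k ∈ Finset.range n, c k • Y k).2 = ∑ k ∈ Finset.range n, c k • (Y k).2 := by
    intro n c Y
    rw [Prod.snd_sum]; rfl
  refine ⟨N + 1, fun k => ((k.factorial : ℂ)⁻¹ • (T ^ k) (ε, q)).2, fun c => ?_, fun c => ?_⟩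
  · rw [H.gaugeBy_eq, hexp c (N + 1) (Nat.le_succ N), hsnd]
  -- Termwise differentiation of the exponential series is multiplication by T. The term k = 0 has
  -- coefficient zero, so the truncated exponent k - 1 does no harm.
  · have h1 : ∑ k ∈ Finset.range (N + 1), ((k : ℂ) * c ^ (k - 1)) •
        ((k.factorial : ℂ)⁻¹ • (T ^ k) (ε, q)) = T (expNil (adOp (-(c • m))) (ε, q)) := by
      rw [hexp c N le_rfl, map_sum, Finset.sum_range_succ']
      simp only [Nat.cast_zero, zero_mul, zero_smul, add_zero, map_smul]
      refine Finset.sum_congr rfl fun k _ => ?_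
      rw [pow_succ', Module.End.mul_apply, Nat.add_sub_cancel, smul_smul, smul_smul]
      congr 1
      have : (((k + 1 : ℕ) : ℂ)) ≠ 0 := by exact_mod_cast Nat.succ_ne_zero k
      rw [Nat.factorial_succ]
      push_cast at this ⊢
      field_simp
    have h2 := congrArg Prod.snd h1
    rw [hsnd] at h2
    rw [h2, H.expNil_eq_gaugeBy ε (Submodule.smul_mem _ c hm), hT, adOp_apply]
    simp only [map_neg, LinearMap.neg_apply, smul_neg, sub_neg_eq_add, br_skew _ m]

theorem isJetCurve_gaugeBy {ε : ℂ} (hε : ε ≠ 0) {m : Loop g} (hm : m ∈ loopsIn (below gr (-1)))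
    (q : Loop g) : IsJetCurve (fun τ : ℝ => gaugeBy ε ((τ : ℂ) • m) q)
      (fun τ => ε • P₂ ε (gaugeBy ε ((τ : ℂ) • m) q) m) := by
  obtain ⟨N, C, h1, h2⟩ := H.exists_gaugeBy_eq_sum ε hm q
  have h3 : ∀ τ : ℝ, ε • P₂ ε (gaugeBy ε ((τ : ℂ) • m) q) m =
      ∑ k ∈ Finset.range N, ((k : ℂ) * (τ : ℂ) ^ (k - 1)) • C k := by
    intro τ
    rw [h2, P₂_apply hε, smul_add, smul_smul, mul_inv_cancel₀ hε, one_smul, add_comm]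
  rw [funext h3]
  simp only [h1]
  refine IsJetCurve.sum _ fun k _ => IsJetCurve.scalar (fun τ => ?_) ?_ (C k)
  · simpa using (HasDerivAt.ofReal_comp (hasDerivAt_id τ)).fun_pow k
  · exact continuous_const.mul (Complex.continuous_ofReal.pow _)

theorem contDiff_gaugeBy (ε : ℂ) {m : Loop g} (hm : m ∈ loopsIn (below gr (-1)))
    (q : Loop g) (φ : g →ₗ[ℂ] ℂ) :
    ContDiff ℝ ∞ fun p : ℝ × ℝ => φ ((gaugeBy ε ((p.1 : ℂ) • m) q).1 p.2) := by
  obtain ⟨N, C, h1, -⟩ := H.exists_gaugeBy_eq_sum ε hm q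
  simp only [h1, Loop.sum_apply, Loop.smul_apply, map_sum, map_smul, smul_eq_mul]
  refine ContDiff.sum fun k _ => ContDiff.mul ?_ ?_
  · exact (Complex.ofRealCLM.contDiff.comp contDiff_fst).pow k
  · exact ((C k).2.1 φ).comp contDiff_snd

theorem isVelocity_gaugeBy {ε : ℂ} (hε : ε ≠ 0) {m : Loop g} (hm : m ∈ loopsIn (below gr (-1)))
    (q : Loop g) : IsVelocity (fun τ : ℝ => gaugeBy ε ((τ : ℂ) • m) q) 0 (ε • P₂ ε q m) := by
  have := (H.isJetCurve_gaugeBy hε hm q).isVelocity 0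
  rwa [Complex.ofReal_zero, zero_smul, H.gaugeBy_zero] at this

theorem dsReduction_D {ε : ℂ} (hε : ε ≠ 0) {n : Submodule ℂ g} (hn : n ≤ below gr (-1))
    (q : Loop g) : (dsReduction ε n e).D q = (loopsIn n).map (P₂ ε q) := by
  refine le_antisymm (Submodule.span_le.2 ?_) ?_
  · rintro v ⟨m, hm, hv⟩
    rw [isVelocity_unique hv (H.isVelocity_gaugeBy hε (loopsIn_mono hn hm) q)]
    exact Submodule.smul_mem _ _ (Submodule.mem_map_of_mem hm)
  · rintro - ⟨m, hm, rfl⟩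
    refine Submodule.subset_span ⟨ε⁻¹ • m, Submodule.smul_mem _ _ hm, ?_⟩
    have := H.isVelocity_gaugeBy hε (loopsIn_mono hn (Submodule.smul_mem _ ε⁻¹ hm)) q
    rwa [map_smul, smul_smul, mul_inv_cancel₀ hε, one_smul] at this

/-- The gauge action is Hamiltonian for the whole pencil. -/
theorem isVelocity_momentum {ε : ℂ} (hε : ε ≠ 0) {n : Submodule ℂ g} (hn : n ≤ below gr (-1))
    [LieAlgebra.IsKilling ℂ g] {a : g} (ha : ∀ x ∈ n, ⁅a, x⁆ = 0) (m : loopsIn n) (q : Loop g)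
    (lam : ℂ) : IsVelocity (fun t : ℝ => gaugeBy ε ((t : ℂ) • (m : Loop g)) q) 0
      (pencil ε a lam q (grad id (fun r => ε * momentum n r m) q)) := by
  have hg : grad id (fun r => ε * momentum n r m) q = ε • (m : Loop g) :=
    grad_eq (hasGrad_pair ε (m : Loop g) q)
  rw [hg, map_smul,
    pencil_eq_P₂ a lam q fun x => ha _ (m.2 x)]
  exact H.isVelocity_gaugeBy hε (loopsIn_mono hn m.2) q

end IsGradedTriple

end

end LoopReduction

/-! ### Gauge fixing by contraction of the degree filtration. -/

namespace LoopReduction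

set_option linter.unusedSectionVars false

noncomputable section

/-- A map that contracts a finite filtration has a unique fixed point, reached after finitely many
iterations. -/
theorem IsFiniteFiltration.fixedPoint {M : Type*} [AddCommGroup M] [Module ℂ M]
    {Fil : ℤ → Submodule ℂ M} {N : ℕ} (hF : IsFiniteFiltration Fil N) {T : M → M}
    (h0 : ∀ m ∈ Fil (-1), T m ∈ Fil (-1))
    (hT : ∀ k : ℕ, ∀ m ∈ Fil (-1), ∀ m' ∈ Fil (-1), m - m' ∈ Fil (-(k + 1)) →
      T m - T m' ∈ Fil (-(k + 2))) :
    T (T^[N + 1] 0) = T^[N + 1] 0 ∧ ∀ m ∈ Fil (-1), T m = m → m = T^[N + 1] 0 := by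
  have hbot : ∀ m m', m - m' ∈ Fil (-((N : ℕ) + 1)) → m = m' := by
    intro m m' h
    rw [show (-((N : ℤ) + 1)) = -N - 1 by ring, hF.bot] at h
    exact sub_eq_zero.1 h
  have hit : ∀ j : ℕ, T^[j] 0 ∈ Fil (-1) := by
    intro j
    induction j with
    | zero => exact zero_mem _
    | succ j ih => rw [Function.iterate_succ_apply']; exact h0 _ ih
  have hstep : ∀ j : ℕ, T^[j + 1] 0 - T^[j] 0 ∈ Fil (-(j + 1)) := by
    intro j
    induction j with
    | zero => simpa using h0 0 (zero_mem _)
    | succ j ih =>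
      have := hT j _ (hit (j + 1)) _ (hit j) ih
      rw [← Function.iterate_succ_apply' T, ← Function.iterate_succ_apply' T] at this
      convert this using 2
      push_cast; ring
  have hfix : T (T^[N + 1] 0) = T^[N + 1] 0 := by
    have h1 := hbot _ _ (hstep N)
    rw [Function.iterate_succ_apply'] at h1
    rw [Function.iterate_succ_apply', h1, h1]
  refine ⟨hfix, fun m hm hTm => hbot _ _ ?_⟩
  have : ∀ j : ℕ, m - T^[N + 1] 0 ∈ Fil (-(j + 1)) := by
    intro j
    induction j with
    | zero => simpa using sub_mem hm (hit (N + 1))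
    | succ j ih =>
      have := hT j _ hm _ (hit (N + 1)) ih
      rw [hTm, hfix] at this
      convert this using 2
      push_cast; ring
  exact this N

variable {g : Type*} [LieRing g] [LieAlgebra ℂ g] [Module.Finite ℂ g]

namespace IsGradedTriple

variable {gr : ℤ → Submodule ℂ g} {e h f : g} (H : IsGradedTriple gr e h f)
include H

/-- The exponential series stops at an order depending only on the grading, and each term is built
from m, s and derivatives by brackets. -/
theorem isDiffMap_gaugeBy {X : Type*} {𝓐 : Subalgebra ℂ (X → ℝ → ℂ)} (h𝓐 : IsDiffAlg 𝓐) (ε : ℂ)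
    {m s : X → Loop g} (hmU : ∀ q, m q ∈ loopsIn (below gr (-1))) (hm : IsDiffMap 𝓐 m)
    (hs : IsDiffMap 𝓐 s) : IsDiffMap 𝓐 fun q => gaugeBy ε (m q) (s q) := by
  obtain ⟨N, -, -, hN⟩ := H.exists_filtration
  have hmn : IsDiffMap 𝓐 fun q => -m q := by
    have := hm.const_smul (-1)
    have h1 : (fun q => -m q) = fun q => (-1 : ℂ) • m q :=
      funext fun q => Loop.ext_apply fun x => by simp
    rwa [h1]
  have hpow : ∀ k : ℕ, ∃ (c : ℂ) (w : X → Loop g), IsDiffMap 𝓐 w ∧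
      ∀ q, (adOp (-m q) ^ k) (ε, s q) = (c, w q) := by
    intro k
    induction k with
    | zero => exact ⟨ε, s, hs, fun q => rfl⟩
    | succ k ih =>
      obtain ⟨c, w, hw, hk⟩ := ih
      refine ⟨0, _, (hmn.br hw).sub ((hmn.dx h𝓐).const_smul c), fun q => ?_⟩
      rw [pow_succ', Module.End.mul_apply, hk, adOp_apply]
  choose c w hw hk using hpow
  have hsum := IsDiffMap.sum (Finset.range (2 * N + 2))
    (T := fun k q => ((k.factorial : ℂ)⁻¹) • w k q) fun k _ => (hw k).const_smul _
  convert hsum using 2 with q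
  rw [H.gaugeBy_eq, expNil_eq_sum (hN.pow_eq_zero (H.adOp_lowering (neg_mem (hmU q)))),
    LinearMap.sum_apply, Prod.snd_sum]
  refine Finset.sum_congr rfl fun k _ => ?_
  rw [LinearMap.smul_apply, hk]; rfl

/-- Only e has degree 2; q - e, the derivative m' and all higher-order terms contribute in lower
degree. So the variation of m·q is [e, m - m'] up to one degree less. -/
theorem gaugeBy_sub_gaugeBy_mem (ε : ℂ) {q : Loop g}
    (hq : q - constLoop e ∈ loopsIn (below gr 1)) (k : ℕ) {m m' : Loop g}
    (hm : m ∈ loopsIn (below gr (-1))) (hm' : m' ∈ loopsIn (below gr (-1)))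
    (hmm : m - m' ∈ loopsIn (below gr (-(k + 1)))) :
    gaugeBy ε m q - gaugeBy ε m' q - br (constLoop e) (m - m') ∈ loopsIn (below gr (-k)) := by
  obtain ⟨N, -, -, hN⟩ := H.exists_filtration
  have hsub : adOp (-m) - adOp (-m') = adOp (-(m - m')) := by
    rw [adOp_neg, adOp_neg, adOp_neg, sub_eq_add_neg m m', adOp_add, adOp_neg]
    abel
  have h1 := hN.expNil_sub (H.adOp_lowering (neg_mem hm)) (H.adOp_lowering (neg_mem hm'))
    (k := k + 1) (by rw [hsub]; exact H.adOp_lowering (neg_mem hmm))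
  have hq2 : q ∈ loopsIn (below gr 2) := by
    have h2 : constLoop e ∈ loopsIn (below gr 2) := fun x => gr_le_below gr le_rfl H.e_mem
    have := add_mem (loopsIn_mono (below_mono gr (by norm_num)) hq) h2
    simpa using this
  have h2 := (h1 2 (ε, q) ⟨fun h => absurd h (lt_irrefl _), hq2⟩).2
  have h3 : ((expNil (adOp (-m)) - expNil (adOp (-m')) - (adOp (-m) - adOp (-m'))) (ε, q)).2 =
      gaugeBy ε m q - gaugeBy ε m' q - (br (-(m - m')) q - ε • dx (-(m - m'))) := by
    have h4 : (adOp (-(m - m')) (ε, q)).2 = br (-(m - m')) q - ε • dx (-(m - m')) := by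
      rw [adOp_apply]
    rw [hsub, ← h4, H.gaugeBy_eq, H.gaugeBy_eq]; rfl
  rw [h3] at h2
  have h5 : br (-(m - m')) (q - constLoop e) - ε • dx (-(m - m')) ∈ loopsIn (below gr (-k)) := by
    refine sub_mem (fun x => ?_) (Submodule.smul_mem _ _ (dx_mem ?_))
    · exact below_mono gr (by omega) (H.lie_mem_below (neg_mem hmm x) (hq x))
    · exact neg_mem (loopsIn_mono (below_mono gr (by omega)) hmm)
  have h6 := add_mem (loopsIn_mono (below_mono gr (show 2 - ((k : ℤ) + 1 + 1) ≤ -k by omega)) h2) h5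
  convert h6 using 1
  have h7 : br (constLoop e) (m - m') = br (-(m - m')) (constLoop e) := by
    rw [br_skew, map_neg, LinearMap.neg_apply]
  rw [map_sub (br (-(m - m'))), h7]
  abel

/-- Fixed points of the contraction `m ↦ m - ρ (G m)`. -/
theorem exists_zero {ρ : g →ₗ[ℂ] g} (hρe : ∀ w ∈ below gr (-1), ρ ⁅e, w⁆ = w)
    (hρf : ∀ z, ⁅f, z⁆ = 0 → ρ z = 0) (hρ : ∀ x, ρ x ∈ below gr (-1))
    (hρk : ∀ k ≤ 1, ∀ x ∈ below gr k, ρ x ∈ below gr (k - 2))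
    (hρ0 : ∀ x ∈ below gr 1, ρ x = 0 → ⁅f, x⁆ = 0) {N : ℕ}
    (hN : IsFiniteFiltration (loopFil gr) N) {T G : Loop g → Loop g}
    (hT : ∀ m, T m = m - Loop.map ρ (G m))
    (hG1 : ∀ m ∈ loopsIn (below gr (-1)), G m ∈ loopsIn (below gr 1))
    (hG : ∀ k : ℕ, ∀ m ∈ loopsIn (below gr (-1)), ∀ m' ∈ loopsIn (below gr (-1)),
      m - m' ∈ loopsIn (below gr (-(k + 1))) →
      G m - G m' - br (constLoop e) (m - m') ∈ loopsIn (below gr (-k))) :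
    (T^[N + 1] 0 ∈ loopsIn (below gr (-1)) ∧
      G (T^[N + 1] 0) ∈ loopsIn (LinearMap.ker (LieAlgebra.ad ℂ g f))) ∧
    ∀ m ∈ loopsIn (below gr (-1)), G m ∈ loopsIn (LinearMap.ker (LieAlgebra.ad ℂ g f)) →
      m = T^[N + 1] 0 := by
  have h0 : ∀ m ∈ loopsIn (below gr (-1)), T m ∈ loopsIn (below gr (-1)) := fun m hm => by
    rw [hT]
    exact sub_mem hm fun x => hρ _
  have hcon : ∀ k : ℕ, ∀ m ∈ loopFil gr (-1), ∀ m' ∈ loopFil gr (-1),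
      m - m' ∈ loopFil gr (-(k + 1)) → T m - T m' ∈ loopFil gr (-(k + 2)) := by
    intro k m hm m' hm' hmm x
    have h1 := hρk (-k) (by omega) _ (hG k m hm m' hm' hmm x)
    -- Because ρ inverts ad e, the leading terms of m - m' and ρ(G m - G m') cancel. The remaining
    -- error has degree at most -k, and ρ lowers it by 2.
    have h2 : (T m - T m').1 x = -ρ ((G m - G m' - br (constLoop e) (m - m')).1 x) := by
      have h3 := hρe _ (sub_mem (hm x) (hm' x))
      simp only [hT, Loop.sub_apply, Loop.map_apply, br_apply, constLoop_apply, map_sub] at h3 ⊢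
      rw [lie_sub, map_sub] at h3
      rw [h3]
      abel
    rw [h2]
    exact neg_mem (below_mono gr (by omega) h1)
  obtain ⟨h1, h2⟩ := hN.fixedPoint h0 hcon
  have hit : ∀ j : ℕ, T^[j] 0 ∈ loopsIn (below gr (-1)) := by
    intro j
    induction j with
    | zero => exact zero_mem _
    | succ j ih => rw [Function.iterate_succ_apply']; exact h0 _ ih
  refine ⟨⟨hit _, fun x => hρ0 _ (hG1 _ (hit _) x) ?_⟩, fun m hm hGm => h2 m hm ?_⟩
  · have h3 := congrArg (fun q : Loop g => q.1 x) h1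
    simp only [hT, Loop.sub_apply, Loop.map_apply, sub_eq_self] at h3
    exact h3
  · refine Loop.ext_apply fun x => ?_
    simp only [hT, Loop.sub_apply, Loop.map_apply, sub_eq_self]
    exact hρf _ (hGm x)

theorem gaugeBy_mem_below (ε : ℂ) {q m : Loop g} (hq : q - constLoop e ∈ loopsIn (below gr 1))
    (hm : m ∈ loopsIn (below gr (-1))) : gaugeBy ε m q - constLoop e ∈ loopsIn (below gr 1) := by
  intro x
  have h1 := H.gaugeBy_sub_gaugeBy_mem ε hq 0 hm (zero_mem _)
    (by rw [sub_zero]; exact loopsIn_mono (below_mono gr (by norm_num)) hm) x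
  have h2 : ⁅e, m.1 x⁆ ∈ below gr 1 := below_mono gr (by norm_num) (H.lie_e_mem (hm x))
  have h3 := add_mem (add_mem (below_mono gr (show -((0 : ℕ) : ℤ) ≤ 1 by norm_num) h1) h2) (hq x)
  have h4 : (gaugeBy ε m q - gaugeBy ε 0 q - br (constLoop e) (m - 0)).1 x + ⁅e, m.1 x⁆ +
      (q - constLoop e).1 x = (gaugeBy ε m q - constLoop e).1 x := by
    rw [H.gaugeBy_zero, sub_zero]
    simp only [Loop.sub_apply, br_apply, constLoop_apply]
    abel
  rwa [h4] at h3

/-- The gauge transformation into `e + L(ker ad f)`, as a differential polynomial map. -/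
theorem exists_section (ε : ℂ) : ∃ M Φ : Loop g → Loop g, IsDiffMap (diffPoly id) Φ ∧
    (∀ q, Φ q - constLoop e ∈ loopsIn (LinearMap.ker (LieAlgebra.ad ℂ g f))) ∧
    ∀ q, q - constLoop e ∈ loopsIn (below gr 1) → M q ∈ loopsIn (below gr (-1)) ∧
      Φ q = gaugeBy ε (M q) q ∧
      ∀ m ∈ loopsIn (below gr (-1)),
        gaugeBy ε m q - constLoop e ∈ loopsIn (LinearMap.ker (LieAlgebra.ad ℂ g f)) → m = M q := by
  obtain ⟨ρ, hρe, hρf, hρ, hρk, hρ0⟩ := H.exists_retraction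
  obtain ⟨N, -, hN, -⟩ := H.exists_filtration
  obtain ⟨π, hπ⟩ := (below gr 1).subtype.exists_leftInverse_of_injective
    (Submodule.ker_subtype _)
  -- A linear projection onto e + L(g_{≤1}), so that Φ is defined as a differential polynomial map
  -- on the whole loop algebra.
  let fix : Loop g → Loop g := fun q =>
    constLoop e + Loop.map ((below gr 1).subtype ∘ₗ π) (q - constLoop e)
  have hfix : ∀ q, q - constLoop e ∈ loopsIn (below gr 1) → fix q = q := by
    intro q hq
    refine Loop.ext_apply fun x => ?_
    have : π ((q - constLoop e).1 x) = ⟨_, hq x⟩ := LinearMap.congr_fun hπ ⟨_, hq x⟩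
    have h1 : (fix q).1 x = (constLoop e).1 x + (π ((q - constLoop e).1 x) : g) := rfl
    rw [h1, congrArg Subtype.val this]
    simp
  have hA := isDiffAlg_diffPoly (id : Loop g → Loop g)
  have hfixd : IsDiffMap (diffPoly id) fix :=
    (IsDiffMap.const e).add (((IsDiffMap.self id).sub (IsDiffMap.const e)).map _)
  -- One iteration preserves differential polynomial dependence on q, and N + 1 iterations from 0
  -- reach the fixed point for every q.
  let T : Loop g → Loop g → Loop g := fun q m =>
    m - Loop.map ρ (gaugeBy ε m (fix q) - constLoop e)
  have hTd : ∀ j : ℕ, IsDiffMap (diffPoly id) (fun q => (T q)^[j] 0) ∧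
      ∀ q, (T q)^[j] 0 ∈ loopsIn (below gr (-1)) := by
    intro j
    induction j with
    | zero => exact ⟨IsDiffMap.zero, fun q => zero_mem _⟩
    | succ j ih =>
      simp only [Function.iterate_succ_apply']
      exact ⟨ih.1.sub (((H.isDiffMap_gaugeBy hA ε ih.2 ih.1 hfixd).sub (IsDiffMap.const e)).map ρ),
        fun q => sub_mem (ih.2 q) fun x => hρ _⟩
  have hfix' : ∀ q, fix q - constLoop e ∈ loopsIn (below gr 1) := fun q x => by
    have h1 : (fix q - constLoop e).1 x = (π ((q - constLoop e).1 x) : g) :=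
      add_sub_cancel_left _ _
    rw [h1]
    exact (π ((q - constLoop e).1 x)).2
  have key := fun q => H.exists_zero hρe hρf hρ hρk hρ0 hN
    (T := T q) (G := fun m => gaugeBy ε m (fix q) - constLoop e) (fun m => rfl)
    (fun m hm => H.gaugeBy_mem_below ε (hfix' q) hm) (fun k m hm m' hm' hmm => by
      have := H.gaugeBy_sub_gaugeBy_mem ε (hfix' q) k hm hm' hmm
      convert this using 1
      abel)
  refine ⟨fun q => (T q)^[N + 1] 0, fun q => gaugeBy ε ((T q)^[N + 1] 0) (fix q),
    H.isDiffMap_gaugeBy hA ε (hTd (N + 1)).2 (hTd (N + 1)).1 hfixd, fun q => (key q).1.2,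
    fun q hq => ?_⟩
  obtain ⟨⟨h1, -⟩, h3⟩ := key q
  rw [hfix q hq] at h3
  exact ⟨h1, congrArg (gaugeBy ε ((T q)^[N + 1] 0)) (hfix q hq), h3⟩

/-- The linearized section. -/
theorem exists_transversal {ε : ℂ} (hε : ε ≠ 0) {q v : Loop g}
    (hq : q - constLoop e ∈ loopsIn (below gr 1)) (hv : v ∈ loopsIn (below gr 1)) :
    ∃ w ∈ loopsIn (below gr (-1)),
      P₂ ε q w - v ∈ loopsIn (LinearMap.ker (LieAlgebra.ad ℂ g f)) ∧
      ∀ w' ∈ loopsIn (below gr (-1)),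
        P₂ ε q w' - v ∈ loopsIn (LinearMap.ker (LieAlgebra.ad ℂ g f)) → w' = w := by
  obtain ⟨ρ, hρe, hρf, hρ, hρk, hρ0⟩ := H.exists_retraction
  obtain ⟨N, -, hN, -⟩ := H.exists_filtration
  have hP : ∀ w, ε • (P₂ ε q w - v) =
      br (constLoop e) w + (br (q - constLoop e) w + ε • dx w) - ε • v := by
    intro w
    rw [P₂_apply hε, smul_sub, smul_add, smul_smul, mul_inv_cancel₀ hε, one_smul, map_sub br,
      LinearMap.sub_apply]
    abel
  have hlow : ∀ k : ℕ, ∀ w ∈ loopsIn (below gr (-(k + 1))),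
      br (q - constLoop e) w + ε • dx w ∈ loopsIn (below gr (-k)) := by
    intro k w hw
    refine add_mem (fun x => ?_) (Submodule.smul_mem _ _ (dx_mem ?_))
    · exact below_mono gr (by omega) (H.lie_mem_below (hq x) (hw x))
    · exact loopsIn_mono (below_mono gr (by omega)) hw
  have hG1 : ∀ w ∈ loopsIn (below gr (-1)), ε • (P₂ ε q w - v) ∈ loopsIn (below gr 1) := by
    intro w hw
    rw [hP]
    refine sub_mem (add_mem (fun x => below_mono gr (by norm_num) (H.lie_e_mem (hw x))) ?_) (Submodule.smul_mem _ _ hv)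
    exact loopsIn_mono (below_mono gr (by norm_num))
      (hlow 0 w (loopsIn_mono (below_mono gr (by norm_num)) hw))
  -- The same contraction with the affine map w ↦ ε(P₂w - v), whose leading term is again [e, w].
  obtain ⟨⟨h1, h2⟩, h3⟩ := H.exists_zero hρe hρf hρ hρk hρ0 hN
    (G := fun w => ε • (P₂ ε q w - v)) (fun _ => rfl) hG1 (fun k w _ w' _ hww => by
      have := hlow k _ hww
      simp only [hP]
      convert this using 1
      simp only [map_sub, smul_sub]
      abel)
  refine ⟨_, h1, ?_, fun w' hw' h' => h3 w' hw' (Submodule.smul_mem _ _ h')⟩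
  have := Submodule.smul_mem _ ε⁻¹ h2
  rwa [smul_smul, inv_mul_cancel₀ hε, one_smul] at this

end IsGradedTriple

end

end LoopReduction

/-! ### The cross section of the gauge action and the leaves on S. -/

namespace LoopReduction

set_option linter.unusedSectionVars false

noncomputable section

variable {g : Type*} [LieRing g] [LieAlgebra ℂ g] [Module.Finite ℂ g]

/-- The space `b`, orthogonal to the coisotropic part of the grading. -/
abbrev slice (gr : ℤ → Submodule ℂ g) (e : g) (l : Submodule ℂ g) : Submodule ℂ g :=
  (killingForm ℂ g).orthogonal (lowerPart gr (coisotropic gr e l))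

/-- The properties of the cross section `Φ` of the gauge action on `e + L(b)`, where `M s` is the
loop that moves `s` to `Φ s`. -/
structure IsCrossSection (gr : ℤ → Submodule ℂ g) (e f : g) (l : Submodule ℂ g) (ε : ℂ)
    (M Φ : Loop g → Loop g) : Prop where
  isDiffMap : IsDiffMap (diffPoly id) Φ
  mem : ∀ s ∈ affineLoops e (slice gr e l), M s ∈ loopsIn (lowerPart gr l)
  eq : ∀ s ∈ affineLoops e (slice gr e l), Φ s = gaugeBy ε (M s) s
  mem_ker : ∀ s, Φ s ∈ affineLoops e (LinearMap.ker (LieAlgebra.ad ℂ g f))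
  unique : ∀ s ∈ affineLoops e (slice gr e l), ∀ m ∈ loopsIn (lowerPart gr l),
    gaugeBy ε m s ∈ affineLoops e (LinearMap.ker (LieAlgebra.ad ℂ g f)) → m = M s
  invariant : ∀ s ∈ affineLoops e (below gr 1), ∀ m ∈ loopsIn (below gr (-1)),
    Φ (gaugeBy ε m s) = Φ s
  fixed : ∀ q ∈ affineLoops e (LinearMap.ker (LieAlgebra.ad ℂ g f)), Φ q = q

namespace IsGradedTriple

variable {gr : ℤ → Submodule ℂ g} {e h f : g} (H : IsGradedTriple gr e h f)
  [LieAlgebra.IsKilling ℂ g] {l : Submodule ℂ g} (hl : l ≤ gr (-1))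
include H hl

theorem lowerPart_le_coisotropic
    (hl_iso : ∀ x ∈ l, ∀ y ∈ l, killingForm ℂ g e ⁅x, y⁆ = 0) :
    lowerPart gr l ≤ lowerPart gr (coisotropic gr e l) :=
  H.lowerPart_mono (l' := coisotropic gr e l) fun x hx => ⟨hl hx, hl_iso x hx⟩

theorem slice_le : slice gr e l ≤ below gr 1 := fun _ hx =>
  ((H.mem_orthogonal_coisotropic hl).1 hx).1

theorem below_zero_le_slice : below gr 0 ≤ slice gr e l := fun x hx =>
  (H.mem_orthogonal_coisotropic hl).2 ⟨below_mono gr (by norm_num) hx, 0, zero_mem _, by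
    rw [lie_zero]; exact H.mem_below_iff.1 hx 1 (by norm_num)⟩

theorem ker_f_le_slice : LinearMap.ker (LieAlgebra.ad ℂ g f) ≤ slice gr e l := fun _ hx =>
  H.below_zero_le_slice hl (H.ker_f_mem_below hx)

theorem sub_mem_below {s : Loop g} (hs : s ∈ affineLoops e (slice gr e l)) :
    s - constLoop e ∈ loopsIn (below gr 1) := loopsIn_mono (H.slice_le hl) hs

theorem affineLoops_ker_subset :
    affineLoops e (LinearMap.ker (LieAlgebra.ad ℂ g f)) ⊆ affineLoops e (slice gr e l) :=
  fun _ hq => loopsIn_mono (H.ker_f_le_slice hl) hq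

/-- Modulo g_{≤0} and b only the component of [e, x] in degree 1 counts; it is [e, x₋₁], which lies
in [e, l] exactly when x₋₁ is in l. This serves both the infinitesimal and the finite gauge action.
-/
theorem add_lie_mem_slice_iff {x v w : g} (hx : x ∈ below gr (-1)) (hv : v ∈ slice gr e l)
    (hw : w - (v + ⁅e, x⁆) ∈ below gr 0) :
    w ∈ slice gr e l ↔ x ∈ lowerPart gr l := by
  have h1 : w ∈ slice gr e l ↔ ⁅e, x⁆ ∈ slice gr e l := by
    have h2 := H.below_zero_le_slice hl hw
    constructor
    · intro h3
      have h4 := sub_mem (sub_mem h3 h2) hv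
      have h5 : w - (w - (v + ⁅e, x⁆)) - v = ⁅e, x⁆ := by abel
      rwa [h5] at h4
    · intro h3
      have h4 := add_mem h2 (add_mem hv h3)
      have h5 : w - (v + ⁅e, x⁆) + (v + ⁅e, x⁆) = w := by abel
      rwa [h5] at h4
  have hpr : H.pr 1 ⁅e, x⁆ = ⁅e, H.pr (-1) x⁆ := by
    rw [← H.pr_lie H.e_mem]; norm_num
  rw [h1, H.mem_orthogonal_coisotropic hl, H.mem_lowerPart hl, hpr]
  constructor
  · rintro ⟨-, y, hy, hxy⟩
    refine ⟨hx, ?_⟩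
    have h2 : H.pr (-1) x - y = 0 := H.ad_e_injective
      (sub_mem (H.pr_mem_below le_rfl _) (gr_le_below gr le_rfl (hl hy)))
      (by rw [lie_sub, hxy, sub_self])
    rw [sub_eq_zero.1 h2]
    exact hy
  · rintro ⟨-, hy⟩
    exact ⟨below_mono gr (by norm_num) (H.lie_e_mem hx), _, hy, rfl⟩

/-- With v = 0 it computes D ∩ TS; a general v is needed for transversality. -/
theorem P₂_mem_slice_iff {ε : ℂ} (hε : ε ≠ 0) {s m v : Loop g}
    (hs : s ∈ affineLoops e (slice gr e l)) (hm : m ∈ loopsIn (below gr (-1)))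
    (hv : v ∈ loopsIn (slice gr e l)) :
    P₂ ε s m - v ∈ loopsIn (slice gr e l) ↔ m ∈ loopsIn (lowerPart gr l) := by
  have key : ∀ x, (P₂ ε s m - v).1 x ∈ slice gr e l ↔ m.1 x ∈ lowerPart gr l := by
    intro x
    have h1 : (P₂ ε s m - v).1 x ∈ slice gr e l ↔ ε • (P₂ ε s m - v).1 x ∈ slice gr e l :=
      (Submodule.smul_mem_iff _ hε).symm
    rw [h1]
    refine H.add_lie_mem_slice_iff hl (v := -(ε • v.1 x)) (hm x)
      (neg_mem (Submodule.smul_mem _ _ (hv x))) ?_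
    have h2 : ε • (P₂ ε s m - v).1 x - (-(ε • v.1 x) + ⁅e, m.1 x⁆) =
        ⁅(s - constLoop e).1 x, m.1 x⁆ + ε • (dx m).1 x := by
      rw [P₂_apply hε]
      simp only [Loop.sub_apply, Loop.add_apply, Loop.smul_apply, br_apply, constLoop_apply,
        sub_lie, smul_sub, smul_add, smul_smul, mul_inv_cancel₀ hε, one_smul]
      abel
    rw [h2]
    refine add_mem (below_mono gr (by norm_num)
      (H.lie_mem_below (H.sub_mem_below hl hs x) (hm x))) (Submodule.smul_mem _ _ ?_)
    exact below_mono gr (by norm_num) (dx_mem hm x)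
  exact ⟨fun hw x => (key x).1 (hw x), fun hw x => (key x).2 (hw x)⟩

theorem gaugeBy_mem_slice_iff (ε : ℂ) {s m : Loop g} (hs : s ∈ affineLoops e (slice gr e l))
    (hm : m ∈ loopsIn (below gr (-1))) :
    gaugeBy ε m s ∈ affineLoops e (slice gr e l) ↔ m ∈ loopsIn (lowerPart gr l) := by
  have key : ∀ x, (gaugeBy ε m s - constLoop e).1 x ∈ slice gr e l ↔
      m.1 x ∈ lowerPart gr l := by
    intro x
    refine H.add_lie_mem_slice_iff hl (v := (s - constLoop e).1 x) (hm x) (hs x) ?_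
    have h1 := H.gaugeBy_sub_gaugeBy_mem ε (H.sub_mem_below hl hs) 0 hm (zero_mem _)
      (by rw [sub_zero]; exact loopsIn_mono (below_mono gr (by norm_num)) hm) x
    rw [H.gaugeBy_zero, sub_zero] at h1
    refine below_mono gr (by norm_num) (?_ : _ ∈ below gr (-((0 : ℕ) : ℤ)))
    have h2 : (gaugeBy ε m s - constLoop e).1 x - ((s - constLoop e).1 x + ⁅e, m.1 x⁆) =
        (gaugeBy ε m s - s - br (constLoop e) m).1 x := by
      simp only [Loop.sub_apply, br_apply, constLoop_apply]
      abel
    rwa [h2]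
  exact ⟨fun hw x => (key x).1 (hw x), fun hw x => (key x).2 (hw x)⟩

theorem gaugeBy_mem_slice (ε : ℂ) {s m : Loop g} (hs : s ∈ affineLoops e (slice gr e l))
    (hm : m ∈ loopsIn (lowerPart gr l)) : gaugeBy ε m s ∈ affineLoops e (slice gr e l) :=
  (H.gaugeBy_mem_slice_iff hl ε hs (loopsIn_mono (H.lowerPart_le hl) hm)).2 hm

theorem P₂_mem_slice {ε : ℂ} (hε : ε ≠ 0) {s m : Loop g}
    (hs : s ∈ affineLoops e (slice gr e l)) (hm : m ∈ loopsIn (lowerPart gr l)) :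
    P₂ ε s m ∈ loopsIn (slice gr e l) := by
  have := (H.P₂_mem_slice_iff hl hε hs (loopsIn_mono (H.lowerPart_le hl) hm) (zero_mem _)).2 hm
  rwa [sub_zero] at this

/-- The intersection of the distribution with the tangent space of `e + L(b)`. -/
theorem map_inf_slice (hl_iso : ∀ x ∈ l, ∀ y ∈ l, killingForm ℂ g e ⁅x, y⁆ = 0) {ε : ℂ}
    (hε : ε ≠ 0) {s : Loop g} (hs : s ∈ affineLoops e (slice gr e l)) :
    (loopsIn (lowerPart gr (coisotropic gr e l))).map (P₂ ε s) ⊓ loopsIn (slice gr e l) =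
      (loopsIn (lowerPart gr l)).map (P₂ ε s) := by
  refine le_antisymm ?_ ?_
  · rintro - ⟨⟨m, hm, rfl⟩, hb⟩
    refine ⟨m, ?_, rfl⟩
    refine (H.P₂_mem_slice_iff hl hε hs (loopsIn_mono (H.lowerPart_le (H.coisotropic_le l)) hm)
      (zero_mem _)).1 ?_
    rw [sub_zero]
    exact hb
  · rintro - ⟨m, hm, rfl⟩
    exact ⟨⟨m, loopsIn_mono (H.lowerPart_le_coisotropic hl hl_iso) hm, rfl⟩,
      H.P₂_mem_slice hl hε hs hm⟩

/-- Existence and uniqueness in `exists_transversal` give the sum and the trivial intersection. The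
solution w lies in L(g_neg) because P₂w - v and v both lie in L(b). -/
theorem transversality {ε : ℂ} (hε : ε ≠ 0) {q : Loop g}
    (hq : q ∈ affineLoops e (LinearMap.ker (LieAlgebra.ad ℂ g f))) :
    (loopsIn (lowerPart gr l)).map (P₂ ε q) ⊓
        loopsIn (LinearMap.ker (LieAlgebra.ad ℂ g f)) = ⊥ ∧
      (loopsIn (lowerPart gr l)).map (P₂ ε q) ⊔
        loopsIn (LinearMap.ker (LieAlgebra.ad ℂ g f)) = loopsIn (slice gr e l) := by
  have hqS := H.affineLoops_ker_subset hl hq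
  have hq1 := H.sub_mem_below hl hqS
  have hU := loopsIn_mono (H.lowerPart_le hl)
  have hker := loopsIn_mono (H.ker_f_le_slice hl)
  refine ⟨?_, le_antisymm ?_ ?_⟩
  · rw [eq_bot_iff]
    rintro - ⟨⟨m, hm, rfl⟩, hk⟩
    obtain ⟨w, -, -, hw⟩ := H.exists_transversal hε hq1 (zero_mem (loopsIn (below gr 1)))
    have h1 := hw m (hU hm) (by rw [sub_zero]; exact hk)
    have h2 := hw 0 (zero_mem _) (by rw [map_zero, sub_zero]; exact zero_mem _)
    rw [h1, ← h2, map_zero]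
    exact zero_mem _
  · refine sup_le ?_ hker
    rintro - ⟨m, hm, rfl⟩
    exact H.P₂_mem_slice hl hε hqS hm
  · intro v hv
    obtain ⟨w, hw, hwv, -⟩ := H.exists_transversal hε hq1 (loopsIn_mono (H.slice_le hl) hv)
    have hw' := (H.P₂_mem_slice_iff hl hε hqS hw hv).1 (hker hwv)
    have h1 := Submodule.add_mem_sup (Submodule.mem_map_of_mem (f := P₂ ε q) hw') (neg_mem hwv)
    have h2 : P₂ ε q w + -(P₂ ε q w - v) = v := by abel
    rwa [h2] at h1

theorem exists_crossSection (ε : ℂ) : ∃ M Φ, IsCrossSection gr e f l ε M Φ := by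
  obtain ⟨M, Φ, hΦ, hk, hM⟩ := H.exists_section ε
  have hlow := H.lowerPart_le hl
  have hU := loopsIn_mono hlow
  have hmem : ∀ s ∈ affineLoops e (slice gr e l), M s ∈ loopsIn (lowerPart gr l) := by
    intro s hs
    obtain ⟨h1, h2, -⟩ := hM s (H.sub_mem_below hl hs)
    refine (H.gaugeBy_mem_slice_iff hl ε hs h1).1 ?_
    rw [← h2]
    exact H.affineLoops_ker_subset hl (hk s)
  have huniq : ∀ s ∈ affineLoops e (slice gr e l), ∀ m ∈ loopsIn (lowerPart gr l),
      gaugeBy ε m s ∈ affineLoops e (LinearMap.ker (LieAlgebra.ad ℂ g f)) → m = M s :=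
    fun s hs m hm hms => (hM s (H.sub_mem_below hl hs)).2.2 m (hU hm) hms
  refine ⟨M, Φ, hΦ, hmem, fun s hs => (hM s (H.sub_mem_below hl hs)).2.1, hk, huniq,
    fun s hs m hm => ?_, fun q hq => ?_⟩
  · obtain ⟨h1, h2, -⟩ := hM s hs
    obtain ⟨-, h2', h3'⟩ := hM _ (H.gaugeBy_mem_below ε hs hm)
    -- Undoing m and then applying M(s) carries m·s to Φ(s) in Q, by a single loop z. Uniqueness of
    -- the gauge parameter of m·s gives Φ(m·s) = Φ(s).
    obtain ⟨z, hz, hzz⟩ := H.gaugeBy_gaugeBy (below_mono gr (by norm_num)) le_rfl ε h1 (neg_mem hm)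
    have h4 : gaugeBy ε z (gaugeBy ε m s) = Φ s := by
      rw [← hzz, H.gaugeBy_neg_gaugeBy ε hm, h2]
    rw [h2', ← h3' z hz (by rw [h4]; exact hk s), h4]
  · have hqS := H.affineLoops_ker_subset hl hq
    have h1 := huniq q hqS 0 (zero_mem _) (by rw [H.gaugeBy_zero]; exact hq)
    rw [(hM q (H.sub_mem_below hl hqS)).2.1, ← h1, H.gaugeBy_zero]

end IsGradedTriple

namespace IsCrossSection

variable {gr : ℤ → Submodule ℂ g} {e h f : g} (H : IsGradedTriple gr e h f)
  [LieAlgebra.IsKilling ℂ g] {l : Submodule ℂ g} (hl : l ≤ gr (-1)) {ε : ℂ}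
  {M Φ : Loop g → Loop g} (hΦ : IsCrossSection gr e f l ε M Φ)
include H hl hΦ

theorem eq_iff {s t : Loop g} (hs : s ∈ affineLoops e (slice gr e l))
    (ht : t ∈ affineLoops e (slice gr e l)) :
    Φ s = Φ t ↔ ∃ m ∈ loopsIn (lowerPart gr l), t = gaugeBy ε m s := by
  constructor
  · intro hst
    obtain ⟨z, hz, hzz⟩ := H.gaugeBy_gaugeBy (H.below_le_lowerPart hl) (H.lowerPart_le hl) ε
      (neg_mem (hΦ.mem t ht)) (hΦ.mem s hs)
    refine ⟨z, hz, ?_⟩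
    rw [← hzz, ← hΦ.eq s hs, hst, hΦ.eq t ht,
      H.gaugeBy_neg_gaugeBy ε (loopsIn_mono (H.lowerPart_le hl) (hΦ.mem t ht))]
  · rintro ⟨m, hm, rfl⟩
    exact (hΦ.invariant s (H.sub_mem_below hl hs) m
      (loopsIn_mono (H.lowerPart_le hl) hm)).symm

/-- The derivative of the cross section vanishes along the leaves. -/
theorem exists_derivative (hε : ε ≠ 0) : ∃ DΦ : Loop g → Loop g → Loop g,
    (∀ {𝕜 : Type} [RCLike 𝕜] [NormedAlgebra 𝕜 ℂ] {γ γ' : 𝕜 → Loop g}, IsJetCurve γ γ' →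
      IsJetCurve (fun τ => Φ (γ τ)) (fun τ => DΦ (γ τ) (γ' τ))) ∧
    ∀ s ∈ affineLoops e (slice gr e l), ∀ m ∈ loopsIn (below gr (-1)),
      DΦ s (P₂ ε s m) = 0 := by
  obtain ⟨DΦ, hD⟩ := LoopReduction.exists_derivative
    (hΦ.isDiffMap.mono (diffPoly_le_densities id))
  refine ⟨DΦ, hD, fun s hs m hm => ?_⟩
  have hm' : ε⁻¹ • m ∈ loopsIn (below gr (-1)) := Submodule.smul_mem _ _ hm
  have h1 := hD (H.isJetCurve_gaugeBy hε hm' s)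
  have h2 : (fun τ : ℝ => Φ (gaugeBy ε ((τ : ℂ) • (ε⁻¹ • m)) s)) = fun _ => Φ s :=
    funext fun τ => hΦ.invariant s (H.sub_mem_below hl hs) _ (Submodule.smul_mem _ _ hm')
  rw [h2] at h1
  have h3 := h1.unique (IsJetCurve.const (Φ s)) 0
  rw [Complex.ofReal_zero, zero_smul, H.gaugeBy_zero, map_smul, smul_smul, mul_inv_cancel₀ hε,
    one_smul] at h3
  exact h3

/-- The velocity lies in D and in TS, hence in P₂(L(g_neg)), where the derivative of Φ vanishes. So
leaves are contained in fibres of Φ. -/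
theorem eq_of_tangentPath (hl_iso : ∀ x ∈ l, ∀ y ∈ l, killingForm ℂ g e ⁅x, y⁆ = 0)
    (hε : ε ≠ 0) {D : Loop g → Submodule ℂ (Loop g)}
    (hD : ∀ q, D q = (loopsIn (lowerPart gr (coisotropic gr e l))).map (P₂ ε q)) {s t : Loop g}
    (hst : TangentPath (affineLoops e (slice gr e l)) D s t) : Φ s = Φ t := by
  obtain ⟨γ, hγ, hγS, hγD, rfl, rfl⟩ := hst
  choose v hv hγv using hγD
  have hjet := isJetCurve_of_contDiff hγ hγv
  obtain ⟨DΦ, hDΦ, hzero⟩ := hΦ.exists_derivative H hl hε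
  have h1 : IsJetCurve (fun τ => γ τ + -constLoop e) (fun τ => v τ + 0) :=
    hjet.add (IsJetCurve.const _)
  refine (hDΦ hjet).eq_of_zero (fun τ => ?_) 0 1
  have hvb : v τ ∈ loopsIn (slice gr e l) := by
    have := h1.velocity_mem (W := slice gr e l) (fun τ => by
      rw [← sub_eq_add_neg]; exact hγS τ) τ
    simpa using this
  have hvm : v τ ∈ (loopsIn (lowerPart gr l)).map (P₂ ε (γ τ)) := by
    rw [← H.map_inf_slice hl hl_iso hε (hγS τ), ← hD]
    exact ⟨hv τ, hvb⟩
  obtain ⟨m, hm, hmv⟩ := hvm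
  rw [← hmv]
  exact hzero _ (hγS τ) m (loopsIn_mono (H.lowerPart_le hl) hm)

/-- The converse inclusion: the path τ ↦ (τm)·s stays in S and has velocity εP₂(m). -/
theorem tangentPath_gaugeBy (hl_iso : ∀ x ∈ l, ∀ y ∈ l, killingForm ℂ g e ⁅x, y⁆ = 0)
    (hε : ε ≠ 0) {D : Loop g → Submodule ℂ (Loop g)}
    (hD : ∀ q, D q = (loopsIn (lowerPart gr (coisotropic gr e l))).map (P₂ ε q)) {s m : Loop g}
    (hs : s ∈ affineLoops e (slice gr e l)) (hm : m ∈ loopsIn (lowerPart gr l)) :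
    TangentPath (affineLoops e (slice gr e l)) D s (gaugeBy ε m s) := by
  have hm' := loopsIn_mono (H.lowerPart_le hl) hm
  refine ⟨fun τ => gaugeBy ε ((τ : ℂ) • m) s, H.contDiff_gaugeBy ε hm' s,
    fun τ => H.gaugeBy_mem_slice hl ε hs (Submodule.smul_mem _ _ hm), fun τ =>
    ⟨_, ?_, (H.isJetCurve_gaugeBy hε hm' s).isVelocity τ⟩, ?_, ?_⟩
  · rw [hD, ← map_smul]
    exact Submodule.mem_map_of_mem (Submodule.smul_mem _ _
      (loopsIn_mono (H.lowerPart_le_coisotropic hl hl_iso) hm))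
  · simp only [Complex.ofReal_zero, zero_smul, H.gaugeBy_zero]
  · simp only [Complex.ofReal_one, one_smul]

theorem sameLeaf_iff (hl_iso : ∀ x ∈ l, ∀ y ∈ l, killingForm ℂ g e ⁅x, y⁆ = 0)
    (hε : ε ≠ 0) {D : Loop g → Submodule ℂ (Loop g)}
    (hD : ∀ q, D q = (loopsIn (lowerPart gr (coisotropic gr e l))).map (P₂ ε q)) {s t : Loop g} :
    SameLeaf (affineLoops e (slice gr e l)) D s t ↔
      s ∈ affineLoops e (slice gr e l) ∧ t ∈ affineLoops e (slice gr e l) ∧ Φ s = Φ t := by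
  refine and_congr_right fun hs => and_congr_right fun ht => ⟨fun hst => ?_, fun hst => ?_⟩
  · clear hs ht
    induction hst with
    | rel s t hst => exact hΦ.eq_of_tangentPath H hl hl_iso hε hD hst
    | refl s => rfl
    | symm s t _ ih => exact ih.symm
    | trans s r t _ _ ih1 ih2 => exact ih1.trans ih2
  · obtain ⟨m, hm, rfl⟩ := (hΦ.eq_iff H hl hs ht).1 hst
    exact Relation.EqvGen.rel _ _ (hΦ.tangentPath_gaugeBy H hl hl_iso hε hD hs hm)

end IsCrossSection

end

end LoopReduction

/-! ### Lifts of functionals and independence of the choice of representatives. -/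

namespace LoopReduction

set_option linter.unusedSectionVars false

noncomputable section

variable {g : Type*} [LieRing g] [LieAlgebra ℂ g] [Module.Finite ℂ g]

/-! ### Functionals and maps -/

section Maps

variable {X : Type*} {i : X → Loop g}

theorem IsDiffMap.comp {𝓐 : Subalgebra ℂ (X → ℝ → ℂ)} (h𝓐 : IsDiffAlg 𝓐) {T : X → Loop g}
    {Φ : Loop g → Loop g} (hΦ : IsDiffMap (diffPoly id) Φ) (hT : IsDiffMap 𝓐 T) :
    IsDiffMap 𝓐 fun s => Φ (T s) := fun φ => hT.comp_diffPoly h𝓐 (hΦ φ)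

theorem IsLocal.comp {T : X → Loop g} {F : Loop g → ℂ} (hF : IsLocal id F)
    (hT : IsDiffMap (densities i) T) : IsLocal i fun s => F (T s) := by
  obtain ⟨p, hp, rfl⟩ := hF
  exact ⟨_, hT.comp_densities (isDiffAlg_densities i) (fun c hc => coeff_mem_densities i hc) hp,
    rfl⟩

theorem IsLocal.exists_extension {F : X → ℂ} (hF : IsLocal i F) :
    ∃ F' : Loop g → ℂ, IsLocal id F' ∧ F = fun s => F' (i s) := by
  obtain ⟨p, hp, rfl⟩ := hF
  obtain ⟨P, hP, rfl⟩ := exists_extension_densities hp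
  exact ⟨functionalOf P, ⟨P, hP, rfl⟩, rfl⟩

theorem HasGrad.restrict {F : Loop g → ℂ} {q : X} {v : Loop g} (h : HasGrad id F (i q) v) :
    HasGrad i (fun s => F (i s)) q v := by
  intro s c hc
  have := h s (fun θ => i (c θ)) hc
  exact this

theorem HasGrad.smul_add {F F' : X → ℂ} {q : X} {v v' : Loop g} (h : HasGrad i F q v)
    (h' : HasGrad i F' q v') (c : ℂ) : HasGrad i (c • F + F') q (c • v + v') := by
  intro s γ hγ
  rw [pair_add_left, pair_smul_left]
  exact ((h s γ hγ).const_mul c).add (h' s γ hγ)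

/-- Two gradients agree on the directions of the lines of an affine space. -/
theorem pair_eq_of_hasGrad {e : g} {W : Submodule ℂ g} {F : affineLoops e W → ℂ}
    {q : affineLoops e W} {v v' : Loop g} (h : HasGrad Subtype.val F q v)
    (h' : HasGrad Subtype.val F q v') {t : Loop g} (ht : t ∈ loopsIn W) : pair v t = pair v' t := by
  let c : ℂ → affineLoops e W := fun θ => ⟨q.1 + θ • t, by
    have h1 : q.1 + θ • t - constLoop e = (q.1 - constLoop e) + θ • t := by abel
    change q.1 + θ • t - constLoop e ∈ loopsIn W
    rw [h1]
    exact add_mem q.2 (Submodule.smul_mem _ θ ht)⟩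
  exact (h t c fun θ => rfl).unique (h' t c fun θ => rfl)

end Maps

variable [LieAlgebra.IsKilling ℂ g]

/-- On L(n) the tensor P_λ equals P₂, so a change of either argument by L(n) is tested against
P₂(L(n)), which the other argument annihilates. Only one representative of each pair needs this
property. -/
theorem pair_pencil_congr {n : Submodule ℂ g} {a : g} (ha : ∀ x ∈ n, ⁅a, x⁆ = 0) {ε : ℂ}
    (hε : ε ≠ 0) (lam : ℂ) {s v v' w w' : Loop g} (hv : v - v' ∈ loopsIn n)
    (hw : w - w' ∈ loopsIn n) (hv' : ∀ m ∈ loopsIn n, pair v' (P₂ ε s m) = 0)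
    (hw' : ∀ m ∈ loopsIn n, pair w (P₂ ε s m) = 0) :
    pair v (pencil ε a lam s w) = pair v' (pencil ε a lam s w') := by
  have h1 := pair_pencil hε a lam s (v - v') w
  rw [pencil_eq_P₂ a lam s fun x => ha _ (hv x), pair_comm, hw' _ hv, pair_sub_left] at h1
  have h2 := hv' _ hw
  rw [← pencil_eq_P₂ a lam s fun x => ha _ (hw x), map_sub, pair_sub_right] at h2
  linear_combination h1 + h2

namespace IsCrossSection

variable {gr : ℤ → Submodule ℂ g} {e h f : g} (H : IsGradedTriple gr e h f)
  {l : Submodule ℂ g} (hl : l ≤ gr (-1)) {ε : ℂ}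
  {M Φ : Loop g → Loop g} (hΦ : IsCrossSection gr e f l ε M Φ)
include H hl hΦ

omit H hl in
theorem isLocal_lift {F : Loop g → ℂ} (hF : IsLocal id F) : IsLocal id fun q => F (Φ q) :=
  hF.comp (hΦ.isDiffMap.mono (diffPoly_le_densities id))

/-- Although the loops of n need not preserve S, Φ is invariant under all negative loops acting on e
+ L(g_{≤1}). Hence F ∘ Φ is constant along the gauge flows of L(n) starting in S. -/
theorem grad_lift_annihilates (hε : ε ≠ 0) {F : Loop g → ℂ} (hF : IsLocal id F) {s : Loop g}
    (hs : s ∈ affineLoops e (slice gr e l)) {m : Loop g}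
    (hm : m ∈ loopsIn (lowerPart gr (coisotropic gr e l))) :
    pair (grad id (fun q => F (Φ q)) s) (P₂ ε s m) = 0 := by
  have hm' := loopsIn_mono (H.lowerPart_le (H.coisotropic_le l)) hm
  have h1 := (isRegular_of_isLocal (hΦ.isLocal_lift hF)).chain (H.isJetCurve_gaugeBy hε hm' s) 0
  have h2 : (fun τ : ℝ => F (Φ (gaugeBy ε ((τ : ℂ) • m) s))) = fun _ => F (Φ s) :=
    funext fun τ => congrArg F (hΦ.invariant s (H.sub_mem_below hl hs) _
      (Submodule.smul_mem _ _ hm'))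
  rw [h2] at h1
  have h3 := h1.unique (hasDerivAt_const 0 _)
  rw [Complex.ofReal_zero, zero_smul, H.gaugeBy_zero, pair_smul_right] at h3
  exact (mul_eq_zero.1 h3).resolve_left hε

/-- The gauge flow τ ↦ (τM(s))·s joins s to Φ(s) inside S with velocity in D, so K is constant along
it. -/
theorem apply_eq_of_annihilates (hl_iso : ∀ x ∈ l, ∀ y ∈ l, killingForm ℂ g e ⁅x, y⁆ = 0)
    (hε : ε ≠ 0) {K : Loop g → ℂ} (hK : IsLocal id K)
    (hKn : ∀ s ∈ affineLoops e (slice gr e l),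
      ∀ m ∈ loopsIn (lowerPart gr (coisotropic gr e l)), pair (grad id K s) (P₂ ε s m) = 0)
    {s : Loop g} (hs : s ∈ affineLoops e (slice gr e l)) : K (Φ s) = K s := by
  have hm := hΦ.mem s hs
  have hm' := loopsIn_mono (H.lowerPart_le hl) hm
  have h1 := (isRegular_of_isLocal hK).chain (H.isJetCurve_gaugeBy hε hm' s)
  have h2 := is_const_of_deriv_eq_zero (f := fun τ : ℝ => K (gaugeBy ε ((τ : ℂ) • M s) s))
    (fun τ => (h1 τ).differentiableAt) (fun τ => by
      rw [(h1 τ).deriv, pair_smul_right, hKn _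
        (H.gaugeBy_mem_slice hl ε hs (Submodule.smul_mem _ _ hm)) _
        (loopsIn_mono (H.lowerPart_le_coisotropic hl hl_iso) hm), mul_zero]) 1 0
  simp only [Complex.ofReal_one, one_smul, Complex.ofReal_zero, zero_smul, H.gaugeBy_zero] at h2
  rw [hΦ.eq s hs, h2]

omit hΦ in
/-- The bracket on `S` is computed from any representatives of the differentials along `S`. -/
theorem pair_pencil_eq_bracket (hε : ε ≠ 0) {a : g}
    (ha : ∀ x ∈ lowerPart gr (coisotropic gr e l), ⁅a, x⁆ = 0) (lam : ℂ) {F G : Loop g → ℂ}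
    (hF : IsLocal id F) (hG : IsLocal id G) {s : affineLoops e (slice gr e l)}
    (hFn : ∀ m ∈ loopsIn (lowerPart gr (coisotropic gr e l)),
      pair (grad id F s.1) (P₂ ε s.1 m) = 0) {v w : Loop g}
    (hv : HasGrad Subtype.val (fun s : affineLoops e (slice gr e l) => F s.1) s v)
    (hw : HasGrad Subtype.val (fun s : affineLoops e (slice gr e l) => G s.1) s w)
    (hwn : ∀ m ∈ loopsIn (lowerPart gr (coisotropic gr e l)), pair w (P₂ ε s.1 m) = 0) :
    pair v (pencil ε a lam s.1 w) = bracket (pencil ε a lam) F G s.1 := by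
  -- Two differentials that agree along S differ by a loop orthogonal to L(b), and b^⊥ = n^⊥⊥ = n.
  have key : ∀ {F : Loop g → ℂ}, IsLocal id F → ∀ {v : Loop g},
      HasGrad Subtype.val (fun s : affineLoops e (slice gr e l) => F s.1) s v →
      v - grad id F s.1 ∈ loopsIn (lowerPart gr (coisotropic gr e l)) := by
    intro F hF v hv
    have h1 := mem_orthogonal_of_pair (n := slice gr e l) (v := v - grad id F s.1) fun t ht => by
      rw [pair_sub_left, sub_eq_zero]
      exact pair_eq_of_hasGrad hv
        (HasGrad.restrict (i := Subtype.val) ((isRegular_of_isLocal hF).hasGrad s.1)) ht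
    rwa [H.orthogonal_orthogonal] at h1
  exact pair_pencil_congr ha hε lam (key hF hv) (key hG hw) hFn hwn

end IsCrossSection

end

end LoopReduction

/-! ### The matrix differential operators of the reduced brackets. -/

namespace LoopReduction

set_option linter.unusedSectionVars false

noncomputable section

variable {g : Type*} [LieRing g] [LieAlgebra ℂ g] [Module.Finite ℂ g]

section Restriction

variable {X : Type*} (i : X → Loop g)

/-- Restriction of differential polynomials. -/
def restrictDiffPoly : diffPoly (id : Loop g → Loop g) →ₗ[ℂ] diffPoly i where
  toFun p := ⟨fun s => p.1 (i s), (IsDiffMap.self i).comp_diffPoly (isDiffAlg_diffPoly i) p.2⟩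
  map_add' _ _ := rfl
  map_smul' _ _ := rfl

/-- Restriction of the coefficients of a differential operator. -/
def restrictOp (A : ℕ →₀ diffPoly (id : Loop g → Loop g)) : ℕ →₀ diffPoly i :=
  A.mapRange (restrictDiffPoly i) (map_zero _)

theorem sum_restrictOp (A B : ℕ →₀ diffPoly (id : Loop g → Loop g)) (c c' : ℂ) (s : X) (x u : ℂ)
    (t : ℝ) (d : ℕ → ℂ) (hx : x = u) :
    ((c • restrictOp i A + c' • restrictOp i B).sum fun r p => x * (p : X → ℝ → ℂ) s t * d r) =
      u * (c * (A.sum fun r p => p.1 (i s) t * d r) +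
        c' * (B.sum fun r p => p.1 (i s) t * d r)) := by
  subst hx
  have h0 : ∀ r, x * ((0 : diffPoly i) : X → ℝ → ℂ) s t * d r = 0 := fun r => by simp
  have key : ∀ (A : ℕ →₀ diffPoly (id : Loop g → Loop g)) (c : ℂ),
      ((c • restrictOp i A).sum fun r p => x * (p : X → ℝ → ℂ) s t * d r) =
        x * (c * (A.sum fun r p => p.1 (i s) t * d r)) := by
    intro A c
    rw [Finsupp.sum_smul_index' h0, restrictOp, Finsupp.sum_mapRange_index (by simp),
      Finsupp.sum, Finsupp.sum, Finset.mul_sum, Finset.mul_sum]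
    refine Finset.sum_congr rfl fun r _ => ?_
    change x * (c * (A r).1 (i s) t) * d r = _
    ring
  rw [Finsupp.sum_add_index' h0 (fun r p p' => by
    change x * (p.1 s t + p'.1 s t) * d r = _
    ring), key, key]
  ring

end Restriction

variable [LieAlgebra.IsKilling ℂ g]

theorem IsVecOp.pencil {X : Type*} {𝓐 : Subalgebra ℂ (X → ℝ → ℂ)} (h𝓐 : IsDiffAlg 𝓐) (ε : ℂ) (a : g)
    {T : X → Loop g} (hT : IsDiffMap 𝓐 T) {K : X → circleFun → Loop g} (hK : IsVecOp 𝓐 K) :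
    IsVecOp 𝓐 (fun q u => P₂ ε (T q) (K q u)) ∧ IsVecOp 𝓐 fun q u => P₁ ε a (T q) (K q u) :=
  ⟨(((hK.dx h𝓐).const_smul ε).add (hK.br hT)).const_smul ε⁻¹,
    (hK.br (IsDiffMap.const a)).const_smul ε⁻¹⟩

namespace IsCrossSection

variable {gr : ℤ → Submodule ℂ g} {e h f : g} {l : Submodule ℂ g} {ε : ℂ}
  {M Φ : Loop g → Loop g} (hΦ : IsCrossSection gr e f l ε M Φ)
include hΦ

/-- The gradient of a lift, in terms of the gradient on `Q`. -/
theorem exists_grad_lift {ι : Type*} [Fintype ι]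
    (ξ : Module.Basis ι ℂ (LinearMap.ker (LieAlgebra.ad ℂ g f))) :
    ∃ L : ι → Loop g → Loop g → ℝ → ℂ, ∃ K : ι → Loop g → circleFun → Loop g,
      (∀ j, L j ∈ linOps (diffPoly id)) ∧ (∀ j, IsVecOp (diffPoly id) (K j)) ∧
      (∀ q (u : ι → circleFun) s, pair (∑ j, K j q (u j)) s =
        ∫ x in (0 : ℝ)..1, ∑ j, (u j).1 x * L j q s x) ∧
      ∀ F : Loop g → ℂ, IsLocal id F →
        ∀ q : affineLoops e (LinearMap.ker (LieAlgebra.ad ℂ g f)),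
        grad id (fun q => F (Φ q)) q.1 = ∑ j, K j q.1
          ⟨_, killing_mem_circleFun (grad Subtype.val (fun q : affineLoops e
            (LinearMap.ker (LieAlgebra.ad ℂ g f)) => F q.1) q) (constLoop (ξ j : g))⟩ := by
  have hη : ∀ j, ∃ η : g →ₗ[ℂ] ℂ, η ∘ₗ Submodule.subtype _ = ξ.coord j := fun j =>
    LinearMap.exists_extend _
  choose η hη using hη
  have hexp : ∀ x ∈ LinearMap.ker (LieAlgebra.ad ℂ g f), x = ∑ j, η j x • (ξ j : g) := by
    intro x hx
    have h1 := congrArg Subtype.val (ξ.sum_repr ⟨x, hx⟩)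
    rw [Submodule.coe_sum] at h1
    conv_lhs => rw [← show ((⟨x, hx⟩ : LinearMap.ker (LieAlgebra.ad ℂ g f)) : g) = x from rfl, ← h1]
    refine Finset.sum_congr rfl fun j _ => ?_
    have h2 := LinearMap.congr_fun (hη j) ⟨x, hx⟩
    simp only [LinearMap.comp_apply, Submodule.subtype_apply, Module.Basis.coord_apply] at h2
    rw [h2]
    rfl
  -- L_j is the linearization of the j-th coordinate of Φ, that is, a row of dΦ, and K_j is its
  -- formal adjoint.
  choose L hL L₂ hLin using fun j => exists_linearization_diffPoly (hΦ.isDiffMap (η j))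
  choose K hK hKL using fun j => exists_adjoint (isDiffAlg_diffPoly (id : Loop g → Loop g)) (hL j)
  obtain ⟨DΦ, hD⟩ := LoopReduction.exists_derivative
    (hΦ.isDiffMap.mono (diffPoly_le_densities id))
  have hpair : ∀ q (u : ι → circleFun) s, pair (∑ j, K j q (u j)) s =
      ∫ x in (0 : ℝ)..1, ∑ j, (u j).1 x * L j q s x := by
    intro q u s
    have h1 : ∀ j, (fun x => (u j).1 x * L j q s x) ∈ circleFun := fun j =>
      mul_mem (u j).2 (linOps_circleFun (isDiffAlg_diffPoly _) (hL j) q s)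
    rw [← pairing_apply, map_sum, LinearMap.sum_apply,
      intervalIntegral.integral_finsetSum fun j _ => intervalIntegrable_of_mem_circleFun (h1 j)]
    exact Finset.sum_congr rfl fun j _ => (hKL j q (u j) s).symm
  refine ⟨L, K, hL, hK, hpair, fun F hF q => ?_⟩
  have hDL : ∀ t x j, η j ((DΦ q.1 t).1 x) = L j q.1 t x := by
    intro t x j
    have h1 := (hD (isJetCurve_line q.1 t)).hasDerivAt_form (η j) x 0
    have h2 := ((hLin j).jet (isJetCurve_line q.1 t)).hasDerivAt 0 0 x
    simp only [iteratedDeriv_zero] at h2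
    have h3 := h1.unique h2
    rwa [zero_smul, add_zero] at h3
  -- Φ - e takes values in L(ker ad f), hence so does the derivative of Φ. Thus any gradient of F
  -- along Q may be used in the chain rule.
  have hDker : ∀ t, DΦ q.1 t ∈ loopsIn (LinearMap.ker (LieAlgebra.ad ℂ g f)) := by
    intro t
    have h1 := ((hD (isJetCurve_line q.1 t)).add (IsJetCurve.const (-constLoop e))).velocity_mem
      (W := LinearMap.ker (LieAlgebra.ad ℂ g f)) (fun τ => by
        rw [← sub_eq_add_neg]; exact hΦ.mem_ker _) 0
    rwa [zero_smul, add_zero, add_zero] at h1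
  have hreg := isRegular_of_isLocal hF
  refine eq_of_pair fun t => ?_
  have h1 := (isRegular_of_isLocal (hΦ.isLocal_lift hF)).chain (isJetCurve_line q.1 t) 0
  have h2 := hreg.chain (hD (isJetCurve_line q.1 t)) 0
  have h3 := h1.unique h2
  rw [zero_smul, add_zero, hΦ.fixed q.1 q.2] at h3
  have hgrad := HasGrad.restrict (i := fun q : affineLoops e
    (LinearMap.ker (LieAlgebra.ad ℂ g f)) => q.1) (hreg.hasGrad q.1)
  rw [h3, ← pair_eq_of_hasGrad (hasGrad_grad ⟨_, hgrad⟩) hgrad (hDker t)]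
  refine Eq.trans ?_ (hpair _ _ _).symm
  refine intervalIntegral.integral_congr fun x _ => ?_
  simp only [constLoop_apply]
  conv_lhs => rw [hexp _ (hDker t x), map_sum]
  refine Finset.sum_congr rfl fun j _ => ?_
  rw [map_smul, hDL, smul_eq_mul, mul_comm]

/-- The matrix differential operators of the reduced brackets. -/
theorem exists_operators (a : g) {ι : Type*} [Fintype ι]
    (ξ : Module.Basis ι ℂ (LinearMap.ker (LieAlgebra.ad ℂ g f))) :
    ∃ A₁ A₂ : ι → ι → ℕ →₀ diffPoly (Subtype.val :
        affineLoops e (LinearMap.ker (LieAlgebra.ad ℂ g f)) → Loop g),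
      ∀ c₁ c₂ : ℂ, ∀ F G : Loop g → ℂ, IsLocal id F → IsLocal id G →
        ∀ q : affineLoops e (LinearMap.ker (LieAlgebra.ad ℂ g f)),
        opBracket Subtype.val (fun j => (ξ j : g)) (c₂ • A₂ + c₁ • A₁) (fun q => F q.1)
          (fun q => G q.1) q =
        pair (grad id (fun q => F (Φ q)) q.1)
          (c₂ • P₂ ε q.1 (grad id (fun q => G (Φ q)) q.1) +
            c₁ • P₁ ε a q.1 (grad id (fun q => G (Φ q)) q.1)) := by
  obtain ⟨L, K, hL, hK, hKL, hgrad⟩ := hΦ.exists_grad_lift ξ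
  have hA := isDiffAlg_diffPoly (id : Loop g → Loop g)
  have hP := fun k => (hK k).pencil hA ε a (IsDiffMap.self id)
  -- The entries are the compositions L_j ∘ P_i ∘ K_k, which is the matrix of dΦ ∘ P_i ∘ (dΦ)*.
  choose A₂ hA₂ using fun j k => scalarOps_eq_sum ((hP k).1.comp_linOps hA (hL j))
  choose A₁ hA₁ using fun j k => scalarOps_eq_sum ((hP k).2.comp_linOps hA (hL j))
  refine ⟨fun j k => restrictOp _ (A₁ j k), fun j k => restrictOp _ (A₂ j k),
    fun c₁ c₂ F G hF hG q => ?_⟩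
  have hlin : ∀ (w : ι → circleFun) j x,
      L j q.1 (c₂ • P₂ ε q.1 (∑ k, K k q.1 (w k)) + c₁ • P₁ ε a q.1 (∑ k, K k q.1 (w k))) x =
      ∑ k, (c₂ * L j q.1 (P₂ ε q.1 (K k q.1 (w k))) x +
        c₁ * L j q.1 (P₁ ε a q.1 (K k q.1 (w k))) x) := by
    intro w j x
    rw [linOps_add (hL j), linOps_smul (hL j), linOps_smul (hL j), map_sum, map_sum,
      linOps_sum (hL j), linOps_sum (hL j), Finset.mul_sum, Finset.mul_sum,
      Finset.sum_add_distrib]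
  rw [hgrad F hF, hgrad G hG]
  refine Eq.trans ?_ (hKL _ _ _).symm
  refine intervalIntegral.integral_congr fun x _ => ?_
  refine Finset.sum_congr rfl fun j _ => ?_
  rw [hlin, Finset.mul_sum]
  refine Finset.sum_congr rfl fun k _ => ?_
  have h2 := hA₂ j k q.1
  have h1 := hA₁ j k q.1
  simp only [id] at h1 h2
  rw [h1, h2]
  exact sum_restrictOp _ (A₂ j k) (A₁ j k) c₂ c₁ q _ _ x _ rfl

end IsCrossSection

end

end LoopReduction

/-! ### The reduced brackets are Poisson brackets on Q. -/

namespace LoopReduction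

set_option linter.unusedSectionVars false

noncomputable section

variable {g : Type*} [LieRing g] [LieAlgebra ℂ g] [Module.Finite ℂ g]

theorem IsLocal.smul_add {F F' : Loop g → ℂ} (hF : IsLocal id F) (hF' : IsLocal id F') (c : ℂ) :
    IsLocal id (c • F + F') := by
  obtain ⟨p, hp, rfl⟩ := hF
  obtain ⟨p', hp', rfl⟩ := hF'
  have hA := isDiffAlg_densities (id : Loop g → Loop g)
  refine ⟨c • p + p', add_mem (Subalgebra.smul_mem _ hp c) hp', funext fun q => ?_⟩
  have h1 : IntervalIntegrable (fun x => c * p q x) MeasureTheory.volume 0 1 :=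
    (intervalIntegrable_of_mem_circleFun (hA.mem_circleFun p hp q)).const_mul c
  have h2 := intervalIntegrable_of_mem_circleFun (hA.mem_circleFun p' hp' q)
  change c * (∫ x in (0 : ℝ)..1, p q x) + ∫ x in (0 : ℝ)..1, p' q x =
    ∫ x in (0 : ℝ)..1, (c * p q x + p' q x)
  rw [intervalIntegral.integral_add h1 h2, intervalIntegral.integral_const_mul]

variable [LieAlgebra.IsKilling ℂ g]

namespace IsCrossSection

variable {gr : ℤ → Submodule ℂ g} {e h f : g} (H : IsGradedTriple gr e h f)
  {l : Submodule ℂ g} (hl : l ≤ gr (-1))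
  (hl_iso : ∀ x ∈ l, ∀ y ∈ l, killingForm ℂ g e ⁅x, y⁆ = 0) {ε : ℂ}
  {M Φ : Loop g → Loop g} (hΦ : IsCrossSection gr e f l ε M Φ)
  (hε : ε ≠ 0) {a : g} (ha : ∀ x ∈ lowerPart gr (coisotropic gr e l), ⁅a, x⁆ = 0) (lam : ℂ)
include H hl hΦ hε ha

theorem grad_bracket_lift_annihilates {F G : Loop g → ℂ} (hF : IsLocal id F) (hG : IsLocal id G)
    {s : Loop g} (hs : s ∈ affineLoops e (slice gr e l)) {m : Loop g}
    (hm : m ∈ loopsIn (lowerPart gr (coisotropic gr e l))) :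
    pair (grad id (bracket (pencil ε a lam) (fun q => F (Φ q)) fun q => G (Φ q)) s)
      (P₂ ε s m) = 0 :=
  grad_bracket_annihilates hε a lam ha e (hΦ.isLocal_lift hF) (hΦ.isLocal_lift hG)
    (fun _ hs _ hm => hΦ.grad_lift_annihilates H hl hε hF hs hm)
    (fun _ hs _ hm => hΦ.grad_lift_annihilates H hl hε hG hs hm) hs hm

include hl_iso

theorem bracket_lift_apply {F G : Loop g → ℂ} (hF : IsLocal id F) (hG : IsLocal id G)
    {s : Loop g} (hs : s ∈ affineLoops e (slice gr e l)) :
    bracket (pencil ε a lam) (fun q => F (Φ q)) (fun q => G (Φ q)) (Φ s) =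
      bracket (pencil ε a lam) (fun q => F (Φ q)) (fun q => G (Φ q)) s :=
  hΦ.apply_eq_of_annihilates H hl hl_iso hε
    (isLocal_bracket hε a lam (hΦ.isLocal_lift hF) (hΦ.isLocal_lift hG))
    (fun _ hs _ hm => hΦ.grad_bracket_lift_annihilates H hl hε ha lam hF hG hs hm) hs

/-- A bracket on `Q` that is given by the brackets of the lifts is a Poisson bracket. -/
theorem isPoisson
    {b : (affineLoops e (LinearMap.ker (LieAlgebra.ad ℂ g f)) → ℂ) →
      (affineLoops e (LinearMap.ker (LieAlgebra.ad ℂ g f)) → ℂ) →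
      affineLoops e (LinearMap.ker (LieAlgebra.ad ℂ g f)) → ℂ}
    (hb : ∀ F G : Loop g → ℂ, IsLocal id F → IsLocal id G →
      b (fun q => F q.1) (fun q => G q.1) =
        fun q => bracket (pencil ε a lam) (fun q => F (Φ q)) (fun q => G (Φ q)) q.1) :
    IsPoisson Subtype.val b := by
  have hloc := fun {F G : Loop g → ℂ} (hF : IsLocal id F) (hG : IsLocal id G) =>
    isLocal_bracket hε a lam (hΦ.isLocal_lift hF) (hΦ.isLocal_lift hG)
  have hgrad := fun {F : Loop g → ℂ} (hF : IsLocal id F) q =>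
    (isRegular_of_isLocal (hΦ.isLocal_lift hF)).hasGrad q
  refine ⟨fun F G h₁ h₂ => ?_, fun c F F' G h₁ h₁' h₂ => ?_, fun F G h₁ h₂ => ?_,
    fun F G K h₁ h₂ h₃ => ?_⟩
  · obtain ⟨F, hF, rfl⟩ := h₁.exists_extension
    obtain ⟨G, hG, rfl⟩ := h₂.exists_extension
    rw [hb F G hF hG]
    exact (hloc hF hG).comp ((IsDiffMap.self _).mono (diffPoly_le_densities _))
  · obtain ⟨F, hF, rfl⟩ := h₁.exists_extension
    obtain ⟨F', hF', rfl⟩ := h₁'.exists_extension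
    obtain ⟨G, hG, rfl⟩ := h₂.exists_extension
    have h1 := hb (c • F + F') G (hF.smul_add hF' c) hG
    refine h1.trans (funext fun q => ?_)
    rw [hb F G hF hG, hb F' G hF' hG]
    have h2 : grad id (fun q => (c • F + F') (Φ q)) q.1 =
        c • grad id (fun q => F (Φ q)) q.1 + grad id (fun q => F' (Φ q)) q.1 :=
      grad_eq ((hgrad hF q.1).smul_add (hgrad hF' q.1) c)
    change pair _ _ = c * pair _ _ + pair _ _
    rw [h2, pair_add_left, pair_smul_left]
  · obtain ⟨F, hF, rfl⟩ := h₁.exists_extension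
    obtain ⟨G, hG, rfl⟩ := h₂.exists_extension
    rw [hb F G hF hG, hb G F hG hF]
    funext q
    change pair _ _ = -pair _ _
    rw [← pair_pencil hε, pair_comm]
  · obtain ⟨F, hF, rfl⟩ := h₁.exists_extension
    obtain ⟨G, hG, rfl⟩ := h₂.exists_extension
    obtain ⟨K, hK, rfl⟩ := h₃.exists_extension
    -- The lift of the inner bracket is {G ∘ Φ, K ∘ Φ} ∘ Φ, which agrees with {G ∘ Φ, K ∘ Φ} on S
    -- but not on the whole loop algebra. As the latter also annihilates D, it may replace the
    -- former in the outer bracket.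
    have key : ∀ {F G K : Loop g → ℂ}, IsLocal id F → IsLocal id G → IsLocal id K → ∀ q,
        b (fun q => F q.1) (b (fun q => G q.1) fun q => K q.1) q =
          bracket (pencil ε a lam) (fun q => F (Φ q)) (bracket (pencil ε a lam)
            (fun q => G (Φ q)) fun q => K (Φ q)) q.1 := by
      intro F G K hF hG hK q
      have hqS := H.affineLoops_ker_subset hl q.2
      rw [hb G K hG hK, hb F _ hF (hloc hG hK)]
      have hfun : (fun s : affineLoops e (slice gr e l) => bracket (pencil ε a lam)
          (fun q => G (Φ q)) (fun q => K (Φ q)) (Φ s.1)) = fun s => bracket (pencil ε a lam)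
          (fun q => G (Φ q)) (fun q => K (Φ q)) s.1 :=
        funext fun s => hΦ.bracket_lift_apply H hl hl_iso hε ha lam hG hK s.2
      refine (pair_pencil_eq_bracket H hl hε ha lam (hΦ.isLocal_lift hF)
        (hΦ.isLocal_lift (hloc hG hK)) (s := ⟨q.1, hqS⟩)
        (fun m hm => hΦ.grad_lift_annihilates H hl hε hF hqS hm)
        (HasGrad.restrict (i := fun s : affineLoops e (slice gr e l) => s.1)
          (q := ⟨q.1, hqS⟩) (hgrad hF q.1)) (w := grad id (bracket (pencil ε a lam)
          (fun q => G (Φ q)) fun q => K (Φ q)) q.1) ?_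
        (fun m hm => hΦ.grad_bracket_lift_annihilates H hl hε ha lam hG hK hqS hm)).symm
      rw [hfun]
      exact HasGrad.restrict (i := fun s : affineLoops e (slice gr e l) => s.1)
          (q := ⟨q.1, hqS⟩) ((isRegular_of_isLocal (hloc hG hK)).hasGrad q.1)
    funext q
    change b _ _ q + b _ _ q + b _ _ q = 0
    rw [key hF hG hK, key hG hK hF, key hK hF hG]
    exact jacobi_bracket hε a lam (hΦ.isLocal_lift hF) (hΦ.isLocal_lift hG)
      (hΦ.isLocal_lift hK) q.1

end IsCrossSection

end

end LoopReduction

/-! ### The quotient N, its identification with Q, and the reduced brackets. -/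

namespace LoopReduction

set_option linter.unusedSectionVars false

noncomputable section

variable {g : Type*} [LieRing g] [LieAlgebra ℂ g] [Module.Finite ℂ g] [LieAlgebra.IsKilling ℂ g]

theorem momentum_level (n : Submodule ℂ g) (e : g) :
    {q | momentum n q = momentum n (constLoop e)} =
      affineLoops e ((killingForm ℂ g).orthogonal n) := by
  ext q
  refine ⟨fun hq => mem_orthogonal_of_pair fun m hm => ?_, fun hq => funext fun w => ?_⟩
  · rw [pair_sub_left, sub_eq_zero]
    exact congrFun hq ⟨m, hm⟩
  · rw [momentum, momentum, ← sub_eq_zero, ← pair_sub_left]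
    exact pair_eq_zero_of_mem_orthogonal hq w.2

namespace IsCrossSection

variable {gr : ℤ → Submodule ℂ g} {e h f : g} (H : IsGradedTriple gr e h f)
  {l : Submodule ℂ g} (hl : l ≤ gr (-1)) {ε : ℂ}
  {M Φ : Loop g → Loop g} (hΦ : IsCrossSection gr e f l ε M Φ)
  {rel : Loop g → Loop g → Prop} {D : Loop g → Submodule ℂ (Loop g)}
  (hrel : ∀ s t, rel s t ↔ s ∈ affineLoops e (slice gr e l) ∧
    t ∈ affineLoops e (slice gr e l) ∧ Φ s = Φ t)

/-- The reduced space is parametrized by `Q = e + L(ker ad f)`. -/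
def quotientEquiv :
    (Reduction.mk (affineLoops e (slice gr e l)) D rel).Space ≃
      affineLoops e (LinearMap.ker (LieAlgebra.ad ℂ g f)) where
  toFun := Quot.lift (fun s => ⟨Φ s.1, hΦ.mem_ker s.1⟩) fun s t hst =>
    Subtype.ext ((hrel s.1 t.1).1 hst).2.2
  invFun q := Quot.mk _ ⟨q.1, H.affineLoops_ker_subset hl q.2⟩
  left_inv := by
    rintro ⟨s⟩
    refine Quot.sound ((hrel _ _).2 ⟨H.affineLoops_ker_subset hl (hΦ.mem_ker _), s.2, ?_⟩)
    exact hΦ.fixed _ (hΦ.mem_ker _)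
  right_inv q := Subtype.ext (hΦ.fixed q.1 q.2)

theorem apply_proj (F : (Reduction.mk (affineLoops e (slice gr e l)) D rel).Space → ℂ)
    (s : affineLoops e (slice gr e l)) : F (Reduction.proj _ s) =
      (F ∘ (hΦ.quotientEquiv H hl hrel).symm) ⟨Φ s.1, hΦ.mem_ker s.1⟩ :=
  congrArg F ((hΦ.quotientEquiv H hl hrel).symm_apply_apply (Reduction.proj _ s)).symm

include hΦ in
theorem isDiffMap_restrict : IsDiffMap (diffPoly fun s : affineLoops e (slice gr e l) => s.1)
    fun s => Φ s.1 := IsDiffMap.comp (isDiffAlg_diffPoly _) hΦ.isDiffMap (IsDiffMap.self _)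

theorem isLocalQuot_iff (F : (Reduction.mk (affineLoops e (slice gr e l)) D rel).Space → ℂ) :
    Reduction.IsLocalQuot _ F ↔
      IsLocal Subtype.val (F ∘ (hΦ.quotientEquiv H hl hrel).symm) := by
  constructor
  · intro hF
    obtain ⟨F', hF', hFF'⟩ := IsLocal.exists_extension hF
    have h1 : F ∘ (hΦ.quotientEquiv H hl hrel).symm = fun q => F' q.1 :=
      funext fun q => congrFun hFF' ⟨q.1, H.affineLoops_ker_subset hl q.2⟩
    rw [h1]
    exact hF'.comp ((IsDiffMap.self _).mono (diffPoly_le_densities _))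
  · intro hF
    obtain ⟨F', hF', hFF'⟩ := hF.exists_extension
    have h1 : F ∘ Reduction.proj _ = fun s : affineLoops e (slice gr e l) => F' (Φ s.1) :=
      funext fun s => (hΦ.apply_proj H hl hrel F s).trans (congrFun hFF' _)
    unfold Reduction.IsLocalQuot
    rw [h1]
    exact hF'.comp (hΦ.isDiffMap_restrict.mono (diffPoly_le_densities _))

theorem exists_extension_quot
    {F : (Reduction.mk (affineLoops e (slice gr e l)) D rel).Space → ℂ}
    (hF : Reduction.IsLocalQuot _ F) : ∃ F' : Loop g → ℂ, IsLocal id F' ∧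
      (F ∘ (hΦ.quotientEquiv H hl hrel).symm = fun q => F' q.1) ∧
      F ∘ Reduction.proj _ = fun s : affineLoops e (slice gr e l) => F' (Φ s.1) := by
  obtain ⟨F', hF', hFF'⟩ := ((hΦ.isLocalQuot_iff H hl hrel F).1 hF).exists_extension
  exact ⟨F', hF', hFF', funext fun s => (hΦ.apply_proj H hl hrel F s).trans (congrFun hFF' _)⟩

include H hl hΦ hrel in
/-- The coordinates of the cross section generate the ring of invariants. -/
theorem invDiffPoly_eq : (Reduction.mk (affineLoops e (slice gr e l)) D rel).invDiffPoly =
    diffPoly fun s : affineLoops e (slice gr e l) => Φ s.1 := by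
  refine le_antisymm ?_ ?_
  · rintro p ⟨hp, hinv⟩
    obtain ⟨P, hP, hpP⟩ := exists_extension_diffPoly hp
    -- Since s and Φ(s) are equivalent, an invariant takes the same value on both, so it is its own
    -- extension composed with Φ.
    have h1 : p = fun s : affineLoops e (slice gr e l) => P (Φ s.1) := by
      funext s
      have hs := H.affineLoops_ker_subset hl (hΦ.mem_ker s.1)
      rw [hinv s ⟨_, hs⟩ ((hrel _ _).2 ⟨s.2, hs, (hΦ.fixed _ (hΦ.mem_ker _)).symm⟩), hpP]
    rw [h1]
    exact (IsDiffMap.self _).comp_diffPoly (isDiffAlg_diffPoly _) hP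
  · intro p hp
    obtain ⟨P, hP, rfl⟩ := exists_extension_diffPoly hp
    refine ⟨hΦ.isDiffMap_restrict.comp_diffPoly (isDiffAlg_diffPoly _) hP, fun s t hst => ?_⟩
    change P (Φ s.1) = P (Φ t.1)
    rw [((hrel s.1 t.1).1 hst).2.2]

/-- Invariant densities are the differential polynomials in the coordinates of Φ; on Q, where Φ is
the identity, they become plain differential polynomials. -/
theorem exists_invDensity {F : (Reduction.mk (affineLoops e (slice gr e l)) D rel).Space → ℂ}
    (hF : Reduction.HasInvDensity _ F) : ∃ P ∈ diffPoly (id : Loop g → Loop g),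
      F ∘ (hΦ.quotientEquiv H hl hrel).symm = fun q => functionalOf P q.1 := by
  obtain ⟨p, hp, hFp⟩ := hF
  rw [hΦ.invDiffPoly_eq H hl hrel] at hp
  obtain ⟨P, hP, rfl⟩ := exists_extension_diffPoly hp
  refine ⟨P, hP, funext fun q => (congrFun hFp ⟨q.1, H.affineLoops_ker_subset hl q.2⟩).trans ?_⟩
  change functionalOf P (Φ q.1) = functionalOf P q.1
  rw [hΦ.fixed q.1 q.2]

theorem hasInvDensity {b : affineLoops e (LinearMap.ker (LieAlgebra.ad ℂ g f)) → ℂ}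
    {P : Loop g → ℝ → ℂ} (hP : P ∈ diffPoly (id : Loop g → Loop g))
    (hb : ∀ q, b q = functionalOf P q.1) :
    Reduction.HasInvDensity _ (b ∘ hΦ.quotientEquiv H hl (D := D) hrel) := by
  refine ⟨fun s => P (Φ s.1), ?_, funext fun s => hb _⟩
  rw [hΦ.invDiffPoly_eq H hl hrel]
  exact (IsDiffMap.self _).comp_diffPoly (isDiffAlg_diffPoly _) hP

variable (hl_iso : ∀ x ∈ l, ∀ y ∈ l, killingForm ℂ g e ⁅x, y⁆ = 0)
  (hε : ε ≠ 0) {a : g} (ha : ∀ x ∈ lowerPart gr (coisotropic gr e l), ⁅a, x⁆ = 0)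
  (hD : ∀ q, D q = (loopsIn (lowerPart gr (coisotropic gr e l))).map (P₂ ε q))
include H hl hΦ hε hD

include hrel in
theorem exists_lift {F : (Reduction.mk (affineLoops e (slice gr e l)) D rel).Space → ℂ}
    (hF : Reduction.IsLocalQuot _ F) : ∃ F', Reduction.IsLift _ F F' := by
  obtain ⟨F', hF', -, hFF'⟩ := hΦ.exists_extension_quot H hl hrel hF
  refine ⟨fun q => F' (Φ q), hΦ.isLocal_lift hF', fun s => (congrFun hFF' s).symm,
    fun s v hv => ?_⟩
  change v ∈ D s at hv
  rw [hD] at hv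
  obtain ⟨m, hm, rfl⟩ := hv
  exact hΦ.grad_lift_annihilates H hl hε hF' s.2 hm

include hl_iso ha

/-- The bracket of the canonical lifts has equal values at s and Φ(s), and at s it may be computed
from any representatives. -/
theorem quotient_bracket_eq (lam : ℂ)
    {b : (affineLoops e (LinearMap.ker (LieAlgebra.ad ℂ g f)) → ℂ) →
      (affineLoops e (LinearMap.ker (LieAlgebra.ad ℂ g f)) → ℂ) →
      affineLoops e (LinearMap.ker (LieAlgebra.ad ℂ g f)) → ℂ}
    (hb : ∀ F G : Loop g → ℂ, IsLocal id F → IsLocal id G →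
      b (fun q => F q.1) (fun q => G q.1) =
        fun q => bracket (pencil ε a lam) (fun q => F (Φ q)) (fun q => G (Φ q)) q.1)
    {F G : (Reduction.mk (affineLoops e (slice gr e l)) D rel).Space → ℂ}
    (hF : Reduction.IsLocalQuot _ F) (hG : Reduction.IsLocalQuot _ G)
    (s : affineLoops e (slice gr e l)) {v w : Loop g}
    (hv : HasGrad Subtype.val (F ∘ Reduction.proj _) s v)
    (hw : HasGrad Subtype.val (G ∘ Reduction.proj _) s w)
    (hwD : ∀ z ∈ D s.1, pair w z = 0) :
    b (F ∘ (hΦ.quotientEquiv H hl hrel).symm) (G ∘ (hΦ.quotientEquiv H hl hrel).symm)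
      (hΦ.quotientEquiv H hl (D := D) hrel (Reduction.proj _ s)) =
        pair v (pencil ε a lam s.1 w) := by
  obtain ⟨F', hF', hFQ, hFS⟩ := hΦ.exists_extension_quot H hl hrel hF
  obtain ⟨G', hG', hGQ, hGS⟩ := hΦ.exists_extension_quot H hl hrel hG
  rw [hFQ, hGQ, hb F' G' hF' hG']
  refine (hΦ.bracket_lift_apply H hl hl_iso hε ha lam hF' hG' s.2).trans ?_
  rw [hFS] at hv
  rw [hGS] at hw
  exact (pair_pencil_eq_bracket H hl hε ha lam (hΦ.isLocal_lift hF') (hΦ.isLocal_lift hG')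
    (fun m hm => hΦ.grad_lift_annihilates H hl hε hF' s.2 hm) hv hw
    (fun m hm => hwD _ (by rw [hD]; exact Submodule.mem_map_of_mem hm))).symm

theorem isReducedBracket (lam : ℂ)
    {b : (affineLoops e (LinearMap.ker (LieAlgebra.ad ℂ g f)) → ℂ) →
      (affineLoops e (LinearMap.ker (LieAlgebra.ad ℂ g f)) → ℂ) →
      affineLoops e (LinearMap.ker (LieAlgebra.ad ℂ g f)) → ℂ}
    (hb : ∀ F G : Loop g → ℂ, IsLocal id F → IsLocal id G →
      b (fun q => F q.1) (fun q => G q.1) =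
        fun q => bracket (pencil ε a lam) (fun q => F (Φ q)) (fun q => G (Φ q)) q.1)
    {F G : (Reduction.mk (affineLoops e (slice gr e l)) D rel).Space → ℂ}
    (hF : Reduction.IsLocalQuot _ F) (hG : Reduction.IsLocalQuot _ G) :
    Reduction.IsReducedBracket _ (pencil ε a lam) F G
      (b (F ∘ (hΦ.quotientEquiv H hl hrel).symm) (G ∘ (hΦ.quotientEquiv H hl hrel).symm) ∘
        hΦ.quotientEquiv H hl (D := D) hrel) := by
  rintro F' G' ⟨hF', hF'S, hF'D⟩ ⟨hG', hG'S, hG'D⟩ s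
  have key : ∀ {F : (Reduction.mk (affineLoops e (slice gr e l)) D rel).Space → ℂ}
      {F' : Loop g → ℂ}, IsLocal id F' → (∀ s : affineLoops e (slice gr e l), F' s.1 =
        F (Reduction.proj _ s)) → HasGrad Subtype.val (F ∘ Reduction.proj _) s (grad id F' s.1) := by
    intro F F' hF' hF'S
    have h1 : F ∘ Reduction.proj _ = fun s : affineLoops e (slice gr e l) => F' s.1 :=
      funext fun s => (hF'S s).symm
    rw [h1]
    exact HasGrad.restrict (i := fun s : affineLoops e (slice gr e l) => s.1)
      ((isRegular_of_isLocal hF').hasGrad s.1)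
  exact (hΦ.quotient_bracket_eq H hl hrel hl_iso hε ha hD lam hb hF hG s (key hF' hF'S)
    (key hG' hG'S) (hG'D s)).symm

end IsCrossSection

end

end LoopReduction

/-! ### The theorem. -/

theorem theorem1p1
    {g : Type*} [LieRing g] [LieAlgebra ℂ g] [Module.Finite ℂ g] [LieAlgebra.IsSimple ℂ g]
    -- a nilpotent element, a good grading, a compatible `sl₂`-triple
    (e h f : g) (hf : IsNilpotent (LieAlgebra.ad ℂ g f))
    (gr : ℤ → Submodule ℂ g) (hgr : IsGoodGrading gr f)
    (hef : ⁅e, f⁆ = h) (hhe : ⁅h, e⁆ = (2 : ℂ) • e) (hhf : ⁅h, f⁆ = (-2 : ℂ) • f)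
    (h_mem : h ∈ gr 0) (e_mem : e ∈ gr 2)
    -- an isotropic subspace and the subspaces it defines
    (l : Submodule ℂ g) (hl : l ≤ gr (-1))
    (hl_iso : ∀ x ∈ l, ∀ y ∈ l, killingForm ℂ g e ⁅x, y⁆ = 0)
    (gneg n b gf : Submodule ℂ g)
    (hgneg : gneg = lowerPart gr l) (hn : n = lowerPart gr (coisotropic gr e l))
    (hb : b = (killingForm ℂ g).orthogonal n) (hgf : gf = LinearMap.ker (LieAlgebra.ad ℂ g f))
    -- an element centralizing `n`, the parameter of the brackets, a basis of the kernel of `ad f`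
    (a : g) (ha : ∀ x ∈ n, ⁅a, x⁆ = 0) (ε : ℂ) (hε : ε ≠ 0)
    {ι : Type*} [Fintype ι] (ξ : Module.Basis ι ℂ gf)
    -- the two reductions, the affine loop space `Q = e + L(g_f)` and its inclusion
    (DS Bih : Reduction g) (hDS : DS = dsReduction ε n e) (hBih : Bih = bihReduction ε a n e)
    (Q : Set (Loop g)) (hQ : Q = affineLoops e gf)
    (iQ : Q → Loop g) (hiQ : iQ = Subtype.val) :
    -- local functionals are differentiable, with a unique gradient on the loop algebra
    (∀ F : Loop g → ℂ, IsLocal id F → ∀ q, ∃! v, HasGrad id F q v) ∧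
    (∀ F : Q → ℂ, IsLocal iQ F → ∀ q, ∃ v, HasGrad iQ F q v) ∧
    -- the action of the adjoint group of `L(n)` is Hamiltonian for the whole pencil, with
    -- equivariant momentum map, and the isotropy group of `e` is the adjoint group of `L(gneg)`
    (∀ m : loopsIn n, ∀ q lam, IsVelocity (fun t : ℝ => gaugeBy ε ((t : ℂ) • (m : Loop g)) q) 0
      (pencil ε a lam q (grad id (fun r => ε * momentum n r m) q))) ∧
    (∀ u ∈ adjointGroup n, ∀ q, ∀ w : loopsIn n, ∃ w' : loopsIn n, (w' : Loop g) = adAct u⁻¹ w ∧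
      momentum n (act ε u q) w = momentum n q w') ∧
    isotropy n e = (adjointGroup gneg : Set (Module.End ℂ (ℂ × Loop g))ˣ) ∧
    -- the set of Casimirs is closed under the second bracket
    (∀ K ∈ casimirs ε a n, ∀ K' ∈ casimirs ε a n, bracket (P₂ ε) K K' ∈ casimirs ε a n) ∧
    -- the two reductions are the same
    DS = Bih ∧
    -- both are the quotient of `S = e + L(b)` by the gauge action of the adjoint group of `L(gneg)`
    DS.S = affineLoops e b ∧
    (∀ q, DS.D q = (loopsIn n).map (P₂ ε q)) ∧
    (∀ s ∈ DS.S, DS.D s ⊓ loopsIn b = (loopsIn gneg).map (P₂ ε s)) ∧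
    (∀ s t, DS.rel s t ↔ s ∈ DS.S ∧ t ∈ DS.S ∧ ∃ u ∈ adjointGroup gneg, t = act ε u s) ∧
    -- `Q` is transversal to the leaves and is a cross section of the action
    Q ⊆ DS.S ∧
    (∀ q ∈ Q, (loopsIn gneg).map (P₂ ε q) ⊓ loopsIn gf = ⊥ ∧
      (loopsIn gneg).map (P₂ ε q) ⊔ loopsIn gf = loopsIn b) ∧
    (∀ s ∈ DS.S, ∃! m, m ∈ loopsIn gneg ∧ gaugeBy ε m s ∈ Q) ∧
    ∃ Ψ : DS.Space ≃ Q,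
      (∀ s : DS.S, ∃ m ∈ loopsIn gneg, iQ (Ψ (DS.proj s)) = gaugeBy ε m s) ∧
      -- the coordinates of `Q` generate the ring of invariant differential polynomials
      DS.invDiffPoly = diffPoly (fun s : DS.S => iQ (Ψ (DS.proj s))) ∧
      (∀ F : DS.Space → ℂ, DS.IsLocalQuot F ↔ IsLocal iQ (F ∘ Ψ.symm)) ∧
      (∀ F : DS.Space → ℂ, DS.IsLocalQuot F → ∃ F', DS.IsLift F F') ∧
      -- the reduced brackets form a local bihamiltonian structure on `Q`
      ∃ A₁ A₂ : ι → ι → ℕ →₀ diffPoly iQ,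
        (∀ lam : ℂ, IsPoisson iQ (opBracket iQ (fun j => (ξ j : g)) (A₂ + lam • A₁))) ∧
        (∀ (lam : ℂ) (F G : DS.Space → ℂ), DS.IsLocalQuot F → DS.IsLocalQuot G →
          DS.IsReducedBracket (pencil ε a lam) F G
            (opBracket iQ (fun j => (ξ j : g)) (A₂ + lam • A₁) (F ∘ Ψ.symm) (G ∘ Ψ.symm) ∘ Ψ)) ∧
        -- they are computed on `S` from the variational derivatives along `S`, by the Leibniz rule
        (∀ (lam : ℂ) (F G : DS.Space → ℂ), DS.IsLocalQuot F → DS.IsLocalQuot G →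
          ∀ (s : DS.S) (v w : Loop g), HasGrad (fun s : DS.S => (s : Loop g)) (F ∘ DS.proj) s v →
            HasGrad (fun s : DS.S => (s : Loop g)) (G ∘ DS.proj) s w →
            (∀ z ∈ DS.D s, pair v z = 0 ∧ pair w z = 0) →
            opBracket iQ (fun j => (ξ j : g)) (A₂ + lam • A₁) (F ∘ Ψ.symm) (G ∘ Ψ.symm)
              (Ψ (DS.proj s)) = pair v (pencil ε a lam s w)) ∧
        -- functionals with densities in the ring of invariants are closed under both brackets
        (∀ F G : DS.Space → ℂ, DS.HasInvDensity F → DS.HasInvDensity G →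
          DS.HasInvDensity
            (opBracket iQ (fun j => (ξ j : g)) A₁ (F ∘ Ψ.symm) (G ∘ Ψ.symm) ∘ Ψ) ∧
          DS.HasInvDensity
            (opBracket iQ (fun j => (ξ j : g)) A₂ (F ∘ Ψ.symm) (G ∘ Ψ.symm) ∘ Ψ)) := by
  have H : IsGradedTriple gr e h f := ⟨hgr, hef, hhe, hhf, e_mem⟩
  subst hb hgneg hn hgf hQ hiQ
  have hnle : lowerPart gr (coisotropic gr e l) ≤ below gr (-1) :=
    H.lowerPart_le (H.coisotropic_le l)
  have hn2 : below gr (-2) ≤ lowerPart gr (coisotropic gr e l) :=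
    H.below_le_lowerPart (H.coisotropic_le l)
  have hnn : ∀ x ∈ lowerPart gr (coisotropic gr e l), ∀ y ∈ lowerPart gr (coisotropic gr e l),
      ⁅x, y⁆ ∈ lowerPart gr (coisotropic gr e l) := fun x hx y hy =>
    H.lie_mem_lowerPart (hnle hx) (hnle hy)
  have hSDS : (dsReduction ε (lowerPart gr (coisotropic gr e l)) e).S =
      affineLoops e (slice gr e l) := momentum_level _ e
  have hDDS := fun q => H.dsReduction_D hε hnle q
  obtain ⟨M, Φ, hΦ⟩ := H.exists_crossSection hl ε
  have hDrel : ∀ s t, (dsReduction ε (lowerPart gr (coisotropic gr e l)) e).rel s t ↔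
      s ∈ affineLoops e (slice gr e l) ∧ t ∈ affineLoops e (slice gr e l) ∧
        ∃ u ∈ adjointGroup (lowerPart gr l), t = act ε u s := by
    intro s t
    rw [← hSDS]
    have := H.isotropy_eq hl hl_iso
    simp only [dsReduction, this]
    rfl
  have hrel : ∀ s t, (dsReduction ε (lowerPart gr (coisotropic gr e l)) e).rel s t ↔
      s ∈ affineLoops e (slice gr e l) ∧ t ∈ affineLoops e (slice gr e l) ∧ Φ s = Φ t := by
    intro s t
    rw [hDrel]
    refine and_congr_right fun hs => and_congr_right fun ht => ?_
    rw [H.exists_act_iff (H.below_le_lowerPart hl) (H.lowerPart_le hl), hΦ.eq_iff H hl hs ht]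
  -- S and D agree by the computation of the Casimirs; the two equivalence relations agree because
  -- each is equality of Φ on S.
  have hDSBih : DS = Bih := by
    have hS' := levelSurface_casimirs hε a ha e
    have hD' := hamDistribution_casimirs hε a ha
    rw [hDS, hBih, bihReduction, hS', funext hD']
    have h1 : dsReduction ε (lowerPart gr (coisotropic gr e l)) e =
        ⟨(dsReduction ε (lowerPart gr (coisotropic gr e l)) e).S,
          (dsReduction ε (lowerPart gr (coisotropic gr e l)) e).D,
          (dsReduction ε (lowerPart gr (coisotropic gr e l)) e).rel⟩ := rfl
    rw [h1, hSDS, funext hDDS]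
    congr 1
    funext s t
    rw [hrel, hΦ.sameLeaf_iff H hl hl_iso hε fun q => rfl]
  obtain ⟨S, D, rel⟩ := DS
  have hS : S = affineLoops e (slice gr e l) := (congrArg Reduction.S hDS).trans hSDS
  have hD : ∀ q, D q = (loopsIn (lowerPart gr (coisotropic gr e l))).map (P₂ ε q) := fun q =>
    (congrFun (congrArg Reduction.D hDS) q).trans (hDDS q)
  have hr : rel = (dsReduction ε (lowerPart gr (coisotropic gr e l)) e).rel :=
    congrArg Reduction.rel hDS
  rw [← hr] at hrel hDrel
  subst hS
  refine ⟨fun F hF q => ?_, fun F hF q => ?_, fun m q lam => H.isVelocity_momentum hε hnle ha m q lam,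
    fun u hu q w => H.momentum_act hn2 hnle hnn ε hu q w, H.isotropy_eq hl hl_iso,
    fun K hK K' hK' => casimirs_bracket hε a hnn ha hK hK', hDSBih, rfl, hD,
    fun s hs => ?_, hDrel, H.affineLoops_ker_subset hl, fun q hq => H.transversality hl hε hq,
    fun s hs => ⟨M s, ⟨hΦ.mem s hs, ?_⟩, fun m hm => hΦ.unique s hs m hm.1 hm.2⟩, ?_⟩
  · have h1 := (isRegular_of_isLocal hF).hasGrad q
    exact ⟨_, h1, fun v hv => hasGrad_unique hv h1⟩
  · obtain ⟨F', hF', rfl⟩ := hF.exists_extension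
    exact ⟨_, ((isRegular_of_isLocal hF').hasGrad q.1).restrict⟩
  · change D s ⊓ _ = _
    rw [hD]
    exact H.map_inf_slice hl hl_iso hε hs
  · rw [← hΦ.eq s hs]
    exact hΦ.mem_ker s
  obtain ⟨A₁, A₂, hA⟩ := hΦ.exists_operators a ξ
  have hb : ∀ (lam : ℂ) (F G : Loop g → ℂ), IsLocal id F → IsLocal id G →
      opBracket Subtype.val (fun j => (ξ j : g)) (A₂ + lam • A₁) (fun q => F q.1)
        (fun q => G q.1) =
      fun q => bracket (pencil ε a lam) (fun q => F (Φ q)) (fun q => G (Φ q)) q.1 := by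
    intro lam F G hF hG
    funext q
    have := hA lam 1 F G hF hG q
    rw [one_smul, one_smul] at this
    exact this
  refine ⟨hΦ.quotientEquiv H hl hrel, fun s => ⟨M s.1, hΦ.mem s.1 s.2, hΦ.eq s.1 s.2⟩,
    hΦ.invDiffPoly_eq H hl hrel, fun F => hΦ.isLocalQuot_iff H hl hrel F,
    fun F hF => hΦ.exists_lift H hl hrel hε hD hF, A₁, A₂,
    fun lam => hΦ.isPoisson H hl hl_iso hε ha lam (hb lam),
    fun lam F G hF hG => hΦ.isReducedBracket H hl hrel hl_iso hε ha hD lam (hb lam) hF hG,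
    fun lam F G hF hG s v w hv hw hz => hΦ.quotient_bracket_eq H hl hrel hl_iso hε ha hD lam
      (hb lam) hF hG s hv hw fun z hz' => (hz z hz').2, fun F G hF hG => ?_⟩
  obtain ⟨P, hP, hFP⟩ := hΦ.exists_invDensity H hl hrel hF
  obtain ⟨R, hR, hGR⟩ := hΦ.exists_invDensity H hl hrel hG
  rw [hFP, hGR]
  have hA' := isDiffAlg_diffPoly (id : Loop g → Loop g)
  have hloc := fun {P : Loop g → ℝ → ℂ} (hP : P ∈ diffPoly (id : Loop g → Loop g)) =>
    (⟨P, diffPoly_le_densities _ hP, rfl⟩ : IsLocal id (functionalOf P))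
  have hreg := fun {P : Loop g → ℝ → ℂ} (hP : P ∈ diffPoly (id : Loop g → Loop g)) =>
    isRegular_of_diffPoly (hΦ.isDiffMap.comp_diffPoly hA' hP)
  have hPF := (hreg hP).isDiffMap
  have hPG := (hreg hR).isDiffMap
  constructor
  · refine hΦ.hasInvDensity H hl hrel (hPF.bilin (killingForm ℂ g)
      (((IsDiffMap.const a).br hPG).const_smul ε⁻¹)) fun q => ?_
    -- The coefficients c₁ = 1, c₂ = 0 isolate A₁, the bracket of P₁ alone, which is not a member of
    -- the pencil P₂ + λP₁.
    have := hA 1 0 _ _ (hloc hP) (hloc hR) q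
    rw [zero_smul, one_smul, zero_add, zero_smul, zero_add, one_smul] at this
    exact this
  · obtain ⟨p, hp, hpb⟩ := bracket_mem hε a 0 hA' (IsDiffMap.self id) hPF hPG
    refine hΦ.hasInvDensity H hl hrel hp fun q => ?_
    have := congrFun (hb 0 _ _ (hloc hP) (hloc hR)) q
    rw [zero_smul, add_zero] at this
    rw [this]
    exact congrFun hpb q.1
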